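/- Let $\mathsf{fab}$ be the category of finitely generated free abelian groups. For a commutative ring $R$, consider functors $F$ from $\mathsf{fab}$ to finitely generated $R$-modules, not necessarily additive, such that $F(0)=0$ for every zero morphism $0$. Given $A=A_1\oplus\dots\oplus A_m$ in $\mathsf{fab}$, let $e_k:A\to A$ be the composite of the projection onto $A_k$ and the inclusion of $A_k$, and define endomorphisms $f(S)$ of $F(A)$ for nonempty $S\subseteq\{1,\dots,m\}$ recursively by $$f(S)=F\Big(\sum_{k\in S}e_k\Big)-\sum_{\emptyset\ne T\subsetneq S}f(T).$$ The image $F_m(A_1|\dots|A_m)$ of $f(\{1,\dots,m\})$ is the value of the $m$-th cross-effect of $F$. A \emph{cubic $R$-module} is such a functor $F$ with $F_m=0$ for all $m>3$ (polynomial of degree at most $3$); it is \emph{weakly alternative} if $F(\mathbb Z)=0$. Isomorphisms are natural isomorphisms, a cubic module means a cubic $\mathbb Z$-module, and tensor products, torsion and direct sums are taken valuewise. For a prime $p$ put $\mathbb Z_{(p)}=\{a/b : a,b\in\mathbb Z,\ p\nmid b\}$ and $M_{(p)}=\mathbb Z_{(p)}\otimes M$; $F$ is torsion free if all its values are, and $\mathrm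 tF\subseteq F$ is the subfunctor of torsion elements. 1. Weakly alternative cubic modules $M,N$ are isomorphic if and only if $M_{(p)}\simeq N_{(p)}$ for every prime $p$. 2. For each prime $p$ let $N_p$ be a weakly alternative cubic $\mathbb Z_{(p)}$-module. There is a weakly alternative cubic module $M$ with $M_{(p)}\simeq N_p$ for all $p$ if and only if all but finitely many of the $N_p$ are torsion free (possibly zero) and $\mathbb Q\otimes N_p\simeq\mathbb Q\otimes N_q$ for all primes $p,q$. In this case, every such $M$ satisfies $\mathbb Q\otimes M\simeq\mathbb Q\otimes N_p$ for every prime $p$, and $\mathrm tM\simeq\bigoplus_p\mathrm tN_p$ as functors from $\mathsf{fab}$ to abelian groups. -/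

import Mathlib

open CategoryTheory DirectSum

universe u

noncomputable section

namespace CubicFunctor

/-! ### Polynomial functors on finitely generated free abelian groups -/

/-- The finitely generated free abelian groups. -/
def isFab : ObjectProperty (ModuleCat.{0} ℤ) :=
  fun A => Module.Finite ℤ A ∧ Module.Free ℤ A

/-- The category `fab` of finitely generated free abelian groups and all homomorphisms. -/
abbrev Fab := isFab.FullSubcategory

instance (A : Fab) : Module.Finite ℤ A.obj := A.property.1

instance (A : Fab) : Module.Free ℤ A.obj := A.property.2

/-- A finitely generated free abelian group as an object of `fab`. -/
abbrev Fab.of (V : Type) [AddCommGroup V] [Module ℤ V] [Module.Finite ℤ V] [Module.Free ℤ V] :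
    Fab :=
  ⟨ModuleCat.of ℤ V, ‹Module.Finite ℤ V›, ‹Module.Free ℤ V›⟩

/-- The direct sum `A₁ ⊕ ⋯ ⊕ Aₘ`. -/
abbrev Fab.sum {m : ℕ} (A : Fin m → Fab) : Fab :=
  letI : Module ℤ (∀ k, (A k).obj) := Pi.module _ _ _
  Fab.of (∀ k, (A k).obj)

/-- The endomorphism `∑_{k ∈ S} e_k` of `A₁ ⊕ ⋯ ⊕ Aₘ`, where `e_k = i_k p_k` is the projection
onto the `k`-th summand followed by its inclusion. -/
def idemSum {m : ℕ} (A : Fin m → Fab) (S : Finset (Fin m)) : Fab.sum A ⟶ Fab.sum A :=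
  letI : Module ℤ (∀ k, (A k).obj) := Pi.module _ _ _
  ObjectProperty.homMk (ModuleCat.ofHom
    (∑ k ∈ S, LinearMap.single ℤ (fun k => ((A k).obj : Type)) k ∘ₗ LinearMap.proj k))

variable {R : Type} [CommRing R]

/-- `F` sends zero morphisms to zero morphisms. -/
def Reduced (F : Fab ⥤ ModuleCat.{u} R) : Prop :=
  ∀ A B : Fab, F.map (0 : A ⟶ B) = 0

/-- The endomorphism `f(k₁ ⋯ k_r)` of `F(A₁ ⊕ ⋯ ⊕ Aₘ)`, for `S = {k₁ < ⋯ < k_r}`, in closed form.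
It satisfies the recursion `f(S) = F(∑_{k ∈ S} e_k) - ∑_{∅ ≠ T ⊂ S} f(T)`, which characterizes it:
see `crossIdem_eq`. -/
def crossIdem (F : Fab ⥤ ModuleCat.{u} R) {m : ℕ} (A : Fin m → Fab) (S : Finset (Fin m)) :
    F.obj (Fab.sum A) ⟶ F.obj (Fab.sum A) :=
  ∑ T ∈ S.powerset, (-1 : ℤ) ^ (S \ T).card • F.map (idemSum A T)

/-- The value `F_m(A₁ | ⋯ | Aₘ)` of the `m`-th cross-effect: the image of `f(1 2 ⋯ m)`. -/
def crossEffect (F : Fab ⥤ ModuleCat.{u} R) {m : ℕ} (A : Fin m → Fab) :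
    Submodule R (F.obj (Fab.sum A)) :=
  LinearMap.range (crossIdem F A Finset.univ).hom

/-- `F` is polynomial of degree at most `n`: its `m`-th cross-effects vanish for all `m > n`. -/
def DegreeLE (F : Fab ⥤ ModuleCat.{u} R) (n : ℕ) : Prop :=
  ∀ m : ℕ, n < m → ∀ A : Fin m → Fab, crossEffect F A = ⊥

/-- Weakly alternative cubic `R`-modules: the functors from `fab` to finitely generated
`R`-modules that send zero morphisms to zero, are polynomial of degree at most `3` and
vanish on `ℤ`. -/
structure IsWeaklyAlternative (F : Fab ⥤ ModuleCat.{u} R) : Prop where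
  finite : ∀ A : Fab, Module.Finite R (F.obj A)
  reduced : Reduced F
  cubic : DegreeLE F 3
  vanish : Subsingleton (F.obj (Fab.of ℤ))

/-- `F` is torsion free: all its values are torsion free `R`-modules. -/
def IsTorsionFree (F : Fab ⥤ ModuleCat.{u} R) : Prop :=
  ∀ A : Fab, Module.IsTorsionFree R (F.obj A)

/-- The torsion part `tF`: the subfunctor `A ↦ {x ∈ F(A) | a x = 0 for some regular a ∈ R}`. -/
def torsion (F : Fab ⥤ ModuleCat.{u} R) : Fab ⥤ ModuleCat.{u} R where
  obj A := ModuleCat.of R (Submodule.torsion R (F.obj A))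
  map {A B} φ := ModuleCat.ofHom <| (F.map φ).hom.restrict
    (p := Submodule.torsion R (F.obj A)) (q := Submodule.torsion R (F.obj B)) <| by
      rintro x ⟨a, ha⟩
      refine ⟨a, ?_⟩
      have h : (F.map φ).hom ((a : R) • x) = 0 := by
        rw [show (a : R) • x = 0 from ha, map_zero]
      rw [map_smul] at h
      exact h
  map_id A := by
    refine ModuleCat.hom_ext (LinearMap.ext fun x => Subtype.ext ?_)
    exact congrArg (fun f => f.hom (x : F.obj A)) (F.map_id A)
  map_comp {A B C} φ ψ := by
    refine ModuleCat.hom_ext (LinearMap.ext fun x => Subtype.ext ?_)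
    exact congrArg (fun f => f.hom (x : F.obj A)) (F.map_comp φ ψ)

/-- The pointwise direct sum of a family of functors. -/
def directSum {ι : Type} (G : ι → Fab ⥤ ModuleCat.{u} R) : Fab ⥤ ModuleCat.{u} R where
  obj A := ModuleCat.of R (⨁ i, (G i).obj A)
  map φ := ModuleCat.ofHom (DirectSum.lmap fun i => ((G i).map φ).hom)
  map_id A := by
    ext x : 2
    simp
  map_comp φ ψ := by
    ext x : 2
    simp [DirectSum.lmap_comp]

/-- The functor `S ⊗_R F` for a commutative `R`-algebra `S`. -/
abbrev baseChange (S : Type) [CommRing S] [Algebra R S] (F : Fab ⥤ ModuleCat.{u} R) :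
    Fab ⥤ ModuleCat.{u} S :=
  F ⋙ ModuleCat.extendScalars (algebraMap R S)

/-- A functor with values in `R`-modules as a functor with values in abelian groups. -/
abbrev toInt (F : Fab ⥤ ModuleCat.{u} R) : Fab ⥤ ModuleCat.{u} ℤ :=
  F ⋙ ModuleCat.restrictScalars (algebraMap ℤ R)

/-- The rationalization `ℚ ⊗_ℤ F`. -/
abbrev rationalization (F : Fab ⥤ ModuleCat.{u} R) : Fab ⥤ ModuleCat.{u} ℚ :=
  baseChange ℚ (toInt F)

/-! ### Localization at primes -/

instance isPrime_span (p : Nat.Primes) : (Ideal.span {((p : ℕ) : ℤ)}).IsPrime :=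
  (Ideal.span_singleton_prime (by exact_mod_cast p.2.ne_zero)).2
    (Nat.prime_iff_prime_int.1 p.2)

/-- The local ring `ℤ_(p)`. -/
abbrev ZLoc (p : Nat.Primes) : Type := Localization.AtPrime (Ideal.span {((p : ℕ) : ℤ)})

/-- The localization `F_(p) = ℤ_(p) ⊗ F`. -/
abbrev localization (p : Nat.Primes) (F : Fab ⥤ ModuleCat.{u} ℤ) : Fab ⥤ ModuleCat.{u} (ZLoc p) :=
  baseChange (ZLoc p) F

/-! ### The recursion for `crossIdem` -/

lemma sum_interval {m : ℕ} (S U : Finset (Fin m)) (hU : U ⊆ S) :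
    ∑ T ∈ S.powerset with U ⊆ T, (-1 : ℤ) ^ (T \ U).card = if U = S then 1 else 0 := by
  have h := Finset.sum_powerset_neg_one_pow_card (x := S \ U)
  have h2 : (S \ U = ∅) ↔ U = S := by
    rw [Finset.sdiff_eq_empty_iff_subset]
    exact ⟨fun h => hU.antisymm h, fun h => h ▸ subset_rfl⟩
  simp only [h2] at h
  rw [← h]
  refine Finset.sum_nbij' (fun T => T \ U) (fun V => V ∪ U) ?_ ?_ ?_ ?_ ?_
  · intro T hT
    simp only [Finset.mem_filter, Finset.mem_powerset] at hT ⊢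
    exact Finset.sdiff_subset_sdiff hT.1 subset_rfl
  · intro V hV
    simp only [Finset.mem_filter, Finset.mem_powerset] at hV ⊢
    exact ⟨Finset.union_subset (hV.trans Finset.sdiff_subset) hU, Finset.subset_union_right⟩
  · intro T hT
    simp only [Finset.mem_filter, Finset.mem_powerset] at hT
    exact Finset.sdiff_union_of_subset hT.2
  · intro V hV
    simp only [Finset.mem_powerset] at hV
    rw [Finset.union_sdiff_right]
    exact Finset.sdiff_eq_self_of_disjoint
      (Finset.disjoint_of_subset_left hV Finset.sdiff_disjoint)
  · intro T _
    rfl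

lemma crossIdem_sum (F : Fab ⥤ ModuleCat.{u} R) {m : ℕ} (A : Fin m → Fab) (S : Finset (Fin m)) :
    ∑ T ∈ S.powerset, crossIdem F A T = F.map (idemSum A S) := by
  unfold crossIdem
  rw [Finset.sum_comm' (t' := S.powerset) (s' := fun U => S.powerset.filter (fun T => U ⊆ T))]
  · simp_rw [← Finset.sum_smul]
    rw [Finset.sum_congr rfl
      (g := fun U => (if U = S then (1 : ℤ) else 0) • F.map (idemSum A U))]
    · simp
    · intro U hU
      rw [sum_interval S U (Finset.mem_powerset.1 hU)]
  · intro T U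
    simp only [Finset.mem_powerset, Finset.mem_filter]
    exact ⟨fun h => ⟨⟨h.1, h.2⟩, h.2.trans h.1⟩, fun h => h.1⟩

lemma crossIdem_empty (F : Fab ⥤ ModuleCat.{u} R) (hF : Reduced F) {m : ℕ} (A : Fin m → Fab) :
    crossIdem F A ∅ = 0 := by
  have h : idemSum A ∅ = 0 := by
    simp only [idemSum, Finset.sum_empty]
    rfl
  simp [crossIdem, h, hF _ _]

theorem crossIdem_eq (F : Fab ⥤ ModuleCat.{u} R) (hF : Reduced F) {m : ℕ} (A : Fin m → Fab)
    (S : Finset (Fin m)) :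
    crossIdem F A S =
      F.map (idemSum A S) - ∑ T ∈ S.ssubsets with T.Nonempty, crossIdem F A T := by
  have h1 : ∑ T ∈ S.ssubsets with T.Nonempty, crossIdem F A T =
      ∑ T ∈ S.ssubsets, crossIdem F A T := by
    refine Finset.sum_filter_of_ne fun T _ hT => ?_
    rw [Finset.nonempty_iff_ne_empty]
    rintro rfl
    exact hT (crossIdem_empty F hF A)
  rw [h1, eq_sub_iff_add_eq, ← crossIdem_sum, Finset.ssubsets,
    Finset.add_sum_erase _ _ (Finset.mem_powerset_self S)]

end CubicFunctor

end

open CubicFunctor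

/-! A functor of degree at most 3 is determined by its value on `ℤ³` as a representation of the
monoid of integral `3 × 3` matrices: for `n > 3` the vanishing of the `n`-th cross-effect writes the
identity of `F(ℤⁿ)` as an integral combination of maps through smaller powers (`resolves`,
`nonempty_iso_of_rep`). If `F` is weakly alternative, matrices of rank one factor through `ℤ` and
act by zero. This makes the third cross-effect trilinear with `S₃` acting through the group ring
modulo its norm element, and makes what remains of the second cross-effect alternating bilinear.
Three operators `kap`, `qOp`, `cOp` thus cut out multiplicity modules, rationally those of `Λ²`, of
the Schur functor of the partition `(2,1)`, and of `Λ³`.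

Integrally the representation is not a direct sum of three pieces, but the failure is bounded. A
homomorphism `l` of multiplicity modules extends to an equivariant map which is `4l`, `6l`, `6l` on
its own block and zero on the other two (`sharp`). So `1 + 4μ` or `1 + 6μ` on a block extends to an
equivariant endomorphism that is the identity on the other blocks. The arithmetic input is that the
only units of `ℤ/4` and `ℤ/6` are `±1`: by Smith normal form every sublattice of a block of index
prime to 6 is the image of such a `1 + 4μ` or `1 + 6μ`. Hence every subrepresentation of index prime
to 6 and to the torsion is the image of an injective equivariant endomorphism, so it is isomorphic
to the whole (`exists_equiv_of_index`).

For statement 1, equivariant maps that are isomorphisms at the finitely many primes dividing 6 and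
the torsion exponents are combined by the Chinese remainder theorem into one map that is an
isomorphism at all of them. It is an embedding of index prime to these primes, and the previous
paragraph applies (`exists_equiv_of_local`).

For statement 2, at `p ≥ 5` the number 6 is invertible, so a torsion free module over `ℤ_(p)` is
determined by the ranks of its blocks, hence by its rationalization. Consequently one lattice in the
common rationalization localizes to almost all of the given modules, and the fibre product of all of
them over that rationalization is finitely generated with the right localizations (`exists_lattice`,
`exists_glue`). Rationalizations and torsion are then read off from the localization maps. -/

namespace CubicFunctor

/-! ### Cubic representations of the monoid of integral `3 × 3` matrices -/

/-- The monoid of integral `3 × 3` matrices. -/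
abbrev Mat := Matrix (Fin 3) (Fin 3) ℤ

/-- A multiplicative map from `Mat` that kills the matrices of rank at most one and is polynomial
of degree at most `3`. -/
structure IsCubicRep {E : Type*} [Ring E] (ρ : Mat →* E) : Prop where
  vanish : ∀ u v : Fin 3 → ℤ, ρ (Matrix.vecMulVec u v) = 0
  cubic : ∀ a b c d : Mat,
    ρ (a + b + c + d) - (ρ (a + b + c) + ρ (a + b + d) + ρ (a + c + d) + ρ (b + c + d))
      + (ρ (a + b) + ρ (a + c) + ρ (a + d) + ρ (b + c) + ρ (b + d) + ρ (c + d))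
      - (ρ a + ρ b + ρ c + ρ d) = 0

/-! ### The third cross-effect idempotent and its trilinearity. -/

section Ring

variable {E : Type*} [Ring E] (ρ : Mat →* E)

/-- The transposed representation in the opposite ring. -/
def opRep : Mat →* Eᵐᵒᵖ where
  toFun m := MulOpposite.op (ρ m.transpose)
  map_one' := by simp
  map_mul' a b := by simp [Matrix.transpose_mul]

-- Transposition preserves sums and matrices of rank one. Each identity with an operator on the left
-- therefore gives its mirror image by passing to the opposite ring.
variable {ρ} in
lemma IsCubicRep.op (h : IsCubicRep ρ) : IsCubicRep (opRep ρ) where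
  vanish u v := by simp [opRep, Matrix.transpose_vecMulVec, h.vanish]
  cubic a b c d := by
    have := congrArg MulOpposite.op
      (h.cubic a.transpose b.transpose c.transpose d.transpose)
    simpa [opRep, Matrix.transpose_add] using this

/-- The diagonal idempotent omitting the `t`-th coordinate. -/
def dropMat (t : Fin 3) : Mat := Matrix.diagonal fun i => if i = t then 0 else 1

/-- The third cross-effect idempotent. -/
def omega : E := 1 - ρ (dropMat 0) - ρ (dropMat 1) - ρ (dropMat 2)

/-- The matrix with `t`-th row `x` and other rows zero. -/
def rowMat (t : Fin 3) (x : Fin 3 → ℤ) : Mat := Matrix.vecMulVec (Pi.single t 1) x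

lemma rowMat_add (t : Fin 3) (x y : Fin 3 → ℤ) : rowMat t (x + y) = rowMat t x + rowMat t y :=
  Matrix.vecMulVec_add _ _ _

lemma of_eq_rowMat (φ : Fin 3 → Fin 3 → ℤ) :
    (Matrix.of φ : Mat) = rowMat 0 (φ 0) + rowMat 1 (φ 1) + rowMat 2 (φ 2) := by
  ext i j
  fin_cases i <;> simp [rowMat, Matrix.vecMulVec_apply]

lemma omega_mul_of (φ : Fin 3 → Fin 3 → ℤ) :
    omega ρ * ρ (Matrix.of φ) =
      ρ (rowMat 0 (φ 0) + rowMat 1 (φ 1) + rowMat 2 (φ 2)) - ρ (rowMat 1 (φ 1) + rowMat 2 (φ 2))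
        - ρ (rowMat 0 (φ 0) + rowMat 2 (φ 2)) - ρ (rowMat 0 (φ 0) + rowMat 1 (φ 1)) := by
  have h0 : dropMat 0 * (Matrix.of φ : Mat) = rowMat 1 (φ 1) + rowMat 2 (φ 2) := by
    ext i j
    fin_cases i <;> simp [dropMat, rowMat, Matrix.vecMulVec_apply]
  have h1 : dropMat 1 * (Matrix.of φ : Mat) = rowMat 0 (φ 0) + rowMat 2 (φ 2) := by
    ext i j
    fin_cases i <;> simp [dropMat, rowMat, Matrix.vecMulVec_apply]
  have h2 : dropMat 2 * (Matrix.of φ : Mat) = rowMat 0 (φ 0) + rowMat 1 (φ 1) := by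
    ext i j
    fin_cases i <;> simp [dropMat, rowMat, Matrix.vecMulVec_apply]
  rw [omega, sub_mul, sub_mul, sub_mul, one_mul, ← map_mul, ← map_mul, ← map_mul, h0, h1, h2,
    ← of_eq_rowMat]

variable {ρ}

lemma IsCubicRep.rowMat (h : IsCubicRep ρ) (t : Fin 3) (x : Fin 3 → ℤ) : ρ (rowMat t x) = 0 :=
  h.vanish _ _

/-- The failure of additivity in one row is the fourth deviation of `ρ` at the four one-row matrices
given by `x`, `y` in row `t` and by the other two rows. All remaining terms of that deviation are
supported in a single row, so they have rank at most one and vanish. -/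
lemma IsCubicRep.omega_mul_add (h : IsCubicRep ρ) (φ : Fin 3 → Fin 3 → ℤ) (t : Fin 3)
    (x y : Fin 3 → ℤ) :
    omega ρ * ρ (Matrix.of (Function.update φ t (x + y))) =
      omega ρ * ρ (Matrix.of (Function.update φ t x)) +
        omega ρ * ρ (Matrix.of (Function.update φ t y)) := by
  have hr := h.rowMat
  rw [omega_mul_of, omega_mul_of, omega_mul_of]
  fin_cases t
  · have := h.cubic (CubicFunctor.rowMat 0 x) (CubicFunctor.rowMat 0 y)
      (CubicFunctor.rowMat 1 (φ 1)) (CubicFunctor.rowMat 2 (φ 2))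
    rw [← rowMat_add] at this
    simp only [hr] at this
    simp [rowMat_add] at this ⊢
    rw [← sub_eq_zero, ← this]
    abel
  · have := h.cubic (CubicFunctor.rowMat 1 x) (CubicFunctor.rowMat 1 y)
      (CubicFunctor.rowMat 0 (φ 0)) (CubicFunctor.rowMat 2 (φ 2))
    rw [← rowMat_add] at this
    simp only [hr] at this
    simp [rowMat_add] at this ⊢
    rw [← sub_eq_zero, ← this]
    abel_nf
  · have := h.cubic (CubicFunctor.rowMat 2 x) (CubicFunctor.rowMat 2 y)
      (CubicFunctor.rowMat 0 (φ 0)) (CubicFunctor.rowMat 1 (φ 1))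
    rw [← rowMat_add] at this
    simp only [hr] at this
    simp [rowMat_add] at this ⊢
    rw [← sub_eq_zero, ← this]
    abel_nf

/-- The trilinear map `φ ↦ ω ρ(φ)` in the rows of `φ`. -/
def IsCubicRep.rowMap (h : IsCubicRep ρ) :
    MultilinearMap ℤ (fun _ : Fin 3 => Fin 3 → ℤ) E where
  toFun φ := omega ρ * ρ (Matrix.of φ)
  map_update_add' {i} φ t x y := by
    obtain rfl : i = instDecidableEqFin 3 := Subsingleton.elim _ _
    exact h.omega_mul_add φ t x y
  map_update_smul' {i} φ t n x := by
    obtain rfl : i = instDecidableEqFin 3 := Subsingleton.elim _ _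
    exact map_zsmul (AddMonoidHom.mk' (fun x => omega ρ * ρ (Matrix.of (Function.update φ t x)))
        (h.omega_mul_add φ t)) n x

end Ring

/-! ### The symmetric group acting on the third cross-effect. -/

section Ring

variable {E : Type*} [Ring E] {ρ : Mat →* E}

lemma omega_eq_sum (ρ : Mat →* E) : omega ρ = 1 - ∑ t, ρ (dropMat t) := by
  rw [omega, Fin.sum_univ_three]
  abel

lemma omega_opRep (ρ : Mat →* E) : omega (opRep ρ) = MulOpposite.op (omega ρ) := by
  simp [omega, opRep, dropMat]

/-- The matrix whose `t`-th row is the unit vector `e_{I t}`. -/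
def sel (I : Fin 3 → Fin 3) : Mat := Matrix.of fun t => Pi.single (I t) 1

lemma sel_mul (I J : Fin 3 → Fin 3) : sel I * sel J = sel (J ∘ I) := by
  ext i j
  rw [Matrix.mul_apply, Finset.sum_eq_single (I i)] <;> simp +contextual [sel]

lemma sel_id : sel id = 1 := by
  ext i j
  simp [sel, Matrix.one_apply, Pi.single_apply, eq_comm]

lemma sel_dropMat (g : Equiv.Perm (Fin 3)) (t : Fin 3) :
    dropMat t * sel g = sel g * dropMat (g t) := by
  ext i j
  simp only [sel, dropMat, Matrix.diagonal_mul, Matrix.mul_diagonal, Matrix.of_apply,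
    Pi.single_apply]
  by_cases h : i = t
  · subst h
    by_cases h' : j = g i <;> simp [h']
  · by_cases h' : j = g i
    · subst h'; simp [h]
    · simp [h']

/-- The action of a permutation. -/
def sig (ρ : Mat →* E) (g : Equiv.Perm (Fin 3)) : E := ρ (sel g)

lemma sig_mul (ρ : Mat →* E) (g h : Equiv.Perm (Fin 3)) :
    sig ρ g * sig ρ h = sig ρ (h * g) := by
  rw [sig, sig, sig, ← map_mul, sel_mul]
  rfl

lemma sig_one (ρ : Mat →* E) : sig ρ 1 = 1 := by
  rw [sig, Equiv.Perm.coe_one, sel_id, map_one]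

lemma omega_comm (ρ : Mat →* E) (g : Equiv.Perm (Fin 3)) :
    omega ρ * sig ρ g = sig ρ g * omega ρ := by
  rw [omega_eq_sum, sub_mul, mul_sub, one_mul, mul_one, Finset.sum_mul, Finset.mul_sum,
    ← Equiv.sum_comp g (fun t => sig ρ g * ρ (dropMat t))]
  simp only [sig, ← map_mul, sel_dropMat]

lemma IsCubicRep.omega_mul_eq_sum (h : IsCubicRep ρ) (m : Mat) :
    omega ρ * ρ m = ∑ I : Fin 3 → Fin 3, (∏ t, m t (I t)) • (omega ρ * ρ (sel I)) := by
  have h1 : (fun t => m t) = fun t => ∑ j, m t j • (Pi.single j 1 : Fin 3 → ℤ) := by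
    ext t j
    simp [Pi.single_apply]
  change h.rowMap (fun t => m t) = _
  rw [h1, MultilinearMap.map_sum]
  refine Finset.sum_congr rfl fun I _ => ?_
  rw [MultilinearMap.map_smul_univ]
  rfl

lemma IsCubicRep.omega_mul_row_zero (h : IsCubicRep ρ) {m : Mat} {t : Fin 3} (ht : m t = 0) :
    omega ρ * ρ m = 0 :=
  h.rowMap.map_coord_zero t ht

lemma IsCubicRep.mul_omega_col_zero (h : IsCubicRep ρ) {m : Mat} {t : Fin 3}
    (ht : ∀ i, m i t = 0) : ρ m * omega ρ = 0 := by
  have := h.op.omega_mul_row_zero (m := m.transpose) (t := t) (funext ht)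
  rw [omega_opRep, opRep] at this
  simpa [← MulOpposite.op_mul] using this

lemma IsCubicRep.mul_omega_eq_sum (h : IsCubicRep ρ) (m : Mat) :
    ρ m * omega ρ =
      ∑ I : Fin 3 → Fin 3, (∏ t, m (I t) t) • (ρ (sel I).transpose * omega ρ) := by
  have := h.op.omega_mul_eq_sum m.transpose
  rw [omega_opRep] at this
  apply MulOpposite.op_injective
  simpa [opRep, ← MulOpposite.op_mul, Finset.op_sum, -zsmul_eq_mul] using this

lemma IsCubicRep.omega_mul_omega (h : IsCubicRep ρ) : omega ρ * omega ρ = omega ρ := by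
  have (t : Fin 3) : omega ρ * ρ (dropMat t) = 0 :=
    h.omega_mul_row_zero (t := t) (by ext j; simp +contextual [dropMat, Matrix.diagonal_apply])
  conv_lhs => rw [omega_eq_sum ρ]; rw [← omega_eq_sum ρ]
  nth_rewrite 2 [omega_eq_sum]
  rw [mul_sub, Finset.mul_sum]
  simp [this]

lemma IsCubicRep.sel_mul_omega (h : IsCubicRep ρ) {I : Fin 3 → Fin 3}
    (hI : ¬ Function.Surjective I) : ρ (sel I) * omega ρ = 0 := by
  obtain ⟨t, ht⟩ := not_forall.1 hI
  refine h.mul_omega_col_zero (t := t) fun i => ?_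
  have : t ≠ I i := fun h => ht ⟨i, h.symm⟩
  simp [sel, this]

/-- In the trilinear expansion a selection that is not surjective has a zero column and is killed by
`ω` on the right, so only permutations survive. -/
lemma IsCubicRep.omega_mul_mul_omega (h : IsCubicRep ρ) (m : Mat) :
    omega ρ * ρ m * omega ρ =
      ∑ g : Equiv.Perm (Fin 3), (∏ t, m t (g t)) • (sig ρ g * omega ρ) := by
  rw [h.omega_mul_eq_sum, Finset.sum_mul]
  symm
  refine Fintype.sum_of_injective (fun g : Equiv.Perm (Fin 3) => (g : Fin 3 → Fin 3))
    DFunLike.coe_injective _ _ (fun I hI => ?_) fun g => ?_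
  · rw [smul_mul_assoc, mul_assoc, h.sel_mul_omega, mul_zero, smul_zero]
    intro hs
    exact hI ⟨Equiv.ofBijective I (Finite.injective_iff_surjective.2 hs |> fun h => ⟨h, hs⟩), rfl⟩
  · rw [smul_mul_assoc]
    change _ = _ • (omega ρ * sig ρ g * omega ρ)
    rw [omega_comm, mul_assoc, h.omega_mul_omega]

/-- The all-ones matrix has rank one and every product of its entries is 1. Thus the norm element of
`S₃` acts by zero, which rationally leaves the sign and the two-dimensional representation. -/
lemma IsCubicRep.sum_sig (h : IsCubicRep ρ) :
    ∑ g : Equiv.Perm (Fin 3), sig ρ g * omega ρ = 0 := by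
  have h1 := h.omega_mul_mul_omega (Matrix.vecMulVec 1 1)
  rw [h.vanish] at h1
  simpa [Matrix.vecMulVec_apply] using h1.symm

/-- The transposition of the first two indices. -/
abbrev s₁₂ : Equiv.Perm (Fin 3) := Equiv.swap 0 1

/-- The cyclic permutation. -/
abbrev rot : Equiv.Perm (Fin 3) := finRotate 3

lemma sum_perm {M : Type*} [AddCommMonoid M] (f : Equiv.Perm (Fin 3) → M) :
    ∑ g, f g = f 1 + f rot + f (rot * rot) + f s₁₂ + f (s₁₂ * rot) + f (s₁₂ * (rot * rot)) := by
  have : (Finset.univ : Finset (Equiv.Perm (Fin 3))) =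
      {1, rot, rot * rot, s₁₂, s₁₂ * rot, s₁₂ * (rot * rot)} := by decide
  rw [this, Finset.sum_insert (by decide), Finset.sum_insert (by decide),
    Finset.sum_insert (by decide), Finset.sum_insert (by decide), Finset.sum_insert (by decide),
    Finset.sum_singleton]
  abel

/-- The group splits into the subgroup generated by `s₁₂` and a single further double coset of it,
with four elements. -/
lemma sum_perm' {M : Type*} [AddCommMonoid M] (f : Equiv.Perm (Fin 3) → M)
    (g : Equiv.Perm (Fin 3)) (hg : g ≠ 1) (hg' : g ≠ s₁₂) :
    ∑ g, f g = f 1 + f s₁₂ + f g + f (g * s₁₂) + f (s₁₂ * g) + f (s₁₂ * (g * s₁₂)) := by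
  have : (Finset.univ : Finset (Equiv.Perm (Fin 3))) =
      {1, s₁₂, g, g * s₁₂, s₁₂ * g, s₁₂ * (g * s₁₂)} := by revert g; decide
  rw [this, Finset.sum_insert (by revert g; decide), Finset.sum_insert (by revert g; decide),
    Finset.sum_insert (by revert g; decide), Finset.sum_insert (by revert g; decide),
    Finset.sum_insert (by revert g; decide), Finset.sum_singleton]
  abel

/-- The operator `(1 + s₁₂) ω`. -/
def qOp (ρ : Mat →* E) : E := (1 + sig ρ s₁₂) * omega ρ

/-- The operator `(1 + r + r²) ω`, where `r` is the cyclic permutation. -/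
def cOp (ρ : Mat →* E) : E := (1 + sig ρ rot + sig ρ (rot * rot)) * omega ρ

lemma qOp_eq (ρ : Mat →* E) : qOp ρ = omega ρ * (1 + sig ρ s₁₂) := by
  simp [qOp, mul_add, add_mul, omega_comm]

lemma cOp_eq (ρ : Mat →* E) : cOp ρ = omega ρ * (1 + sig ρ rot + sig ρ (rot * rot)) := by
  simp [cOp, mul_add, add_mul, omega_comm]

/-- The multiplicities in `q g q = χ(g) q`. -/
def chi (g : Equiv.Perm (Fin 3)) : ℤ := if g = 1 ∨ g = s₁₂ then 2 else -1

lemma IsCubicRep.omega_mul_qOp (h : IsCubicRep ρ) : omega ρ * qOp ρ = qOp ρ := by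
  rw [qOp_eq, ← mul_assoc, h.omega_mul_omega]

lemma IsCubicRep.qOp_mul_omega (h : IsCubicRep ρ) : qOp ρ * omega ρ = qOp ρ := by
  rw [qOp, mul_assoc, h.omega_mul_omega]

lemma IsCubicRep.omega_mul_cOp (h : IsCubicRep ρ) : omega ρ * cOp ρ = cOp ρ := by
  rw [cOp_eq, ← mul_assoc, h.omega_mul_omega]

lemma IsCubicRep.cOp_mul_omega (h : IsCubicRep ρ) : cOp ρ * omega ρ = cOp ρ := by
  rw [cOp, mul_assoc, h.omega_mul_omega]

lemma sig_qOp (ρ : Mat →* E) : sig ρ s₁₂ * qOp ρ = qOp ρ := by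
  rw [qOp, ← mul_assoc, mul_add, mul_one, sig_mul]
  simp [sig_one, add_comm]

lemma qOp_sig (ρ : Mat →* E) : qOp ρ * sig ρ s₁₂ = qOp ρ := by
  rw [qOp_eq, mul_assoc, add_mul, one_mul, sig_mul]
  simp [sig_one, add_comm]

/-- Inside the subgroup generated by `s₁₂` this is `q² = 2q`. Outside it the double coset sum is the
norm minus `1 + s₁₂`, and the norm vanishes. -/
lemma IsCubicRep.qOp_mul_sig_mul_qOp (h : IsCubicRep ρ) (g : Equiv.Perm (Fin 3)) :
    qOp ρ * sig ρ g * qOp ρ = chi g • qOp ρ := by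
  have h2 : qOp ρ * qOp ρ = (2 : ℤ) • qOp ρ := by
    rw [show qOp ρ * qOp ρ = omega ρ * (1 + sig ρ s₁₂) * qOp ρ by rw [← qOp_eq],
      mul_assoc, add_mul, one_mul, sig_qOp, ← two_mul, ← mul_assoc, mul_two, add_mul,
      h.omega_mul_qOp, two_smul]
  by_cases hg : g = 1
  · subst hg
    rw [sig_one, mul_one, h2]
    simp [chi]
  by_cases hg' : g = s₁₂
  · subst hg'
    rw [qOp_sig, h2]
    simp [chi]
  have h3 := h.sum_sig
  rw [sum_perm' _ g hg hg'] at h3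
  rw [chi, if_neg (by tauto)]
  have h6 : qOp ρ * sig ρ g * qOp ρ =
      omega ρ * ((1 + sig ρ s₁₂) * (sig ρ g * ((1 + sig ρ s₁₂) * omega ρ))) := by
    rw [← qOp, ← mul_assoc, ← qOp_eq, ← mul_assoc]
  rw [h6]
  have h4 : (1 + sig ρ s₁₂) * (sig ρ g * ((1 + sig ρ s₁₂) * omega ρ)) =
      sig ρ g * omega ρ + sig ρ (g * s₁₂) * omega ρ + sig ρ (s₁₂ * g) * omega ρ +
        sig ρ (s₁₂ * (g * s₁₂)) * omega ρ := by
    simp only [← sig_mul]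
    noncomm_ring
  rw [h4]
  have h5 : sig ρ g * omega ρ + sig ρ (g * s₁₂) * omega ρ + sig ρ (s₁₂ * g) * omega ρ +
        sig ρ (s₁₂ * (g * s₁₂)) * omega ρ = -qOp ρ := by
    rw [eq_neg_iff_add_eq_zero, ← h3, qOp, sig_one]
    noncomm_ring
  rw [h5, mul_neg, h.omega_mul_qOp]
  simp

/-- `chi` is three times the indicator function of `{1, s₁₂}` minus the constant 1. The constant
contributes the norm, that is zero, and the indicator contributes `3(1 + s₁₂)q = 6q`. -/
lemma IsCubicRep.sum_chi (h : IsCubicRep ρ) :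
    ∑ g : Equiv.Perm (Fin 3), chi g • (sig ρ g⁻¹ * qOp ρ) = (6 : ℤ) • qOp ρ := by
  have h1 : ∑ g : Equiv.Perm (Fin 3), sig ρ g⁻¹ * qOp ρ = 0 := by
    rw [← Equiv.sum_comp (Equiv.inv (Equiv.Perm (Fin 3)))]
    simp only [Equiv.inv_apply, inv_inv]
    have := congrArg (· * (1 + sig ρ s₁₂)) h.sum_sig
    simpa only [Finset.sum_mul, mul_assoc, ← qOp_eq, zero_mul] using this
  have h2 (g : Equiv.Perm (Fin 3)) : chi g = (if g = 1 ∨ g = s₁₂ then 3 else 0) - 1 := by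
    unfold chi
    split_ifs <;> rfl
  simp only [h2, sub_smul, one_smul, Finset.sum_sub_distrib, h1, sub_zero]
  rw [sum_perm]
  simp only [show ¬ (rot = 1 ∨ rot = s₁₂) by decide,
    show ¬ (rot * rot = 1 ∨ rot * rot = s₁₂) by decide,
    show ¬ (s₁₂ * rot = 1 ∨ s₁₂ * rot = s₁₂) by decide,
    show ¬ (s₁₂ * (rot * rot) = 1 ∨ s₁₂ * (rot * rot) = s₁₂) by decide, if_false, zero_smul]
  simp only [true_or, or_true, if_true, inv_one, Equiv.swap_inv, sig_qOp, sig_one, one_mul]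
  module

/-- The three conjugates of `1 + s₁₂` under rotations add up to 3 plus all transpositions. The
rotations in `c` complete the transpositions to the norm, which is zero. -/
lemma IsCubicRep.three_omega (h : IsCubicRep ρ) :
    (3 : ℤ) • omega ρ = cOp ρ + qOp ρ + sig ρ rot * qOp ρ * sig ρ (rot * rot) +
      sig ρ (rot * rot) * qOp ρ * sig ρ rot := by
  have h1 := h.sum_sig
  rw [sum_perm] at h1
  have e1 : sig ρ rot * qOp ρ * sig ρ (rot * rot) =
      omega ρ + sig ρ (s₁₂ * (rot * rot)) * omega ρ := by
    rw [qOp, mul_assoc, mul_assoc, omega_comm, ← mul_assoc, ← mul_assoc, mul_add, add_mul, mul_one,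
      sig_mul, sig_mul, sig_mul, add_mul, show rot * rot * rot = 1 by decide, sig_one,
      show rot * rot * (s₁₂ * rot) = s₁₂ * (rot * rot) by decide, one_mul]
  have e2 : sig ρ (rot * rot) * qOp ρ * sig ρ rot =
      omega ρ + sig ρ (s₁₂ * rot) * omega ρ := by
    rw [qOp, mul_assoc, mul_assoc, omega_comm, ← mul_assoc, ← mul_assoc, mul_add, add_mul, mul_one,
      sig_mul, sig_mul, sig_mul, add_mul, show rot * (rot * rot) = 1 by decide, sig_one,
      show rot * (s₁₂ * (rot * rot)) = s₁₂ * rot by decide, one_mul]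
  rw [e1, e2, cOp, qOp]
  rw [sig_one] at h1
  rw [← sub_eq_zero, ← neg_eq_zero, ← h1]
  noncomm_ring

end Ring

/-! ### The sign part and the determinant. -/

section Ring

variable {E : Type*} [Ring E] {ρ : Mat →* E}

lemma sel_transpose (g : Equiv.Perm (Fin 3)) : (sel g).transpose = sel (g⁻¹ : Equiv.Perm _) := by
  ext i j
  simp only [sel, Pi.single_apply, Matrix.transpose_apply, Matrix.of_apply]
  exact if_congr (by rw [Equiv.Perm.eq_inv_iff_eq, eq_comm]) rfl rfl

lemma sig_opRep (ρ : Mat →* E) (g : Equiv.Perm (Fin 3)) :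
    sig (opRep ρ) g = MulOpposite.op (sig ρ g⁻¹) := by
  simp [sig, opRep, sel_transpose]

lemma cOp_opRep (ρ : Mat →* E) : cOp (opRep ρ) = MulOpposite.op (cOp ρ) := by
  rw [cOp, cOp_eq, omega_opRep, sig_opRep, sig_opRep, show rot⁻¹ = rot * rot by decide,
    show (rot * rot)⁻¹ = rot by decide]
  simp only [MulOpposite.op_mul, MulOpposite.op_add, MulOpposite.op_one]
  noncomm_ring

/-- `c` absorbs rotations, and `c + c s₁₂` is the norm times `ω`, which vanishes. -/
lemma IsCubicRep.cOp_mul_sig (h : IsCubicRep ρ) (g : Equiv.Perm (Fin 3)) :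
    cOp ρ * sig ρ g = (Equiv.Perm.sign g : ℤ) • cOp ρ := by
  have hr : cOp ρ * sig ρ rot = cOp ρ := by
    rw [cOp_eq, mul_assoc, add_mul, add_mul, sig_mul, sig_mul,
      show rot * (rot * rot) = 1 by decide, sig_one]
    noncomm_ring
  have hs : cOp ρ * sig ρ s₁₂ = - cOp ρ := by
    have := h.sum_sig
    rw [sum_perm] at this
    rw [cOp, mul_assoc, omega_comm, ← mul_assoc, ← sub_eq_zero, ← this, sig_one]
    simp only [← sig_mul]
    noncomm_ring
  have hg : g = 1 ∨ g = rot ∨ g = rot * rot ∨ g = s₁₂ ∨ g = s₁₂ * rot ∨ g = s₁₂ * (rot * rot) := by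
    revert g; decide
  rcases hg with rfl | rfl | rfl | rfl | rfl | rfl <;>
    simp [← sig_mul, ← mul_assoc, sig_one, hr, hs]

lemma IsCubicRep.cOp_mul_cOp (h : IsCubicRep ρ) : cOp ρ * cOp ρ = (3 : ℤ) • cOp ρ := by
  have e1 : (Equiv.Perm.sign rot : ℤ) = 1 := by decide
  nth_rewrite 2 [cOp]
  have e3 : (Equiv.Perm.sign (rot * rot) : ℤ) = 1 := by decide
  rw [← mul_assoc, mul_add, mul_add, h.cOp_mul_sig, h.cOp_mul_sig, e1, e3,
    one_smul, mul_one, add_mul, add_mul, h.cOp_mul_omega]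
  module

lemma IsCubicRep.cOp_mul_qOp (h : IsCubicRep ρ) : cOp ρ * qOp ρ = 0 := by
  have e2 : (Equiv.Perm.sign s₁₂ : ℤ) = -1 := by decide
  rw [qOp, ← mul_assoc, mul_add, mul_one, h.cOp_mul_sig, e2]
  simp

lemma IsCubicRep.sig_mul_cOp (h : IsCubicRep ρ) (g : Equiv.Perm (Fin 3)) :
    sig ρ g * cOp ρ = (Equiv.Perm.sign g : ℤ) • cOp ρ := by
  have := h.op.cOp_mul_sig g⁻¹
  rw [cOp_opRep, sig_opRep, inv_inv] at this
  apply MulOpposite.op_injective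
  simpa [← MulOpposite.op_mul, -zsmul_eq_mul] using this

lemma IsCubicRep.qOp_mul_sig_mul_cOp (h : IsCubicRep ρ) (g : Equiv.Perm (Fin 3)) :
    qOp ρ * sig ρ g * cOp ρ = 0 := by
  have e2 : (Equiv.Perm.sign s₁₂ : ℤ) = -1 := by decide
  rw [mul_assoc, h.sig_mul_cOp, mul_smul_comm, qOp_eq, mul_assoc, add_mul, h.sig_mul_cOp, e2]
  simp

/-- The map `φ ↦ c ρ(φ)` is trilinear and antisymmetric in the rows. Antisymmetry makes only its
double alternating, whence the factor 2, and an alternating form in three variables is a multiple of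
the determinant. -/
lemma IsCubicRep.two_cOp_mul (h : IsCubicRep ρ) (m : Mat) :
    (2 : ℤ) • (cOp ρ * ρ m) = m.det • (2 : ℤ) • cOp ρ := by
  let T : (Fin 3 → ℤ) [⋀^Fin 3]→ₗ[ℤ] E :=
    { (LinearMap.mulLeft ℤ ((2 : ℤ) • cOp ρ)).compMultilinearMap h.rowMap with
      map_eq_zero_of_eq' := by
        intro φ i j hij hne
        change (2 : ℤ) • cOp ρ * (omega ρ * ρ (Matrix.of φ)) = 0
        have h1 : (Matrix.of φ : Mat) = sel (Equiv.swap i j) * Matrix.of φ := by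
          ext a b
          simp only [Matrix.mul_apply, sel, Matrix.of_apply, Pi.single_apply, ite_mul, one_mul,
            zero_mul, Finset.sum_ite_eq', Finset.mem_univ, if_true]
          rcases eq_or_ne a i with rfl | ha
          · rw [Equiv.swap_apply_left, hij]
          rcases eq_or_ne a j with rfl | ha'
          · rw [Equiv.swap_apply_right, hij]
          rw [Equiv.swap_apply_of_ne_of_ne ha ha']
        have h2 : cOp ρ * ρ (Matrix.of φ) = - (cOp ρ * ρ (Matrix.of φ)) := by
          conv_lhs => rw [h1, map_mul, ← mul_assoc]
          change cOp ρ * sig ρ (Equiv.swap i j) * _ = _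
          rw [h.cOp_mul_sig, Equiv.Perm.sign_swap hne]
          simp
        rw [← mul_assoc, smul_mul_assoc, h.cOp_mul_omega, smul_mul_assoc, two_smul]
        exact eq_neg_iff_add_eq_zero.1 h2 }
  let T' : (Fin 3 → ℤ) [⋀^Fin 3]→ₗ[ℤ] E :=
    (LinearMap.toSpanSingleton ℤ E ((2 : ℤ) • cOp ρ)).compAlternatingMap Matrix.detRowAlternating
  have hT (φ : Fin 3 → Fin 3 → ℤ) : T φ = (2 : ℤ) • (cOp ρ * ρ (Matrix.of φ)) := by
    change (2 : ℤ) • cOp ρ * (omega ρ * ρ (Matrix.of φ)) = _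
    rw [← mul_assoc, smul_mul_assoc, h.cOp_mul_omega, smul_mul_assoc]
  have hT' (φ : Fin 3 → Fin 3 → ℤ) : T' φ = (Matrix.of φ).det • (2 : ℤ) • cOp ρ := rfl
  have : T = T' := by
    refine Module.Basis.ext_alternating (Pi.basisFun ℤ (Fin 3)) fun v hv => ?_
    have h1 : (fun i => (Pi.basisFun ℤ (Fin 3)) (v i)) = fun i => Pi.single (v i) 1 := by
      funext i; simp
    rw [h1, hT, hT']
    obtain ⟨g, rfl⟩ : ∃ g : Equiv.Perm (Fin 3), (g : Fin 3 → Fin 3) = v :=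
      ⟨Equiv.ofBijective v ⟨hv, Finite.injective_iff_surjective.1 hv⟩, rfl⟩
    change (2 : ℤ) • (cOp ρ * sig ρ g) = (sel g).det • _
    have h2 : (sel g).det = Equiv.Perm.sign g := by
      have : sel g = (1 : Mat).submatrix g id := by
        ext i j; simp [sel, Matrix.one_apply, Pi.single_apply, eq_comm]
      rw [this, Matrix.det_permute, Matrix.det_one, mul_one, Int.cast_id]
    rw [h.cOp_mul_sig, h2, smul_comm]
  exact (hT fun i => m i).symm.trans (this ▸ hT' fun i => m i)

lemma IsCubicRep.mul_two_cOp (h : IsCubicRep ρ) (m : Mat) :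
    (2 : ℤ) • (ρ m * cOp ρ) = m.det • (2 : ℤ) • cOp ρ := by
  have := h.op.two_cOp_mul m.transpose
  rw [cOp_opRep] at this
  apply MulOpposite.op_injective
  simpa [opRep, ← MulOpposite.op_mul, -zsmul_eq_mul] using this

/-! The bilinear part. -/

/-- The matrix duplicating the first coordinate. -/
def dup₁ : Mat := sel ![0, 0, 1]

/-- The matrix duplicating the second coordinate. -/
def dup₂ : Mat := sel ![0, 1, 1]

/-- The operator on the square part of the representation that kills the image of the third
cross-effect. -/
def kap (ρ : Mat →* E) : E :=
  (2 : ℤ) • ρ (dropMat 2) - ρ dup₁.transpose * omega ρ * ρ dup₁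
    - ρ dup₂.transpose * omega ρ * ρ dup₂

lemma kap_opRep (ρ : Mat →* E) : kap (opRep ρ) = MulOpposite.op (kap ρ) := by
  rw [kap, omega_opRep]
  simp [kap, opRep, dropMat, mul_assoc, -zsmul_eq_mul]

lemma dropMat_dup₁ : dropMat 2 * dup₁.transpose = dup₁.transpose := by decide

lemma dropMat_dup₂ : dropMat 2 * dup₂.transpose = dup₂.transpose := by decide

lemma dropMat_mul_kap (ρ : Mat →* E) : ρ (dropMat 2) * kap ρ = kap ρ := by
  simp only [kap, mul_sub, mul_smul_comm, ← mul_assoc, ← map_mul, dropMat_dup₁, dropMat_dup₂]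
  rw [show dropMat 2 * dropMat 2 = dropMat 2 by decide]

lemma kap_mul_dropMat (ρ : Mat →* E) : kap ρ * ρ (dropMat 2) = kap ρ := by
  have := dropMat_mul_kap (opRep ρ)
  rw [kap_opRep] at this
  apply MulOpposite.op_injective
  simpa [opRep, ← MulOpposite.op_mul, dropMat] using this

/-- By `omega_mul_mul_omega`, going from the third cross-effect to the second and back along the
same duplication gives `1 + s` with `s` the swap of the two duplicated coordinates, while the mixed
composites vanish. Since the duplication matrix is fixed by `s`, the two copies cancel the term
`2ρ(dropMat 2)`. -/
lemma IsCubicRep.omega_mul_dup_kap (h : IsCubicRep ρ) :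
    omega ρ * ρ dup₁ * kap ρ = 0 ∧ omega ρ * ρ dup₂ * kap ρ = 0 := by
  have key (m : Mat) (e0 : m * dropMat 2 = m) : omega ρ * ρ m * kap ρ = (2 : ℤ) • (omega ρ * ρ m) -
      omega ρ * ρ (m * dup₁.transpose) * omega ρ * ρ dup₁ -
      omega ρ * ρ (m * dup₂.transpose) * omega ρ * ρ dup₂ := by
    simp only [kap, mul_sub, mul_smul_comm, mul_assoc, ← map_mul, e0]
    simp only [map_mul, mul_assoc]
  have f1 : dup₁ * dup₁.transpose = !![1, 1, 0; 1, 1, 0; 0, 0, 1] := by decide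
  have f2 : dup₁ * dup₂.transpose = !![1, 0, 0; 1, 0, 0; 0, 1, 1] := by decide
  have f3 : dup₂ * dup₁.transpose = !![1, 1, 0; 0, 0, 1; 0, 0, 1] := by decide
  have f4 : dup₂ * dup₂.transpose = !![1, 0, 0; 0, 1, 1; 0, 1, 1] := by decide
  let s₂₃ : Equiv.Perm (Fin 3) := Equiv.swap 1 2
  have g1 : omega ρ * ρ (!![1, 1, 0; 1, 1, 0; 0, 0, 1] : Mat) * omega ρ =
      omega ρ + sig ρ s₁₂ * omega ρ := by
    rw [h.omega_mul_mul_omega, ← Finset.sum_subset (Finset.subset_univ {1, s₁₂}),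
      Finset.sum_pair (by decide)]
    · have : ∏ t, (!![1, 1, 0; 1, 1, 0; 0, 0, 1] : Mat) t (s₁₂ t) = 1 := by decide
      rw [this]
      simp [Fin.prod_univ_three, sig_one]
    · intro g _ hg
      have : ∏ t, (!![1, 1, 0; 1, 1, 0; 0, 0, 1] : Mat) t (g t) = 0 := by revert g; decide
      rw [this, zero_smul]
  have g4 : omega ρ * ρ (!![1, 0, 0; 0, 1, 1; 0, 1, 1] : Mat) * omega ρ =
      omega ρ + sig ρ s₂₃ * omega ρ := by
    rw [h.omega_mul_mul_omega, ← Finset.sum_subset (Finset.subset_univ {1, s₂₃}),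
      Finset.sum_pair (by decide)]
    · have : ∏ t, (!![1, 0, 0; 0, 1, 1; 0, 1, 1] : Mat) t (s₂₃ t) = 1 := by decide
      rw [this]
      simp [Fin.prod_univ_three, sig_one]
    · intro g _ hg
      have : ∏ t, (!![1, 0, 0; 0, 1, 1; 0, 1, 1] : Mat) t (g t) = 0 := by revert g; decide
      rw [this, zero_smul]
  have g2 : omega ρ * ρ (!![1, 0, 0; 1, 0, 0; 0, 1, 1] : Mat) * omega ρ = 0 := by
    rw [h.omega_mul_mul_omega]
    refine Finset.sum_eq_zero fun g _ => ?_
    have : ∏ t, (!![1, 0, 0; 1, 0, 0; 0, 1, 1] : Mat) t (g t) = 0 := by revert g; decide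
    rw [this, zero_smul]
  have g3 : omega ρ * ρ (!![1, 1, 0; 0, 0, 1; 0, 0, 1] : Mat) * omega ρ = 0 := by
    rw [h.omega_mul_mul_omega]
    refine Finset.sum_eq_zero fun g _ => ?_
    have : ∏ t, (!![1, 1, 0; 0, 0, 1; 0, 0, 1] : Mat) t (g t) = 0 := by revert g; decide
    rw [this, zero_smul]
  constructor
  · rw [key _ (by decide), f1, f2, g1, g2, add_mul, ← omega_comm, mul_assoc _ (sig ρ s₁₂), sig,
      ← map_mul, show sel s₁₂ * dup₁ = dup₁ by decide]
    noncomm_ring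
  · rw [key _ (by decide), f3, f4, g3, g4, add_mul, ← omega_comm, mul_assoc _ (sig ρ s₂₃), sig,
      ← map_mul, show sel s₂₃ * dup₂ = dup₂ by decide]
    noncomm_ring

/-- It suffices to treat selections. As `κ` lives on the first two coordinates, a selection using
the index 2 yields a zero row; a constant one has rank one; every other one is a permutation of
`dup₁` or `dup₂`. -/
lemma IsCubicRep.omega_mul_mul_kap (h : IsCubicRep ρ) (m : Mat) :
    omega ρ * ρ m * kap ρ = 0 := by
  rw [h.omega_mul_eq_sum, Finset.sum_mul]
  refine Finset.sum_eq_zero fun I _ => ?_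
  rw [smul_mul_assoc]
  suffices omega ρ * ρ (sel I) * kap ρ = 0 by rw [this, smul_zero]
  have hI : (∃ t, I t = 2) ∨ (∀ t, I t = I 0) ∨
      ∃ g : Equiv.Perm (Fin 3), I = ![0, 0, 1] ∘ g ∨ I = ![0, 1, 1] ∘ g := by
    revert I; decide
  rcases hI with ⟨t, ht⟩ | hI | ⟨g, rfl | rfl⟩
  · rw [← dropMat_mul_kap, ← mul_assoc, mul_assoc (omega ρ), ← map_mul,
      h.omega_mul_row_zero (t := t), zero_mul]
    ext j
    rw [dropMat, Matrix.mul_diagonal]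
    by_cases hj : j = 2 <;> simp [sel, ht, hj]
  · have : sel I = Matrix.vecMulVec 1 (Pi.single (I 0) 1) := by
      ext i j
      simp [sel, Matrix.vecMulVec_apply, hI i]
    rw [this, h.vanish, mul_zero, zero_mul]
  · rw [← sel_mul, map_mul, ← mul_assoc]
    change omega ρ * sig ρ g * ρ dup₁ * _ = 0
    rw [omega_comm, mul_assoc, mul_assoc, ← mul_assoc (omega ρ), h.omega_mul_dup_kap.1, mul_zero]
  · rw [← sel_mul, map_mul, ← mul_assoc]
    change omega ρ * sig ρ g * ρ dup₂ * _ = 0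
    rw [omega_comm, mul_assoc, mul_assoc, ← mul_assoc (omega ρ), h.omega_mul_dup_kap.2, mul_zero]

lemma IsCubicRep.kap_mul_mul_omega (h : IsCubicRep ρ) (m : Mat) :
    kap ρ * ρ m * omega ρ = 0 := by
  have := h.op.omega_mul_mul_kap m.transpose
  rw [omega_opRep, kap_opRep] at this
  apply MulOpposite.op_injective
  simpa [opRep, mul_assoc] using this

lemma IsCubicRep.kap_mul_kap (h : IsCubicRep ρ) : kap ρ * kap ρ = (2 : ℤ) • kap ρ := by
  nth_rewrite 2 [kap]
  rw [mul_sub, mul_sub, mul_smul_comm, kap_mul_dropMat, ← mul_assoc, ← mul_assoc, ← mul_assoc,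
    ← mul_assoc, h.kap_mul_mul_omega, h.kap_mul_mul_omega]
  simp

/-- Insert `1 = ω + ∑ ρ(dropMat t)` between `P` and the rows; `κ` kills the `ω` term. This is the
source of additivity for the bilinear part. -/
lemma IsCubicRep.kap_mul_rows (h : IsCubicRep ρ) (x y z : Fin 3 → ℤ) (m : Mat) (P : Mat)
    (a b c : Mat) (hm : m = P * Matrix.of ![x, y, z]) (ha : a = P * dropMat 0 * Matrix.of ![x, y, z])
    (hb : b = P * dropMat 1 * Matrix.of ![x, y, z])
    (hc : c = P * dropMat 2 * Matrix.of ![x, y, z]) :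
    kap ρ * ρ m = kap ρ * ρ a + kap ρ * ρ b + kap ρ * ρ c := by
  have h1 : (1 : E) = omega ρ + ρ (dropMat 0) + ρ (dropMat 1) + ρ (dropMat 2) := by
    rw [omega]; abel
  rw [hm, map_mul, ← mul_one (ρ P), h1, ha, hb, hc]
  have h2 := h.kap_mul_mul_omega P
  simp only [mul_add, add_mul, map_mul, mul_assoc] at h2 ⊢
  rw [← mul_assoc (ρ P), ← mul_assoc (kap ρ), h2]
  simp

/-- The bilinear map `(x, y) ↦ κ ρ(x, y, 0)`. -/
def IsCubicRep.pairMap (h : IsCubicRep ρ) :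
    MultilinearMap ℤ (fun _ : Fin 2 => Fin 3 → ℤ) E :=
  have hadd (φ : Fin 2 → Fin 3 → ℤ) (t : Fin 2) (x y : Fin 3 → ℤ) :
      kap ρ * ρ (Matrix.of ![Function.update φ t (x + y) 0, Function.update φ t (x + y) 1, 0]) =
      kap ρ * ρ (Matrix.of ![Function.update φ t x 0, Function.update φ t x 1, 0]) +
      kap ρ * ρ (Matrix.of ![Function.update φ t y 0, Function.update φ t y 1, 0]) := by
    fin_cases t
    -- Left multiplication by `dup₁ᵀ` turns rows `x, y, z` into `x + y, z, 0`. Dropping `z` leaves a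
    -- rank-one matrix, so just two terms remain.
    · rw [h.kap_mul_rows x y (φ 1) _ dup₁.transpose (Matrix.of ![y, φ 1, 0])
        (Matrix.of ![x, φ 1, 0]) (Matrix.vecMulVec (Pi.single 0 1) (x + y)) _ _ _ _, h.vanish]
      · simp [add_comm]
      all_goals
        ext i j
        fin_cases i <;> simp [dup₁, sel, dropMat, Matrix.mul_apply, Fin.sum_univ_three,
          Pi.single_apply, Matrix.vecMulVec_apply]
    · rw [h.kap_mul_rows (φ 0) x y _ dup₂.transpose (Matrix.vecMulVec (Pi.single 1 1) (x + y))
        (Matrix.of ![φ 0, y, 0]) (Matrix.of ![φ 0, x, 0]) _ _ _ _, h.vanish]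
      · simp [add_comm]
      all_goals
        ext i j
        fin_cases i <;> simp [dup₂, sel, dropMat, Matrix.mul_apply, Fin.sum_univ_three,
          Pi.single_apply, Matrix.vecMulVec_apply]
  { toFun φ := kap ρ * ρ (Matrix.of ![φ 0, φ 1, 0])
    map_update_add' {i} φ t x y := by
      obtain rfl : i = instDecidableEqFin 2 := Subsingleton.elim _ _
      exact hadd φ t x y
    map_update_smul' {i} φ t n x := by
      obtain rfl : i = instDecidableEqFin 2 := Subsingleton.elim _ _
      exact map_zsmul (AddMonoidHom.mk' (fun x => kap ρ * ρ (Matrix.of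
        ![Function.update φ t x 0, Function.update φ t x 1, 0])) (hadd φ t)) n x }

lemma IsCubicRep.pairMap_apply (h : IsCubicRep ρ) (φ : Fin 2 → Fin 3 → ℤ) :
    h.pairMap φ = kap ρ * ρ (Matrix.of ![φ 0, φ 1, 0]) := rfl

end Ring

section Ring

variable {E : Type*} [Ring E] {ρ : Mat →* E}

/-- The matrix whose first two rows are the unit vectors `e_{I 0}`, `e_{I 1}`, with third row
zero. -/
def selPair (I : Fin 2 → Fin 3) : Mat := Matrix.of ![Pi.single (I 0) 1, Pi.single (I 1) 1, 0]

lemma IsCubicRep.kap_mul_eq_sum (h : IsCubicRep ρ) (m : Mat) :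
    kap ρ * ρ m =
      ∑ I : Fin 2 → Fin 3, (m 0 (I 0) * m 1 (I 1)) • (kap ρ * ρ (selPair I)) := by
  have h1 : (![m 0, m 1] : Fin 2 → Fin 3 → ℤ) =
      fun t => ∑ j, ![m 0, m 1] t j • (Pi.single j 1 : Fin 3 → ℤ) := by
    ext t j
    simp [Pi.single_apply]
  have h2 : kap ρ * ρ m = h.pairMap ![m 0, m 1] := by
    rw [← kap_mul_dropMat, mul_assoc, ← map_mul, h.pairMap_apply]
    congr 2
    ext i j
    fin_cases i <;> simp [dropMat]
  rw [h2, h1, MultilinearMap.map_sum]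
  refine Finset.sum_congr rfl fun I _ => ?_
  rw [MultilinearMap.map_smul_univ, Fin.prod_univ_two]
  rfl

lemma IsCubicRep.mul_kap_eq_sum (h : IsCubicRep ρ) (m : Mat) :
    ρ m * kap ρ =
      ∑ I : Fin 2 → Fin 3, (m (I 0) 0 * m (I 1) 1) • (ρ (selPair I).transpose * kap ρ) := by
  have := h.op.kap_mul_eq_sum m.transpose
  rw [kap_opRep] at this
  apply MulOpposite.op_injective
  simpa [opRep, ← MulOpposite.op_mul, Finset.op_sum, -zsmul_eq_mul] using this

/-- Two equal rows and a zero row form a matrix of rank at most one, so the bilinear map vanishes on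
the diagonal; polarize at `e₀ + e₁`. -/
lemma IsCubicRep.kap_mul_swap (h : IsCubicRep ρ) : kap ρ * ρ (selPair ![1, 0]) = - kap ρ := by
  have h0 (x : Fin 3 → ℤ) : h.pairMap ![x, x] = 0 := by
    have : (Matrix.of ![x, x, 0] : Mat) = Matrix.vecMulVec ![1, 1, 0] x := by
      ext i j
      fin_cases i <;> simp [Matrix.vecMulVec_apply]
    rw [h.pairMap_apply]
    change kap ρ * ρ (Matrix.of ![x, x, 0]) = 0
    rw [this, h.vanish, mul_zero]
  have hl (x y z : Fin 3 → ℤ) : h.pairMap ![x + y, z] = h.pairMap ![x, z] + h.pairMap ![y, z] := by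
    have e (a : Fin 3 → ℤ) : Function.update ![x, z] 0 a = ![a, z] := by
      ext i; fin_cases i <;> rfl
    have := h.pairMap.map_update_add ![x, z] 0 x y
    rwa [e, e, e] at this
  have hr (x y z : Fin 3 → ℤ) : h.pairMap ![z, x + y] = h.pairMap ![z, x] + h.pairMap ![z, y] := by
    have e (a : Fin 3 → ℤ) : Function.update ![z, x] 1 a = ![z, a] := by
      ext i; fin_cases i <;> rfl
    have := h.pairMap.map_update_add ![z, x] 1 x y
    rwa [e, e, e] at this
  have h1 := h0 (Pi.single 0 1 + Pi.single 1 1)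
  rw [hl, hr, hr, h0, h0, zero_add, add_zero] at h1
  have h2 : h.pairMap ![Pi.single 0 1, Pi.single 1 1] = kap ρ := by
    rw [h.pairMap_apply]
    conv_rhs => rw [← kap_mul_dropMat]
    congr 2
    decide
  rw [h2] at h1
  exact eq_neg_of_add_eq_zero_right h1

lemma IsCubicRep.swap_mul_kap (h : IsCubicRep ρ) : ρ (selPair ![1, 0]).transpose * kap ρ = -kap ρ := by
  have := h.op.kap_mul_swap
  rw [kap_opRep] at this
  apply MulOpposite.op_injective
  simpa [opRep] using this

lemma IsCubicRep.kap_mul_selPair_mul_kap (h : IsCubicRep ρ) (I : Fin 2 → Fin 3)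
    (h0 : I ≠ ![0, 1]) (h1 : I ≠ ![1, 0]) : kap ρ * ρ (selPair I) * kap ρ = 0 := by
  have hI : (I 0 = 2 ∨ I 1 = 2) ∨ I 0 = I 1 := by revert I; decide
  rcases hI with hI | hI
  · have e : kap ρ * ρ (selPair I) * kap ρ = kap ρ * ρ (selPair I * dropMat 2) * kap ρ := by
      rw [map_mul, ← mul_assoc, mul_assoc _ (ρ (dropMat 2)), dropMat_mul_kap]
    rw [e, h.kap_mul_eq_sum, Finset.sum_eq_zero, zero_mul]
    intro J _
    rw [dropMat, Matrix.mul_diagonal, Matrix.mul_diagonal]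
    have : selPair I 0 (J 0) * (if J 0 = 2 then 0 else 1) *
        (selPair I 1 (J 1) * (if J 1 = 2 then 0 else 1)) = 0 := by
      rcases hI with hI | hI
      · by_cases hj : J 0 = 2 <;> simp [selPair, hI, hj]
      · by_cases hj : J 1 = 2 <;> simp [selPair, hI, hj]
    rw [this, zero_smul]
  · have : selPair I = Matrix.vecMulVec ![1, 1, 0] (Pi.single (I 0) 1) := by
      ext i j
      fin_cases i <;> simp [selPair, Matrix.vecMulVec_apply, hI]
    rw [this, h.vanish, mul_zero, zero_mul]

lemma IsCubicRep.omega_mul_kap (h : IsCubicRep ρ) : omega ρ * kap ρ = 0 := by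
  simpa using h.omega_mul_mul_kap 1

end Ring

/-! ### Equivariant maps built from maps of multiplicity modules. -/

section Blocks

variable {R : Type*} [CommRing R] {W W' W'' : Type*} [AddCommGroup W] [Module R W]
  [AddCommGroup W'] [Module R W'] [AddCommGroup W''] [Module R W'']
  {ρ : Mat →* Module.End R W} {ρ' : Mat →* Module.End R W'} {ρ'' : Mat →* Module.End R W''}

/-- The operators whose images are the multiplicity modules of the three rational types. -/
def blockOp (ρ : Mat →* Module.End R W) (i : Fin 3) : Module.End R W :=
  ![kap ρ, qOp ρ, cOp ρ] i

/-- The multiplicity modules of the three rational types. -/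
abbrev block (ρ : Mat →* Module.End R W) (i : Fin 3) : Submodule R W :=
  LinearMap.range (blockOp ρ i)

/-- The denominators of the three central idempotents. -/
def blockDen (i : Fin 3) : ℤ := ![4, 6, 6] i

/-- A homomorphism of multiplicity modules, extended to the representations. -/
def inflate (ρ : Mat →* Module.End R W) (ρ' : Mat →* Module.End R W') (i : Fin 3) :
    (block ρ i →ₗ[R] block ρ' i) →ₗ[R] (W →ₗ[R] W') where
  toFun l := (block ρ' i).subtype ∘ₗ l ∘ₗ (blockOp ρ i).rangeRestrict
  map_add' a b := by ext; simp
  map_smul' a b := by ext; simp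

lemma inflate_apply (i : Fin 3) (l : block ρ i →ₗ[R] block ρ' i) (w : W) :
    inflate ρ ρ' i l w = l ⟨blockOp ρ i w, w, rfl⟩ := rfl

lemma inflate_apply_eq (i : Fin 3) (l : block ρ i →ₗ[R] block ρ' i) (w : W) (n : ℤ) (x : block ρ i)
    (hx : blockOp ρ i w = n • (x : W)) : inflate ρ ρ' i l w = n • (l x : W') := by
  rw [inflate_apply, show (⟨blockOp ρ i w, w, rfl⟩ : block ρ i) = n • x from Subtype.ext hx,
    map_zsmul]
  rfl

lemma inflate_apply_zero (i : Fin 3) (l : block ρ i →ₗ[R] block ρ' i) (w : W)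
    (hx : blockOp ρ i w = 0) : inflate ρ ρ' i l w = 0 := by
  simpa using inflate_apply_eq i l w 0 0 (by simpa using hx)

/-- The sum `∑ ρ'(aᵀ) Λ ρ(a)` over a family of matrices. -/
def symSum (ρ : Mat →* Module.End R W) (ρ' : Mat →* Module.End R W') {ι : Type} [Fintype ι]
    (a : ι → Mat) : (W →ₗ[R] W') →ₗ[R] (W →ₗ[R] W') where
  toFun Λ := ∑ I, ρ' (a I).transpose ∘ₗ Λ ∘ₗ ρ (a I)
  map_add' x y := by simp [LinearMap.comp_add, LinearMap.add_comp, Finset.sum_add_distrib]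
  map_smul' r x := by simp [LinearMap.comp_smul, LinearMap.smul_comp, Finset.smul_sum]

/-- Moving `g` in from either side and expanding gives the same double sum of `ρ'(a Jᵀ) Λ ρ(a I)`.
The hypothesis `hc` says that the two coefficient matrices are transposes of each other. -/
lemma symSum_comm {ι : Type} [Fintype ι] (a : ι → Mat) (c : Mat → ι → ℤ)
    (hc : ∀ g I J, c (a J * g) I = c (a I * g.transpose) J) (Λ : W →ₗ[R] W')
    (h1 : ∀ m, Λ ∘ₗ ρ m = ∑ I, c m I • Λ ∘ₗ ρ (a I))
    (h2 : ∀ m, ρ' m ∘ₗ Λ = ∑ I, c m.transpose I • ρ' (a I).transpose ∘ₗ Λ) (g : Mat) :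
    ρ' g ∘ₗ symSum ρ ρ' a Λ = symSum ρ ρ' a Λ ∘ₗ ρ g := by
  have e1 (I : ι) : ρ' g ∘ₗ ρ' (a I).transpose ∘ₗ Λ ∘ₗ ρ (a I) =
      ∑ J, c (a I * g.transpose) J • ρ' (a J).transpose ∘ₗ Λ ∘ₗ ρ (a I) := by
    rw [← LinearMap.comp_assoc, ← LinearMap.comp_assoc]
    change (ρ' g * ρ' (a I).transpose) ∘ₗ Λ ∘ₗ _ = _
    rw [← map_mul, ← LinearMap.comp_assoc, h2]
    ext w
    simp [Matrix.transpose_mul, -zsmul_eq_mul]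
  have e2 (J : ι) : (ρ' (a J).transpose ∘ₗ Λ ∘ₗ ρ (a J)) ∘ₗ ρ g =
      ∑ I, c (a J * g) I • ρ' (a J).transpose ∘ₗ Λ ∘ₗ ρ (a I) := by
    rw [LinearMap.comp_assoc, LinearMap.comp_assoc]
    change ρ' (a J).transpose ∘ₗ Λ ∘ₗ (ρ (a J) * ρ g) = _
    rw [← map_mul, h1]
    ext w
    simp [map_sum, map_zsmul, -zsmul_eq_mul]
  have e3 : (∑ J, ρ' (a J).transpose ∘ₗ Λ ∘ₗ ρ (a J)) ∘ₗ ρ g =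
      ∑ J, (ρ' (a J).transpose ∘ₗ Λ ∘ₗ ρ (a J)) ∘ₗ ρ g := by
    ext w; simp
  have e4 : ρ' g ∘ₗ (∑ J, ρ' (a J).transpose ∘ₗ Λ ∘ₗ ρ (a J)) =
      ∑ J, ρ' g ∘ₗ (ρ' (a J).transpose ∘ₗ Λ ∘ₗ ρ (a J)) := by
    ext w; simp
  change ρ' g ∘ₗ (∑ J, ρ' (a J).transpose ∘ₗ Λ ∘ₗ ρ (a J)) =
    (∑ J, ρ' (a J).transpose ∘ₗ Λ ∘ₗ ρ (a J)) ∘ₗ ρ g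
  rw [e3, e4]
  simp only [e1, e2]
  rw [Finset.sum_comm]
  exact Finset.sum_congr rfl fun J _ => Finset.sum_congr rfl fun I _ => by
    rw [hc, Matrix.transpose_transpose]

/-- The homomorphism of representations attached to a homomorphism of multiplicity modules. -/
def sharp (ρ : Mat →* Module.End R W) (ρ' : Mat →* Module.End R W') (i : Fin 3)
    (l : block ρ i →ₗ[R] block ρ' i) : W →ₗ[R] W' :=
  -- On the sign block every matrix acts through its determinant once things are doubled, so no
  -- averaging is needed beyond the factor 2.
  ![symSum ρ ρ' selPair, symSum ρ ρ' sel, (2 : ℤ) • LinearMap.id] i (inflate ρ ρ' i l)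

lemma sharp_add (i : Fin 3) (l l' : block ρ i →ₗ[R] block ρ' i) :
    sharp ρ ρ' i (l + l') = sharp ρ ρ' i l + sharp ρ ρ' i l' := by
  simp [sharp]

lemma sharp_zsmul (i : Fin 3) (n : ℤ) (l : block ρ i →ₗ[R] block ρ' i) :
    sharp ρ ρ' i (n • l) = n • sharp ρ ρ' i l :=
  map_zsmul (AddMonoidHom.mk' (sharp ρ ρ' i) (sharp_add i)) n l

lemma sharp_zero_eq (l : block ρ 0 →ₗ[R] block ρ' 0) (w : W) :
    sharp ρ ρ' 0 l w =
      ∑ I, ρ' (selPair I).transpose (inflate ρ ρ' 0 l (ρ (selPair I) w)) := by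
  simp [sharp, symSum]

lemma sharp_one_eq (l : block ρ 1 →ₗ[R] block ρ' 1) (w : W) :
    sharp ρ ρ' 1 l w = ∑ I, ρ' (sel I).transpose (inflate ρ ρ' 1 l (ρ (sel I) w)) := by
  simp [sharp, symSum]

lemma sharp_two_eq (l : block ρ 2 →ₗ[R] block ρ' 2) (w : W) :
    sharp ρ ρ' 2 l w = (2 : ℤ) • inflate ρ ρ' 2 l w := rfl

lemma inflate_comp_eq_sum {ι : Type} [Fintype ι] {i : Fin 3} (l : block ρ i →ₗ[R] block ρ' i)
    (m : Mat) (c : ι → ℤ) (a : ι → Mat)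
    (h : blockOp ρ i * ρ m = ∑ I, c I • (blockOp ρ i * ρ (a I))) :
    inflate ρ ρ' i l ∘ₗ ρ m = ∑ I, c I • inflate ρ ρ' i l ∘ₗ ρ (a I) := by
  have : (blockOp ρ i).rangeRestrict ∘ₗ ρ m =
      ∑ I, c I • (blockOp ρ i).rangeRestrict ∘ₗ ρ (a I) := by
    ext w
    have := LinearMap.congr_fun h w
    simpa [-zsmul_eq_mul] using this
  ext w
  have := congrArg ((block ρ' i).subtype ∘ₗ l) (LinearMap.congr_fun this w)
  simp only [LinearMap.sum_apply, LinearMap.smul_apply, map_sum, map_zsmul] at this ⊢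
  exact this

lemma comp_inflate_eq_sum {ι : Type} [Fintype ι] {i : Fin 3} (l : block ρ i →ₗ[R] block ρ' i)
    (m : Mat) (c : ι → ℤ) (a : ι → Mat)
    (h : ρ' m * blockOp ρ' i = ∑ I, c I • (ρ' (a I) * blockOp ρ' i)) :
    ρ' m ∘ₗ inflate ρ ρ' i l = ∑ I, c I • ρ' (a I) ∘ₗ inflate ρ ρ' i l := by
  ext w
  obtain ⟨y, hy⟩ := (l ⟨blockOp ρ i w, w, rfl⟩).2
  have := LinearMap.congr_fun h y
  simp only [LinearMap.coe_comp, Function.comp_apply, inflate_apply, LinearMap.sum_apply,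
    LinearMap.smul_apply, ← hy]
  simpa [-zsmul_eq_mul] using this

lemma fin_three_cases (i : Fin 3) : i = 0 ∨ i = 1 ∨ i = 2 := by
  revert i; decide

lemma sharp_comm (h : IsCubicRep ρ) (h' : IsCubicRep ρ') (i : Fin 3)
    (l : block ρ i →ₗ[R] block ρ' i) (g : Mat) :
    ρ' g ∘ₗ sharp ρ ρ' i l = sharp ρ ρ' i l ∘ₗ ρ g := by
  obtain rfl | rfl | rfl := fin_three_cases i
  · refine symSum_comm selPair (fun m I => m 0 (I 0) * m 1 (I 1)) (fun g I J => ?_) _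
      (fun m => inflate_comp_eq_sum l m _ _ (h.kap_mul_eq_sum m))
      (fun m => comp_inflate_eq_sum l m _ _ (h'.mul_kap_eq_sum m)) g
    simp [selPair, Matrix.mul_apply, Pi.single_apply]
  · refine symSum_comm sel (fun m I => ∏ t, m t (I t)) (fun g I J => ?_) _
      (fun m => inflate_comp_eq_sum l m _ _ ?_) (fun m => comp_inflate_eq_sum l m _ _ ?_) g
    · simp [sel, Matrix.mul_apply, Pi.single_apply]
    · have := h.omega_mul_eq_sum m
      have := congrArg ((1 + sig ρ s₁₂) * ·) this
      simp only [Finset.mul_sum, ← mul_assoc, mul_smul_comm] at this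
      exact this
    · have := h'.mul_omega_eq_sum m
      have := congrArg (· * (1 + sig ρ' s₁₂)) this
      simp only [Finset.sum_mul, mul_assoc, smul_mul_assoc, ← qOp_eq] at this
      exact this
  · ext w
    change ρ' g ((2 : ℤ) • inflate ρ ρ' 2 l w) = (2 : ℤ) • inflate ρ ρ' 2 l (ρ g w)
    have h1 := LinearMap.congr_fun (h.two_cOp_mul g) w
    obtain ⟨y, hy⟩ := (l ⟨blockOp ρ 2 w, w, rfl⟩).2
    have h2 := LinearMap.congr_fun (h'.mul_two_cOp g) y
    have h3 : (2 : ℤ) • inflate ρ ρ' 2 l (ρ g w) = (g.det * 2) • blockOp ρ' 2 y := by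
      rw [← map_zsmul, inflate_apply_eq 2 l _ (g.det * 2) ⟨blockOp ρ 2 w, w, rfl⟩, ← hy]
      rw [map_zsmul, mul_smul]
      exact h1
    rw [h3, inflate_apply, ← hy, map_zsmul, mul_smul]
    exact h2

/-- For `κ` only the identity and the swap contribute, each giving 2 because `κ² = 2κ` and the swap
acts by `-1` on both sides. For `q` the sum is `sum_chi`, giving 6. For `c` the 6 is the factor 2 in
`sharp` times the 3 in `c² = 3c`. -/
lemma IsCubicRep.sharp_apply_block (h : IsCubicRep ρ) (h' : IsCubicRep ρ') (i : Fin 3)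
    (l : block ρ i →ₗ[R] block ρ' i) (x : block ρ i) :
    sharp ρ ρ' i l x = blockDen i • (l x : W') := by
  obtain ⟨_, y, rfl⟩ := x
  obtain ⟨z, hz⟩ := (l ⟨blockOp ρ i y, y, rfl⟩).2
  obtain rfl | rfl | rfl := fin_three_cases i
  · have hne : (![0, 1] : Fin 2 → Fin 3) ≠ ![1, 0] := by decide
    have e0 : selPair ![0, 1] = dropMat 2 := by decide
    have e1 := LinearMap.congr_fun h.kap_mul_kap y
    have e2 := LinearMap.congr_fun (dropMat_mul_kap ρ') z
    have e3 := LinearMap.congr_fun h'.swap_mul_kap z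
    rw [sharp_zero_eq, ← Finset.sum_subset (Finset.subset_univ {![0, 1], ![1, 0]}),
      Finset.sum_pair hne,
      inflate_apply_eq 0 l _ 2 ⟨blockOp ρ 0 y, y, rfl⟩,
      inflate_apply_eq 0 l _ (-2) ⟨blockOp ρ 0 y, y, rfl⟩, ← hz]
    · rw [e0, map_zsmul, map_zsmul]
      change (2 : ℤ) • (ρ' (dropMat 2).transpose) (kap ρ' z) +
        (-2 : ℤ) • (ρ' (selPair ![1, 0]).transpose) (kap ρ' z) = (4 : ℤ) • kap ρ' z
      simp only [Module.End.mul_apply, LinearMap.neg_apply] at e2 e3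
      rw [show (dropMat 2).transpose = dropMat 2 by simp [dropMat], e2, e3]
      module
    · change (kap ρ * ρ _ * kap ρ) y = (-2 : ℤ) • kap ρ y
      rw [h.kap_mul_swap, neg_mul, LinearMap.neg_apply, e1, neg_smul]
      rfl
    · change (kap ρ * ρ _ * kap ρ) y = (2 : ℤ) • kap ρ y
      rw [e0, kap_mul_dropMat]
      exact e1
    · intro I _ hI
      rw [inflate_apply_zero, map_zero]
      simp only [Finset.mem_insert, Finset.mem_singleton, not_or] at hI
      exact LinearMap.congr_fun (h.kap_mul_selPair_mul_kap I hI.1 hI.2) y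
  · have e1 := LinearMap.congr_fun h'.sum_chi z
    rw [sharp_one_eq, ← hz]
    change _ = (6 : ℤ) • qOp ρ' z
    rw [LinearMap.smul_apply] at e1
    rw [← e1, LinearMap.sum_apply]
    symm
    refine Fintype.sum_of_injective (fun g : Equiv.Perm (Fin 3) => (g : Fin 3 → Fin 3))
      DFunLike.coe_injective _ _ (fun I hI => ?_) fun g => ?_
    · rw [inflate_apply_zero, map_zero]
      change (qOp ρ * (ρ (sel I) * qOp ρ)) y = 0
      rw [qOp_eq, ← mul_assoc (ρ (sel I)), h.sel_mul_omega]
      · simp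
      intro hs
      exact hI ⟨Equiv.ofBijective I (Finite.injective_iff_surjective.2 hs |> fun h => ⟨h, hs⟩), rfl⟩
    · rw [inflate_apply_eq 1 l _ (chi g) ⟨blockOp ρ 1 y, y, rfl⟩, ← hz, map_zsmul, sel_transpose]
      · rfl
      · exact LinearMap.congr_fun (h.qOp_mul_sig_mul_qOp g) y
  · rw [sharp_two_eq, inflate_apply_eq 2 l _ 3 ⟨blockOp ρ 2 y, y, rfl⟩]
    · rw [← mul_smul]
      rfl
    · exact LinearMap.congr_fun h.cOp_mul_cOp y

lemma IsCubicRep.sharp_apply_block_of_ne (h : IsCubicRep ρ) (i j : Fin 3) (hij : i ≠ j)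
    (l : block ρ i →ₗ[R] block ρ' i) (x : block ρ j) : sharp ρ ρ' i l x = 0 := by
  obtain ⟨_, y, rfl⟩ := x
  change sharp ρ ρ' i l (blockOp ρ j y) = 0
  have k0 (m : Mat) : kap ρ * ρ m * qOp ρ = 0 := by
    rw [← h.omega_mul_qOp, ← mul_assoc, h.kap_mul_mul_omega, zero_mul]
  have k1 (m : Mat) : kap ρ * ρ m * cOp ρ = 0 := by
    rw [← h.omega_mul_cOp, ← mul_assoc, h.kap_mul_mul_omega, zero_mul]
  have k2 (m : Mat) : qOp ρ * ρ m * kap ρ = 0 := by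
    rw [← h.qOp_mul_omega, mul_assoc, mul_assoc, ← mul_assoc (omega ρ), h.omega_mul_mul_kap,
      mul_zero]
  have k3 : cOp ρ * kap ρ = 0 := by
    rw [← h.cOp_mul_omega, mul_assoc, h.omega_mul_kap, mul_zero]
  have k4 (I : Fin 3 → Fin 3) : qOp ρ * ρ (sel I) * cOp ρ = 0 := by
    by_cases hs : Function.Surjective I
    · exact h.qOp_mul_sig_mul_cOp
        (Equiv.ofBijective I (Finite.injective_iff_surjective.2 hs |> fun h => ⟨h, hs⟩))
    · rw [cOp_eq, ← mul_assoc, mul_assoc (qOp ρ), h.sel_mul_omega hs]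
      simp
  obtain rfl | rfl | rfl := fin_three_cases i <;> obtain rfl | rfl | rfl := fin_three_cases j
  · exact absurd rfl hij
  · rw [sharp_zero_eq]
    refine Finset.sum_eq_zero fun I _ => ?_
    rw [inflate_apply_zero, map_zero]
    exact LinearMap.congr_fun (k0 (selPair I)) y
  · rw [sharp_zero_eq]
    refine Finset.sum_eq_zero fun I _ => ?_
    rw [inflate_apply_zero, map_zero]
    exact LinearMap.congr_fun (k1 (selPair I)) y
  · rw [sharp_one_eq]
    refine Finset.sum_eq_zero fun I _ => ?_
    rw [inflate_apply_zero, map_zero]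
    exact LinearMap.congr_fun (k2 (sel I)) y
  · exact absurd rfl hij
  · rw [sharp_one_eq]
    refine Finset.sum_eq_zero fun I _ => ?_
    rw [inflate_apply_zero, map_zero]
    exact LinearMap.congr_fun (k4 I) y
  · rw [sharp_two_eq, inflate_apply_zero, smul_zero]
    exact LinearMap.congr_fun k3 y
  · rw [sharp_two_eq, inflate_apply_zero, smul_zero]
    exact LinearMap.congr_fun h.cOp_mul_qOp y
  · exact absurd rfl hij

/-- A homomorphism that commutes with the action of all matrices commutes with the operators
that define the blocks. -/
lemma comm_blockOp {f : W →ₗ[R] W'} (hf : ∀ g, ρ' g ∘ₗ f = f ∘ₗ ρ g) (i : Fin 3) (w : W) :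
    blockOp ρ' i (f w) = f (blockOp ρ i w) := by
  have hf' (g : Mat) (w : W) : ρ' g (f w) = f (ρ g w) := LinearMap.congr_fun (hf g) w
  have ho (w : W) : omega ρ' (f w) = f (omega ρ w) := by
    simp [omega, hf']
  obtain rfl | rfl | rfl := fin_three_cases i
  · simp [blockOp, kap, hf', ho, -zsmul_eq_mul]
  · simp [blockOp, qOp, hf', ho, sig]
  · simp [blockOp, cOp, hf', ho, sig]

/-- Equivariance moves the inner map past the matrices to the block, where it is multiplication by
the denominator followed by `l`. -/
lemma sharp_comp (h : IsCubicRep ρ) (h' : IsCubicRep ρ') (i : Fin 3)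
    (l : block ρ i →ₗ[R] block ρ' i) (l' : block ρ' i →ₗ[R] block ρ'' i) :
    sharp ρ' ρ'' i l' ∘ₗ sharp ρ ρ' i l = blockDen i • sharp ρ ρ'' i (l' ∘ₗ l) := by
  have hc (g : Mat) (w : W) : ρ' g (sharp ρ ρ' i l w) = sharp ρ ρ' i l (ρ g w) :=
    LinearMap.congr_fun (sharp_comm h h' i l g) w
  have key (w : W) : inflate ρ' ρ'' i l' (sharp ρ ρ' i l w) =
      blockDen i • inflate ρ ρ'' i (l' ∘ₗ l) w := by
    rw [inflate_apply_eq i l' _ (blockDen i) (l ⟨blockOp ρ i w, w, rfl⟩)]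
    · rfl
    · rw [comm_blockOp (sharp_comm h h' i l)]
      exact h.sharp_apply_block h' i l ⟨blockOp ρ i w, w, rfl⟩
  ext w
  rw [LinearMap.comp_apply, LinearMap.smul_apply]
  obtain rfl | rfl | rfl := fin_three_cases i
  · rw [sharp_zero_eq l', sharp_zero_eq (l' ∘ₗ l), Finset.smul_sum]
    exact Finset.sum_congr rfl fun I _ => by rw [hc, key, map_zsmul]
  · rw [sharp_one_eq l', sharp_one_eq (l' ∘ₗ l), Finset.smul_sum]
    exact Finset.sum_congr rfl fun I _ => by rw [hc, key, map_zsmul]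
  · rw [sharp_two_eq l', key, sharp_two_eq (l' ∘ₗ l), smul_comm]

/-- The blocks detect membership in a subrepresentation up to a factor `6`. -/
lemma six_smul_mem (U : Submodule ℤ W) (h : IsCubicRep ρ) (hU : ∀ g, ∀ u ∈ U, ρ g u ∈ U) (w : W)
    (hw : ∀ i g, blockOp ρ i (ρ g w) ∈ U) : (6 : ℤ) • w ∈ U := by
  -- The third cross-effect is recovered from `q` and `c` up to 3; below, the definition of `κ`
  -- costs a further factor 2.
  have h1 (g : Mat) : (3 : ℤ) • omega ρ (ρ g w) ∈ U := by
    have := LinearMap.congr_fun h.three_omega (ρ g w)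
    simp only [LinearMap.smul_apply] at this
    rw [this]
    refine U.add_mem (U.add_mem (U.add_mem (hw 2 g) (hw 1 g)) (hU _ _ ?_)) (hU _ _ ?_)
    · have := hw 1 (sel ⇑(rot * rot) * g)
      rwa [map_mul] at this
    · have := hw 1 (sel ⇑rot * g)
      rwa [map_mul] at this
  have h2 (g : Mat) : (6 : ℤ) • ρ (dropMat 2 * g) w ∈ U := by
    have h3 : (6 : ℤ) • ρ (dropMat 2 * g) w = (3 : ℤ) • kap ρ (ρ g w) +
        ρ dup₁.transpose ((3 : ℤ) • omega ρ (ρ (dup₁ * g) w)) +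
        ρ dup₂.transpose ((3 : ℤ) • omega ρ (ρ (dup₂ * g) w)) := by
      simp only [kap, LinearMap.sub_apply, LinearMap.smul_apply, Module.End.mul_apply, map_mul,
        map_zsmul]
      module
    rw [h3]
    exact U.add_mem (U.add_mem (U.smul_mem _ (hw 0 g)) (hU _ _ (h1 _))) (hU _ _ (h1 _))
  have h3 (t : Fin 3) : (6 : ℤ) • ρ (dropMat t) w ∈ U := by
    have : dropMat t = sel (Equiv.swap t 2) * (dropMat 2 * sel (Equiv.swap t 2)) := by
      revert t; decide
    rw [this, map_mul, Module.End.mul_apply, ← map_zsmul]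
    exact hU _ _ (h2 _)
  have h4 : (6 : ℤ) • w = (2 : ℤ) • ((3 : ℤ) • omega ρ (ρ 1 w)) + (6 : ℤ) • ρ (dropMat 0) w +
      (6 : ℤ) • ρ (dropMat 1) w + (6 : ℤ) • ρ (dropMat 2) w := by
    rw [map_one]
    simp only [omega, LinearMap.sub_apply, Module.End.one_apply]
    module
  rw [h4]
  exact U.add_mem (U.add_mem (U.add_mem (U.smul_mem _ (h1 1)) (h3 0)) (h3 1)) (h3 2)

end Blocks

/-! ### Sublattices as images of endomorphisms congruent to the identity -/

/-- In a Smith basis `L` is spanned by multiples `a i • b i` with `a i` prime to 6. Changing signs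
does not change the span and makes every factor congruent to 1 modulo `k`, so the diagonal map with
these factors has the form `1 + kμ`. -/
lemma exists_range_one_add_smul_of_free (K : Type*) [AddCommGroup K] [Module.Finite ℤ K]
    [Module.Free ℤ K] (L : Submodule ℤ K) (d k : ℤ) (hd : IsCoprime d 6)
    (hk : ∀ a : ℤ, IsCoprime a 6 → k ∣ a - 1 ∨ k ∣ -a - 1) (hdL : ∀ x : K, d • x ∈ L) :
    ∃ μ : K →ₗ[ℤ] K, Function.Injective (1 + k • μ : Module.End ℤ K) ∧
      LinearMap.range (1 + k • μ : Module.End ℤ K) = L := by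
  have hd0 : d ≠ 0 := by
    rintro rfl
    rw [isCoprime_zero_left, Int.isUnit_iff] at hd
    omega
  have hrank : Module.finrank ℤ L = Module.finrank ℤ K := by
    refine le_antisymm (Submodule.finrank_le L) ?_
    let g : K →ₗ[ℤ] L := (d • LinearMap.id : K →ₗ[ℤ] K).codRestrict L hdL
    refine LinearMap.finrank_le_finrank_of_injective (f := g) fun x y hxy => ?_
    have := congrArg Subtype.val hxy
    exact smul_right_injective K hd0 this
  obtain ⟨b, a, c, hc⟩ := Submodule.exists_smith_normal_form_of_rank_eq
    (Module.Free.chooseBasis ℤ K) hrank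
  -- Compare coordinates of `d • b i`, which lies in `L`.
  have ha (i) : a i ∣ d := by
    have h1 := c.sum_repr ⟨d • b i, hdL _⟩
    have h2 := congrArg (fun x : L => b.repr (x : K) i) h1
    simp only [Submodule.coe_sum, Submodule.coe_smul, hc, map_sum, map_smul, Finsupp.coe_finsetSum,
      Finset.sum_apply, Finsupp.smul_apply, Module.Basis.repr_self, Finsupp.single_apply,
      smul_eq_mul, mul_ite, mul_one, mul_zero, Finset.sum_ite_eq', Finset.mem_univ, if_true] at h2
    exact ⟨_, by rw [← h2, mul_comm]⟩
  have he (i) : ∃ ε e : ℤ, (ε = 1 ∨ ε = -1) ∧ ε * a i = 1 + k * e := by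
    rcases hk (a i) (hd.of_isCoprime_of_dvd_left (ha i)) with ⟨e, h⟩ | ⟨e, h⟩
    · exact ⟨1, e, Or.inl rfl, by linarith⟩
    · exact ⟨-1, e, Or.inr rfl, by linarith⟩
  choose ε e hε he using he
  let μ : K →ₗ[ℤ] K := b.constr ℤ fun i => e i • b i
  have hμ (i) : (1 + k • μ : Module.End ℤ K) (b i) = (ε i * a i) • b i := by
    rw [he]
    simp only [LinearMap.add_apply, Module.End.one_apply, LinearMap.smul_apply, μ,
      Module.Basis.constr_basis]
    module
  have hr : LinearMap.range (1 + k • μ : Module.End ℤ K) = L := by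
    rw [LinearMap.range_eq_map, ← b.span_eq, Submodule.map_span, ← Set.range_comp]
    refine le_antisymm (Submodule.span_le.2 ?_) fun x hx => ?_
    · rintro _ ⟨i, rfl⟩
      rw [Function.comp_apply, hμ, mul_smul, ← hc]
      exact L.smul_mem _ (c i).2
    · have h1 := congrArg Subtype.val (c.sum_repr ⟨x, hx⟩)
      rw [Submodule.coe_sum] at h1
      change _ = x at h1
      rw [← h1]
      refine Submodule.sum_mem _ fun i _ => ?_
      have h2 : ((c.repr ⟨x, hx⟩ i • c i : L) : K) =
          (c.repr ⟨x, hx⟩ i * ε i) • (1 + k • μ : Module.End ℤ K) (b i) := by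
        rw [hμ, Submodule.coe_smul, hc, ← mul_smul, ← mul_smul]
        congr 1
        have : ε i * ε i = 1 := by rcases hε i with h | h <;> rw [h] <;> rfl
        calc _ = c.repr ⟨x, hx⟩ i * (ε i * ε i) * a i := by rw [this]; ring
          _ = _ := by ring
      rw [h2]
      exact Submodule.smul_mem _ _ (Submodule.subset_span ⟨i, rfl⟩)
  refine ⟨μ, ?_, hr⟩
  rw [← LinearMap.ker_eq_bot]
  have hfr := Submodule.finrank_quotient_add_finrank
    (LinearMap.ker (1 + k • μ : Module.End ℤ K))
  rw [(LinearMap.quotKerEquivRange (1 + k • μ : Module.End ℤ K)).finrank_eq, hr, hrank] at hfr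
  exact Submodule.finrank_eq_zero.1 (by omega)

lemma exists_range_one_add_smul (K : Type*) [AddCommGroup K] [Module.Finite ℤ K]
    (L : Submodule ℤ K) (d k : ℤ) (hd : IsCoprime d 6)
    (hk : ∀ a : ℤ, IsCoprime a 6 → k ∣ a - 1 ∨ k ∣ -a - 1) (hdL : ∀ x : K, d • x ∈ L)
    (htors : ∀ x : K, d • x = 0 → x = 0) :
    ∃ μ : K →ₗ[ℤ] K, Function.Injective (1 + k • μ : Module.End ℤ K) ∧
      LinearMap.range (1 + k • μ : Module.End ℤ K) = L := by
  let T := Submodule.torsion ℤ K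
  -- Multiplication by `d` is injective on the finite group `T`, hence surjective, so `T = dT` lies
  -- in `L`. The question thus descends to the free quotient, from which `μ` is pulled back along a
  -- section.
  have hT : T ≤ L := by
    have hfin : Finite T := Module.finite_of_fg_torsion T Submodule.torsion_isTorsion
    intro t ht
    have hinj : Function.Injective (fun x : T => d • x) := by
      intro x y hxy
      have h1 : d • ((x - y : T) : K) = 0 := by
        have := congrArg Subtype.val (sub_eq_zero.2 hxy)
        simpa [smul_sub, -zsmul_eq_mul] using this
      have := htors _ h1
      exact sub_eq_zero.1 (Subtype.ext this)
    obtain ⟨x, hx⟩ := Finite.injective_iff_surjective.1 hinj ⟨t, ht⟩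
    have := congrArg Subtype.val hx
    rw [← show d • (x : K) = t from this]
    exact hdL _
  have hfree : Module.Free ℤ (K ⧸ T) := Module.free_iff_isTorsionFree.2 inferInstance
  obtain ⟨s, hs⟩ := Module.projective_lifting_property T.mkQ (LinearMap.id : (K ⧸ T) →ₗ[ℤ] _)
    T.mkQ_surjective
  have hs' (y : K ⧸ T) : T.mkQ (s y) = y := LinearMap.congr_fun hs y
  obtain ⟨μ, hμ, hr⟩ := exists_range_one_add_smul_of_free (K ⧸ T) (L.map T.mkQ) d k hd hk (by
    intro x
    obtain ⟨x, rfl⟩ := T.mkQ_surjective x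
    rw [← map_smul]
    exact Submodule.mem_map_of_mem (hdL x))
  have hν (x : K) : T.mkQ ((1 + k • (s ∘ₗ μ ∘ₗ T.mkQ) : Module.End ℤ K) x) =
      (1 + k • μ : Module.End ℤ (K ⧸ T)) (T.mkQ x) := by
    simp only [LinearMap.add_apply, Module.End.one_apply, LinearMap.smul_apply, map_add, map_smul,
      LinearMap.comp_apply, hs']
  have hν' (x : K) (hx : T.mkQ x = 0) : (1 + k • (s ∘ₗ μ ∘ₗ T.mkQ) : Module.End ℤ K) x = x := by
    simp only [LinearMap.add_apply, Module.End.one_apply, LinearMap.smul_apply,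
      LinearMap.comp_apply, hx, map_zero, smul_zero, add_zero]
  refine ⟨s ∘ₗ μ ∘ₗ T.mkQ, ?_, le_antisymm ?_ ?_⟩
  · rw [injective_iff_map_eq_zero]
    intro x hx
    have h1 := hν x
    rw [hx, map_zero] at h1
    have h2 := (injective_iff_map_eq_zero _).1 hμ _ h1.symm
    rw [← hν' x h2, hx]
  · rintro _ ⟨x, rfl⟩
    have h1 : (1 + k • μ : Module.End ℤ (K ⧸ T)) (T.mkQ x) ∈ L.map T.mkQ := hr ▸ ⟨_, rfl⟩
    rw [← hν] at h1
    obtain ⟨l, hl, hl'⟩ := h1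
    rw [← sub_eq_zero, ← map_sub, Submodule.mkQ_apply, Submodule.Quotient.mk_eq_zero] at hl'
    have := L.sub_mem hl (hT hl')
    rwa [sub_sub_cancel] at this
  · intro l hl
    have h1 : T.mkQ l ∈ LinearMap.range (1 + k • μ : Module.End ℤ (K ⧸ T)) :=
      hr ▸ Submodule.mem_map_of_mem hl
    obtain ⟨z, hz⟩ := h1
    obtain ⟨z, rfl⟩ := T.mkQ_surjective z
    rw [← hν, ← sub_eq_zero, ← map_sub] at hz
    refine ⟨z - ((1 + k • (s ∘ₗ μ ∘ₗ T.mkQ) : Module.End ℤ K) z - l), ?_⟩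
    rw [map_sub, hν' _ hz, sub_sub_cancel]

/-- The unit groups of `ℤ/4` and `ℤ/6` are `{±1}`. This is why local isomorphism suffices for global
isomorphism. -/
lemma blockDen_dvd (i : Fin 3) (a : ℤ) (ha : IsCoprime a 6) :
    blockDen i ∣ a - 1 ∨ blockDen i ∣ -a - 1 := by
  have h2 : ¬ (2 : ℤ) ∣ a := fun h => by
    have := ha.isUnit_of_dvd' h (by norm_num)
    rw [Int.isUnit_iff] at this
    omega
  have h3 : ¬ (3 : ℤ) ∣ a := fun h => by
    have := ha.isUnit_of_dvd' h (by norm_num)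
    rw [Int.isUnit_iff] at this
    omega
  have h6 : (6 : ℤ) ∣ a - 1 ∨ (6 : ℤ) ∣ -a - 1 := by
    obtain h | h | h | h | h | h : a % 6 = 0 ∨ a % 6 = 1 ∨ a % 6 = 2 ∨ a % 6 = 3 ∨ a % 6 = 4 ∨
      a % 6 = 5 := by omega
    all_goals omega
  obtain rfl | rfl | rfl := fin_three_cases i
  · change (4 : ℤ) ∣ _ ∨ (4 : ℤ) ∣ _
    omega
  · exact h6
  · exact h6

lemma mem_of_isCoprime_smul_mem {W : Type*} [AddCommGroup W] (U : Submodule ℤ W) {a b : ℤ}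
    (hab : IsCoprime a b) {x : W} (ha : a • x ∈ U) (hb : b • x ∈ U) : x ∈ U := by
  obtain ⟨u, v, huv⟩ := hab
  rw [← one_smul ℤ x, ← huv, add_smul, mul_smul, mul_smul]
  exact U.add_mem (U.smul_mem _ ha) (U.smul_mem _ hb)

/-! ### Subrepresentations of index prime to `6` as images of endomorphisms. -/

section Index

variable {W : Type*} [AddCommGroup W] {ρ : Mat →* Module.End ℤ W}

/-- An endomorphism of the representation that is invertible up to `d` and acts on one block in a
prescribed way. -/
lemma exists_end_of_block [Module.Finite ℤ W] (h : IsCubicRep ρ) (d : ℤ) (hd : IsCoprime d 6)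
    (htors : ∀ x : W, d • x = 0 → x = 0) (i : Fin 3) (L : Submodule ℤ (block ρ i))
    (hL : ∀ x, d • x ∈ L) :
    ∃ n n' : W →ₗ[ℤ] W, (∀ g, ρ g ∘ₗ n = n ∘ₗ ρ g) ∧ (∀ x, n' (n x) = d • x) ∧
      (∀ x, n (n' x) = d • x) ∧ (∀ j, j ≠ i → ∀ x : block ρ j, n x = x) ∧
      (∀ x : block ρ i, ∃ y : L, n x = (y : block ρ i)) ∧
      (∀ y : L, ∃ x : block ρ i, n x = (y : block ρ i)) := by
  have : Module.Finite ℤ (block ρ i) := inferInstance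
  obtain ⟨μ, hμ, hr⟩ := exists_range_one_add_smul (block ρ i) L d (blockDen i) hd (blockDen_dvd i)
    hL (fun x hx => Subtype.ext (htors x (by simpa using congrArg Subtype.val hx)))
  set ν : Module.End ℤ (block ρ i) := 1 + blockDen i • μ with hνdef
  -- `θ` is `d ν⁻¹`, which is integral because the image of `ν` contains all multiples of `d`.
  let θ : block ρ i →ₗ[ℤ] block ρ i :=
    (LinearEquiv.ofInjective ν hμ).symm.toLinearMap ∘ₗ
      (d • LinearMap.id : block ρ i →ₗ[ℤ] block ρ i).codRestrict (LinearMap.range ν)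
        (fun x => hr ▸ hL x)
  have hνθ (x : block ρ i) : ν (θ x) = d • x := by
    have := (LinearEquiv.ofInjective ν hμ).apply_symm_apply
      ((d • LinearMap.id : block ρ i →ₗ[ℤ] block ρ i).codRestrict (LinearMap.range ν)
        (fun x => hr ▸ hL x) x)
    exact congrArg Subtype.val this
  have hθν (x : block ρ i) : θ (ν x) = d • x := hμ (by rw [hνθ, map_smul])
  have hc (l : block ρ i →ₗ[ℤ] block ρ i) (g : Mat) (w : W) :
      ρ g (sharp ρ ρ i l w) = sharp ρ ρ i l (ρ g w) := LinearMap.congr_fun (sharp_comm h h i l g) w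
  have hcomp (l l' : block ρ i →ₗ[ℤ] block ρ i) (w : W) :
      sharp ρ ρ i l (sharp ρ ρ i l' w) = blockDen i • sharp ρ ρ i (l ∘ₗ l') w :=
    LinearMap.congr_fun (sharp_comp h h i l' l) w
  have hn (x : block ρ i) : (LinearMap.id + sharp ρ ρ i μ : W →ₗ[ℤ] W) x = ν x := by
    simp only [LinearMap.add_apply, LinearMap.id_apply, h.sharp_apply_block h, hνdef,
      Module.End.one_apply, LinearMap.smul_apply, Submodule.coe_add, Submodule.coe_smul]
  have hid (l : block ρ i →ₗ[ℤ] block ρ i) (hl : l = 0) (w : W) : sharp ρ ρ i l w = 0 := by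
    have := sharp_zsmul (ρ := ρ) (ρ' := ρ) i 0 l
    rw [hl]
    rw [zero_smul, zero_smul] at this
    rw [this]; rfl
  refine ⟨LinearMap.id + sharp ρ ρ i μ, d • LinearMap.id - sharp ρ ρ i (μ ∘ₗ θ), ?_, ?_, ?_, ?_,
    ?_, ?_⟩
  · intro g
    ext w
    simp [hc]
  · intro w
    -- By `sharp_comp`, the product of `1 + μ♯` and `d - (μθ)♯` differs from `d` by the extension of
    -- a map of blocks. That map is zero, as one sees by applying `μ` to `θν = d` with `ν = 1 +
    -- blockDen i • μ`.
    have h1 := hid (d • μ + (-1 : ℤ) • (μ ∘ₗ θ) + (- blockDen i) • ((μ ∘ₗ θ) ∘ₗ μ)) (by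
      ext1 x
      have := hθν x
      simp only [hνdef, LinearMap.add_apply, Module.End.one_apply, LinearMap.smul_apply, map_add,
        map_smul] at this
      simp only [LinearMap.add_apply, LinearMap.smul_apply, LinearMap.comp_apply,
        LinearMap.zero_apply]
      have t := congrArg μ this
      rw [map_add, map_smul, map_smul] at t
      rw [← t]
      module) w
    rw [sharp_add, sharp_add, sharp_zsmul, sharp_zsmul, sharp_zsmul] at h1
    simp only [LinearMap.add_apply, LinearMap.smul_apply] at h1
    simp only [LinearMap.add_apply, LinearMap.sub_apply, LinearMap.smul_apply, LinearMap.id_apply,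
      map_add, hcomp]
    rw [← sub_eq_zero, ← h1]
    module
  · intro w
    have h1 := hid (d • μ + (-1 : ℤ) • (μ ∘ₗ θ) + (- blockDen i) • (μ ∘ₗ (μ ∘ₗ θ))) (by
      ext1 x
      have := hνθ x
      simp only [hνdef, LinearMap.add_apply, Module.End.one_apply, LinearMap.smul_apply] at this
      simp only [LinearMap.add_apply, LinearMap.smul_apply, LinearMap.comp_apply,
        LinearMap.zero_apply]
      have t := congrArg μ this
      rw [map_add, map_smul, map_smul] at t
      rw [← t]
      module) w
    rw [sharp_add, sharp_add, sharp_zsmul, sharp_zsmul, sharp_zsmul] at h1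
    simp only [LinearMap.add_apply, LinearMap.smul_apply] at h1
    simp only [LinearMap.add_apply, LinearMap.sub_apply, LinearMap.smul_apply, LinearMap.id_apply,
      map_sub, map_smul, hcomp]
    rw [← sub_eq_zero, ← h1]
    module
  · intro j hj x
    simp [h.sharp_apply_block_of_ne i j hj.symm]
  · intro x
    exact ⟨⟨ν x, hr ▸ ⟨x, rfl⟩⟩, hn x⟩
  · rintro ⟨y, hy⟩
    obtain ⟨x, rfl⟩ : y ∈ LinearMap.range ν := hr ▸ hy
    exact ⟨x, hn x⟩

/-- A subrepresentation of index prime to `6` and to the torsion is the image of an injective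
endomorphism. -/
lemma exists_end_range_eq [Module.Finite ℤ W] (h : IsCubicRep ρ) (d : ℤ) (hd : IsCoprime d 6)
    (htors : ∀ x : W, d • x = 0 → x = 0) (U : Submodule ℤ W) (hU : ∀ g, ∀ u ∈ U, ρ g u ∈ U)
    (hdU : ∀ x : W, d • x ∈ U) :
    ∃ n : W →ₗ[ℤ] W, (∀ g, ρ g ∘ₗ n = n ∘ₗ ρ g) ∧ Function.Injective n ∧ LinearMap.range n = U := by
  have hop (i : Fin 3) (u : W) (hu : u ∈ U) : blockOp ρ i u ∈ U := by
    have ho (u : W) (hu : u ∈ U) : omega ρ u ∈ U := by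
      simp only [omega, LinearMap.sub_apply, Module.End.one_apply]
      exact U.sub_mem (U.sub_mem (U.sub_mem hu (hU _ _ hu)) (hU _ _ hu)) (hU _ _ hu)
    obtain rfl | rfl | rfl := fin_three_cases i
    · change kap ρ u ∈ U
      simp only [kap, LinearMap.sub_apply, Module.End.mul_apply, LinearMap.smul_apply]
      exact U.sub_mem (U.sub_mem (U.smul_mem _ (hU _ _ hu)) (hU _ _ (ho _ (hU _ _ hu))))
        (hU _ _ (ho _ (hU _ _ hu)))
    · change qOp ρ u ∈ U
      simp only [qOp, Module.End.mul_apply, LinearMap.add_apply, Module.End.one_apply]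
      exact U.add_mem (ho _ hu) (hU _ _ (ho _ hu))
    · change cOp ρ u ∈ U
      simp only [cOp, Module.End.mul_apply, LinearMap.add_apply, Module.End.one_apply]
      exact U.add_mem (U.add_mem (ho _ hu) (hU _ _ (ho _ hu))) (hU _ _ (ho _ hu))
  let L (i : Fin 3) : Submodule ℤ (block ρ i) :=
    (U.map (blockOp ρ i)).comap (block ρ i).subtype
  have hL (i : Fin 3) (x : block ρ i) : d • x ∈ L i := by
    obtain ⟨_, y, rfl⟩ := x
    exact ⟨d • y, hdU y, by rw [map_smul]; rfl⟩
  choose n n' hcomm hn'n hnn' hne hi hi' using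
    fun i => exists_end_of_block h d hd htors i (L i) (hL i)
  -- Each factor is the identity on the blocks of the other two, so on block `i` the composite is `n
  -- i`, with image `L i`, the block of `U`.
  let N : W →ₗ[ℤ] W := n 0 ∘ₗ n 1 ∘ₗ n 2
  let N' : W →ₗ[ℤ] W := n' 2 ∘ₗ n' 1 ∘ₗ n' 0
  have hN'N (x : W) : N' (N x) = (d ^ 3) • x := by
    simp only [N, N', LinearMap.comp_apply, hn'n, map_smul, ← mul_smul]
    congr 1; ring
  have hNN' (x : W) : N (N' x) = (d ^ 3) • x := by
    simp only [N, N', LinearMap.comp_apply, hnn', map_smul, ← mul_smul]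
    congr 1; ring
  have hcomm' (i g w) : ρ g (n i w) = n i (ρ g w) := LinearMap.congr_fun (hcomm i g) w
  have hNcomm (g) : ρ g ∘ₗ N = N ∘ₗ ρ g := by
    ext w
    simp [N, hcomm']
  have hNi (i) (x : block ρ i) : N x = n i x := by
    obtain ⟨y, hy⟩ := hi i x
    have hstay (j) (hj : j ≠ i) : n j (n i x) = n i x := by
      rw [hy]
      exact hne j i hj.symm _
    obtain rfl | rfl | rfl := fin_three_cases i
    · simp only [N, LinearMap.comp_apply]
      rw [hne 2 0 (by decide), hne 1 0 (by decide)]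
    · simp only [N, LinearMap.comp_apply]
      rw [hne 2 1 (by decide), hstay 0 (by decide)]
    · simp only [N, LinearMap.comp_apply]
      rw [hstay 1 (by decide), hstay 0 (by decide)]
  have hd3 : IsCoprime (d ^ 3) 6 := hd.pow_left
  refine ⟨N, hNcomm, ?_, le_antisymm ?_ fun u hu => ?_⟩
  · rw [injective_iff_map_eq_zero]
    intro x hx
    have h1 := hN'N x
    rw [hx, map_zero, pow_succ, pow_two, mul_smul, mul_smul] at h1
    exact htors _ (htors _ (htors _ h1.symm))
  · rintro _ ⟨w, rfl⟩
    -- The blocks give `6 N(w) ∈ U`, while `d N(w) ∈ U` by assumption; 6 and `d` are coprime. The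
    -- reverse inclusion uses 6 and `d³` in the same way.
    refine mem_of_isCoprime_smul_mem U hd (hdU _) (six_smul_mem U h hU _ fun i g => ?_)
    have h1 : blockOp ρ i (ρ g (N w)) = N (blockOp ρ i (ρ g w)) := by
      rw [← comm_blockOp hNcomm]
      congr 1
      exact LinearMap.congr_fun (hNcomm g) w
    rw [h1]
    obtain ⟨y, hy⟩ := hi i ⟨blockOp ρ i (ρ g w), _, rfl⟩
    have h2 := hNi i ⟨blockOp ρ i (ρ g w), _, rfl⟩
    rw [hy] at h2
    obtain ⟨v, hv, hv'⟩ := y.2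
    have h3 : N (blockOp ρ i (ρ g w)) = blockOp ρ i v := h2.trans hv'.symm
    rw [h3]
    exact hop i v hv
  · refine mem_of_isCoprime_smul_mem (LinearMap.range N) hd3 ⟨N' u, hNN' u⟩
      (six_smul_mem _ h ?_ _ fun i g => ?_)
    · rintro g _ ⟨w, rfl⟩
      exact ⟨ρ g w, (LinearMap.congr_fun (hNcomm g) w).symm⟩
    · obtain ⟨x, hx⟩ := hi' i ⟨⟨blockOp ρ i (ρ g u), _, rfl⟩, ρ g u, hU _ _ hu, rfl⟩
      exact ⟨x, by rw [hNi, hx]⟩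

end Index

/-- Two cubic representations are isomorphic if one embeds in the other with index prime to `6`
and to the torsion. -/
theorem exists_equiv_of_index {W W' : Type*} [AddCommGroup W] [AddCommGroup W'] [iW : Module ℤ W]
    [iW' : Module ℤ W'] {ρ : Mat →* Module.End ℤ W} {ρ' : Mat →* Module.End ℤ W'}
    [Module.Finite ℤ W'] (h' : IsCubicRep ρ') (d : ℤ) (hd : IsCoprime d 6)
    (htors : ∀ x : W', d • x = 0 → x = 0) (f : W →ₗ[ℤ] W') (hf : ∀ g, ρ' g ∘ₗ f = f ∘ₗ ρ g)
    (hinj : Function.Injective f) (hdf : ∀ x : W', ∃ y, f y = d • x) :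
    ∃ e : W ≃ₗ[ℤ] W', ∀ g w, ρ' g (e w) = e (ρ g w) := by
  obtain rfl : iW = AddCommGroup.toIntModule W := Subsingleton.elim _ _
  obtain rfl : iW' = AddCommGroup.toIntModule W' := Subsingleton.elim _ _
  obtain ⟨n, hn, hninj, hr⟩ := exists_end_range_eq h' d hd htors (LinearMap.range f) (by
    rintro g _ ⟨w, rfl⟩
    exact ⟨ρ g w, (LinearMap.congr_fun (hf g) w).symm⟩) hdf
  -- `f` and `n` are injective with the same image, so `n⁻¹ f` is defined and bijective.
  let e : W ≃ₗ[ℤ] W' := (LinearEquiv.ofInjective f hinj).trans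
    ((LinearEquiv.ofEq _ _ hr.symm).trans (LinearEquiv.ofInjective n hninj).symm)
  have he (w : W) : n (e w) = f w := by
    have := (LinearEquiv.ofInjective n hninj).apply_symm_apply
      (LinearEquiv.ofEq _ _ hr.symm (LinearEquiv.ofInjective f hinj w))
    exact congrArg Subtype.val this
  refine ⟨e, fun g w => hninj ?_⟩
  rw [he, ← LinearMap.comp_apply n, ← hn, LinearMap.comp_apply, he]
  exact LinearMap.congr_fun (hf g) w

/-! ### Polynomial functors are determined by their value on `ℤ³` -/

/-- The free abelian group of rank `n`. -/
abbrev Zn (n : ℕ) : Fab := Fab.of (Fin n → ℤ)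

/-- The homomorphism given by a matrix. -/
def matHom (m : Mat) : Zn 3 ⟶ Zn 3 := ObjectProperty.homMk (ModuleCat.ofHom (Matrix.toLin' m))

lemma matHom_mul (m n : Mat) : matHom (m * n) = matHom n ≫ matHom m := by
  simp only [matHom, Matrix.toLin'_mul]
  rfl

lemma matHom_one : matHom 1 = 𝟙 _ := by
  simp only [matHom, Matrix.toLin'_one]
  rfl

lemma matHom_add (m n : Mat) : matHom (m + n) = matHom m + matHom n := by
  simp only [matHom, map_add]
  rfl

lemma exists_matHom (g : Zn 3 ⟶ Zn 3) : ∃ m, matHom m = g :=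
  ⟨LinearMap.toMatrix' g.hom.hom, by
    simp only [matHom, Matrix.toLin'_toMatrix']
    rfl⟩

section

variable {R : Type} [CommRing R]

/-- The representation of the monoid of integral matrices on `F(ℤ³)`. -/
def rep (F : Fab ⥤ ModuleCat.{u} R) : Mat →* Module.End R (F.obj (Zn 3)) where
  toFun m := (F.map (matHom m)).hom
  map_one' := by
    rw [matHom_one, F.map_id]
    rfl
  map_mul' m n := by
    rw [matHom_mul, F.map_comp]
    rfl

lemma sum_comp_idemSum {m : ℕ} {A B : Fab} (f : Fin m → (A ⟶ B)) :
    ∃ (d : A ⟶ Fab.sum fun _ : Fin m => B) (s : (Fab.sum fun _ : Fin m => B) ⟶ B),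
      ∀ T, d ≫ idemSum (fun _ => B) T ≫ s = ∑ k ∈ T, f k := by
  let _ : Module ℤ (∀ _ : Fin m, B.obj) := Pi.module _ _ _
  refine ⟨ObjectProperty.homMk (ModuleCat.ofHom (LinearMap.pi fun k => (f k).hom.hom)),
    ObjectProperty.homMk (ModuleCat.ofHom (∑ k, LinearMap.proj k)), fun T => ?_⟩
  have hsum : ∀ T : Finset (Fin m), (∑ k ∈ T, f k).hom.hom = ∑ k ∈ T, (f k).hom.hom := by
    intro T
    induction T using Finset.induction_on with
    | empty => rfl
    | insert a s ha ih => rw [Finset.sum_insert ha, Finset.sum_insert ha, ← ih]; rfl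
  apply ObjectProperty.hom_ext
  apply ModuleCat.hom_ext
  rw [hsum]
  change (∑ k, LinearMap.proj k) ∘ₗ (∑ k ∈ T, LinearMap.single ℤ (fun _ => (B.obj : Type)) k ∘ₗ
    LinearMap.proj k) ∘ₗ (LinearMap.pi fun k => (f k).hom.hom) = _
  ext x
  simp only [LinearMap.comp_apply, LinearMap.sum_apply, LinearMap.proj_apply, LinearMap.pi_apply,
    Finset.sum_apply]
  rw [Finset.sum_comm]
  refine Finset.sum_congr rfl fun k _ => ?_
  simp

/-- Every `m`-th deviation is the cross-effect operator on the sum of `m` copies of `B`, composed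
with the map of components `f k` before it and the codiagonal after it. -/
lemma DegreeLE.sum_map_eq_zero {F : Fab ⥤ ModuleCat.{u} R} {n : ℕ} (hF : DegreeLE F n) {m : ℕ}
    (hm : n < m) {A B : Fab} (f : Fin m → (A ⟶ B)) :
    ∑ T : Finset (Fin m), (-1 : ℤ) ^ (Finset.univ \ T).card • F.map (∑ k ∈ T, f k) = 0 := by
  obtain ⟨d, s, h⟩ := sum_comp_idemSum f
  have h0 : crossIdem F (fun _ : Fin m => B) Finset.univ = 0 := by
    have := hF m hm fun _ => B
    rw [crossEffect, LinearMap.range_eq_bot] at this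
    exact ModuleCat.hom_ext this
  have h1 : F.map d ≫ crossIdem F (fun _ : Fin m => B) Finset.univ ≫ F.map s = 0 := by
    rw [h0]; simp
  rw [← h1, crossIdem, Preadditive.sum_comp, Preadditive.comp_sum]
  simp only [Finset.powerset_univ, Preadditive.zsmul_comp, Preadditive.comp_zsmul, ← F.map_comp, h]

lemma sum_finset_fin_four {M : Type*} [AddCommMonoid M] (f : Finset (Fin 4) → M) :
    ∑ T, f T = f ∅ + (f {0} + (f {1} + (f {2} + (f {3} + (f {0, 1} + (f {0, 2} + (f {0, 3} +
      (f {1, 2} + (f {1, 3} + (f {2, 3} + (f {0, 1, 2} + (f {0, 1, 3} + (f {0, 2, 3} +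
        (f {1, 2, 3} + f {0, 1, 2, 3})))))))))))))) := by
  have h : (Finset.univ : Finset (Finset (Fin 4))) =
    {∅, {0}, {1}, {2}, {3}, {0, 1}, {0, 2}, {0, 3}, {1, 2}, {1, 3}, {2, 3}, {0, 1, 2},
      {0, 1, 3}, {0, 2, 3}, {1, 2, 3}, {0, 1, 2, 3}} := by decide
  rw [h]
  iterate 15 rw [Finset.sum_insert (by decide)]
  rw [Finset.sum_singleton]

/-- The conditions on a weakly alternative cubic module apart from finite generation. -/
structure IsAlternativeCubic (F : Fab ⥤ ModuleCat.{u} R) : Prop where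
  reduced : Reduced F
  cubic : DegreeLE F 3
  vanish : Subsingleton (F.obj (Fab.of ℤ))

lemma IsWeaklyAlternative.isAlternativeCubic {F : Fab ⥤ ModuleCat.{u} R}
    (hF : IsWeaklyAlternative F) : IsAlternativeCubic F :=
  ⟨hF.reduced, hF.cubic, hF.vanish⟩

lemma IsAlternativeCubic.isCubicRep {F : Fab ⥤ ModuleCat.{u} R} (hF : IsAlternativeCubic F) :
    IsCubicRep (rep F) where
  vanish u v := by
    let a : Zn 3 ⟶ Fab.of ℤ := ObjectProperty.homMk (ModuleCat.ofHom
      (Fintype.linearCombination ℤ v))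
    let b : Fab.of ℤ ⟶ Zn 3 := ObjectProperty.homMk (ModuleCat.ofHom
      (LinearMap.toSpanSingleton ℤ (Fin 3 → ℤ) u))
    have h : matHom (Matrix.vecMulVec u v) = a ≫ b := by
      apply ObjectProperty.hom_ext
      apply ModuleCat.hom_ext
      change Matrix.toLin' _ = LinearMap.toSpanSingleton ℤ (Fin 3 → ℤ) u ∘ₗ
        Fintype.linearCombination ℤ v
      ext i j
      simp [Matrix.vecMulVec_apply, Fintype.linearCombination_apply, Pi.single_apply, mul_comm]
    have := hF.vanish
    change (F.map (matHom (Matrix.vecMulVec u v))).hom = 0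
    rw [h, F.map_comp]
    ext x
    rw [ModuleCat.comp_apply, Subsingleton.elim ((F.map a).hom x) 0]
    simp
  cubic a b c d := by
    have h := hF.cubic.sum_map_eq_zero (m := 4) (by norm_num)
      ![matHom a, matHom b, matHom c, matHom d]
    rw [sum_finset_fin_four] at h
    have hc (T : Finset (Fin 4)) : (Finset.univ \ T).card = 4 - T.card := by
      rw [Finset.card_univ_sdiff, Fintype.card_fin]
    have h0 : F.map (∑ k ∈ ∅, ![matHom a, matHom b, matHom c, matHom d] k) = 0 := by
      rw [Finset.sum_empty]
      exact hF.reduced _ _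
    rw [h0] at h
    simp [hc, ← matHom_add] at h
    have h2 := congrArg ModuleCat.Hom.hom h
    simp only [ModuleCat.hom_add, ModuleCat.hom_neg, ModuleCat.hom_zero] at h2
    have hr (m : Mat) : (F.map (matHom m)).hom = rep F m := rfl
    simp only [hr] at h2
    rw [← h2]
    simp only [add_assoc]
    abel

/-- The identity of `A` decomposes through `ℤ³` after applying any functor of degree at most
`3`. -/
def Resolves (R : Type) [CommRing R] (A : Fab) : Prop :=
  ∃ (ι : Type) (_ : Fintype ι) (c : ι → ℤ) (p : ι → (A ⟶ Zn 3)) (i : ι → (Zn 3 ⟶ A)),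
    ∀ F : Fab ⥤ ModuleCat.{u} R, DegreeLE F 3 →
      𝟙 (F.obj A) = ∑ t, c t • (F.map (p t) ≫ F.map (i t))

lemma Resolves.of_retract {A B : Fab} (r : A ⟶ B) (s : B ⟶ A) (h : r ≫ s = 𝟙 A)
    (hB : Resolves.{u} R B) : Resolves.{u} R A := by
  obtain ⟨ι, _, c, p, i, hc⟩ := hB
  refine ⟨ι, inferInstance, c, fun t => r ≫ p t, fun t => i t ≫ s, fun F hF => ?_⟩
  rw [← F.map_id, ← h, F.map_comp, ← Category.id_comp (F.map s), hc F hF]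
  simp [Preadditive.sum_comp, Preadditive.comp_sum]

lemma resolves_three : Resolves.{u} R (Zn 3) :=
  ⟨Unit, inferInstance, 1, fun _ => 𝟙 _, fun _ => 𝟙 _, fun F _ => by simp⟩

/-- The vanishing deviation of the `n + 1` coordinate idempotents expresses the identity through
partial sums over proper subsets. Each of these omits a coordinate `j` and so factors through `ℤⁿ`.
-/
lemma resolves_succ (n : ℕ) (hn : 3 ≤ n) (h : Resolves.{u} R (Zn n)) :
    Resolves.{u} R (Zn (n + 1)) := by
  obtain ⟨ι, _, c, p, i, hc⟩ := h
  let e (k : Fin (n + 1)) : Zn (n + 1) ⟶ Zn (n + 1) := ObjectProperty.homMk (ModuleCat.ofHom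
    (LinearMap.single ℤ (fun _ => ℤ) k ∘ₗ LinearMap.proj k))
  let d (j : Fin (n + 1)) : Zn (n + 1) ⟶ Zn n := ObjectProperty.homMk (ModuleCat.ofHom
    (LinearMap.funLeft ℤ ℤ j.succAbove))
  let s (j : Fin (n + 1)) : Zn n ⟶ Zn (n + 1) := ObjectProperty.homMk (ModuleCat.ofHom
    (∑ k, LinearMap.single ℤ (fun _ => ℤ) (j.succAbove k) ∘ₗ LinearMap.proj k))
  have hsum (T : Finset (Fin (n + 1))) :
      (∑ k ∈ T, e k).hom.hom = ∑ k ∈ T, (e k).hom.hom := by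
    induction T using Finset.induction_on with
    | empty => rfl
    | insert a s ha ih => rw [Finset.sum_insert ha, Finset.sum_insert ha, ← ih]; rfl
  have hds (j) (T : Finset (Fin (n + 1))) (hj : j ∉ T) :
      d j ≫ s j ≫ (∑ k ∈ T, e k) = ∑ k ∈ T, e k := by
    apply ObjectProperty.hom_ext
    apply ModuleCat.hom_ext
    change (∑ k ∈ T, e k).hom.hom ∘ₗ (s j).hom.hom ∘ₗ (d j).hom.hom = _
    rw [hsum]
    refine LinearMap.ext fun x => funext fun l => ?_
    simp only [LinearMap.comp_apply, LinearMap.sum_apply, Finset.sum_apply]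
    refine Finset.sum_congr rfl fun k hk => ?_
    change (LinearMap.single ℤ (fun _ => ℤ) k ∘ₗ LinearMap.proj k)
      ((∑ k, LinearMap.single ℤ (fun _ => ℤ) (j.succAbove k) ∘ₗ LinearMap.proj k)
        (LinearMap.funLeft ℤ ℤ j.succAbove x)) l =
      (LinearMap.single ℤ (fun _ => ℤ) k ∘ₗ LinearMap.proj k) x l
    simp only [LinearMap.proj_apply, LinearMap.sum_apply, Finset.sum_apply, LinearMap.comp_apply,
      LinearMap.funLeft_apply, LinearMap.single_apply]
    obtain ⟨k', rfl⟩ := Fin.exists_succAbove_eq (x := k) (y := j) (fun h => hj (h ▸ hk))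
    rw [Finset.sum_eq_single k']
    · simp
    · intro b _ hb
      simp [hb.symm]
    · simp
  have hone : ∑ k, e k = 𝟙 (Zn (n + 1)) := by
    apply ObjectProperty.hom_ext
    apply ModuleCat.hom_ext
    rw [hsum]
    refine LinearMap.ext fun x => funext fun l => ?_
    simp only [LinearMap.sum_apply, Finset.sum_apply]
    change ∑ k, (Pi.single k (x k) : Fin (n + 1) → ℤ) l = x l
    simp [Pi.single_apply]
  have hex (T : {T : Finset (Fin (n + 1)) // T ≠ Finset.univ}) : ∃ j, j ∉ T.1 := by
    by_contra! h
    exact T.2 (Finset.eq_univ_iff_forall.2 h)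
  choose j hj using hex
  refine ⟨{T : Finset (Fin (n + 1)) // T ≠ Finset.univ} × ι, inferInstance,
    fun t => -((-1 : ℤ) ^ (Finset.univ \ t.1.1).card * c t.2), fun t => d (j t.1) ≫ p t.2,
    fun t => i t.2 ≫ s (j t.1) ≫ (∑ k ∈ t.1.1, e k), fun F hF => ?_⟩
  have h1 := hF.sum_map_eq_zero (m := n + 1) (by omega) e
  rw [← Finset.add_sum_erase _ _ (Finset.mem_univ (Finset.univ : Finset (Fin (n + 1)))), hone,
    F.map_id] at h1
  simp only [Finset.sdiff_self, Finset.card_empty, pow_zero, one_smul] at h1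
  rw [Fintype.sum_prod_type, eq_neg_of_add_eq_zero_left h1, ← Finset.sum_neg_distrib,
    Finset.sum_subtype (Finset.univ.erase Finset.univ) (p := fun T => T ≠ Finset.univ) (by simp) _]
  refine Finset.sum_congr rfl fun T _ => ?_
  have h2 : F.map (∑ k ∈ T.1, e k) =
      F.map (d (j T)) ≫ 𝟙 _ ≫ F.map (s (j T) ≫ ∑ k ∈ T.1, e k) := by
    rw [Category.id_comp, ← F.map_comp, hds _ _ (hj T)]
  rw [h2, hc F hF]
  dsimp only
  generalize ∑ k ∈ T.1, e k = E
  simp only [Preadditive.sum_comp, Preadditive.comp_sum, Preadditive.zsmul_comp,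
    Preadditive.comp_zsmul, Finset.smul_sum, ← Finset.sum_neg_distrib, F.map_comp, Category.assoc,
    smul_smul, neg_smul]

lemma resolves_Zn (n : ℕ) : Resolves.{u} R (Zn n) := by
  rcases le_total n 3 with hn | hn
  · let r : Zn n ⟶ Zn 3 := ObjectProperty.homMk (ModuleCat.ofHom
      (∑ k, LinearMap.single ℤ (fun _ => ℤ) (Fin.castLE hn k) ∘ₗ LinearMap.proj k))
    let s : Zn 3 ⟶ Zn n := ObjectProperty.homMk (ModuleCat.ofHom
      (LinearMap.funLeft ℤ ℤ (Fin.castLE hn)))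
    refine resolves_three.of_retract r s ?_
    apply ObjectProperty.hom_ext
    apply ModuleCat.hom_ext
    refine LinearMap.ext fun x => funext fun l => ?_
    change (∑ k, LinearMap.single ℤ (fun _ => ℤ) (Fin.castLE hn k) ∘ₗ LinearMap.proj k :
      (Fin n → ℤ) →ₗ[ℤ] (Fin 3 → ℤ)) x (Fin.castLE hn l) = x l
    simp only [LinearMap.sum_apply, Finset.sum_apply, LinearMap.comp_apply, LinearMap.proj_apply,
      LinearMap.single_apply]
    rw [Finset.sum_eq_single l]
    · simp
    · intro b _ hb
      rw [Pi.single_eq_of_ne]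
      exact fun h => hb (Fin.castLE_injective hn h).symm
    · simp
  · induction n, hn using Nat.le_induction with
    | base => exact resolves_three
    | succ n hn ih => exact resolves_succ n hn ih

lemma resolves (A : Fab) : Resolves.{u} R A := by
  let e := (Module.finBasis ℤ A.obj).equivFun
  refine Resolves.of_retract (B := Zn (Module.finrank ℤ A.obj))
    (ObjectProperty.homMk (ModuleCat.ofHom e.toLinearMap))
    (ObjectProperty.homMk (ModuleCat.ofHom e.symm.toLinearMap)) ?_ (resolves_Zn _)
  apply ObjectProperty.hom_ext
  apply ModuleCat.hom_ext
  exact LinearMap.ext fun x => e.symm_apply_apply x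

lemma hom_ext_of_comp {F : Fab ⥤ ModuleCat.{u} R} (hF : DegreeLE F 3) {A : Fab}
    {X : ModuleCat.{u} R} {x y : X ⟶ F.obj A}
    (h : ∀ q : A ⟶ Zn 3, x ≫ F.map q = y ≫ F.map q) : x = y := by
  obtain ⟨ι, _, c, p, i, hc⟩ := resolves.{u} (R := R) A
  rw [← Category.comp_id x, ← Category.comp_id y, hc F hF]
  simp only [Preadditive.comp_sum, Preadditive.comp_zsmul, ← Category.assoc, h]

lemma eq_zero_of_map {F : Fab ⥤ ModuleCat.{u} R} (hF : DegreeLE F 3) {A : Fab} (x : F.obj A)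
    (h : ∀ q : A ⟶ Zn 3, F.map q x = 0) : x = 0 := by
  obtain ⟨ι, _, c, p, i, hc⟩ := resolves.{u} (R := R) A
  have := congrArg (fun f => f.hom x) (hc F hF)
  simp only [ModuleCat.hom_sum, LinearMap.sum_apply] at this
  refine this.trans (Finset.sum_eq_zero fun t _ => ?_)
  change c t • (F.map (i t)).hom ((F.map (p t)).hom x) = 0
  rw [h, map_zero, smul_zero]

/-! ### Natural transformations from equivariant maps on `ℤ³`. -/

section Extend

variable {F G : Fab ⥤ ModuleCat.{u} R}

/-- Insert `Φ` in the middle of the resolution of the identity of `F(A)`; equivariance of `Φ` moves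
the remaining factor across. -/
lemma exists_app (hF : DegreeLE F 3) (Φ : F.obj (Zn 3) ⟶ G.obj (Zn 3))
    (hΦ : ∀ g : Zn 3 ⟶ Zn 3, F.map g ≫ Φ = Φ ≫ G.map g) (A : Fab) :
    ∃ x : F.obj A ⟶ G.obj A, ∀ q : A ⟶ Zn 3, x ≫ G.map q = F.map q ≫ Φ := by
  obtain ⟨ι, _, c, p, i, hc⟩ := resolves.{u} (R := R) A
  refine ⟨∑ t, c t • (F.map (p t) ≫ Φ ≫ G.map (i t)), fun q => ?_⟩
  conv_rhs => rw [← Category.id_comp (F.map q ≫ Φ), hc F hF]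
  simp only [Preadditive.sum_comp, Preadditive.zsmul_comp, Category.assoc, ← G.map_comp, ← hΦ]
  simp only [← Category.assoc, ← F.map_comp]

lemma exists_natTrans (hF : DegreeLE F 3) (hG : DegreeLE G 3) (Φ : F.obj (Zn 3) ⟶ G.obj (Zn 3))
    (hΦ : ∀ g : Zn 3 ⟶ Zn 3, F.map g ≫ Φ = Φ ≫ G.map g) :
    ∃ α : F ⟶ G, α.app (Zn 3) = Φ := by
  choose x hx using exists_app hF Φ hΦ
  refine ⟨{ app := x, naturality := fun A B f => hom_ext_of_comp hG fun q => ?_ }, ?_⟩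
  · rw [Category.assoc, hx, Category.assoc, ← G.map_comp, hx, F.map_comp, Category.assoc]
  · have := hx (Zn 3) (𝟙 _)
    simpa using this

lemma natTrans_ext (hG : DegreeLE G 3) {α β : F ⟶ G} (h : α.app (Zn 3) = β.app (Zn 3)) :
    α = β := by
  ext1
  funext A
  exact hom_ext_of_comp hG fun q => by rw [← α.naturality, ← β.naturality, h]

/-- Functors of degree at most `3` are isomorphic if their values on `ℤ³` are isomorphic
representations. -/
theorem nonempty_iso_of_rep (hF : DegreeLE F 3) (hG : DegreeLE G 3)
    (e : F.obj (Zn 3) ≃ₗ[R] G.obj (Zn 3)) (he : ∀ g w, rep G g (e w) = e (rep F g w)) :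
    Nonempty (F ≅ G) := by
  have h1 (g : Zn 3 ⟶ Zn 3) : F.map g ≫ e.toModuleIso.hom = e.toModuleIso.hom ≫ G.map g := by
    obtain ⟨m, rfl⟩ := exists_matHom g
    exact ModuleCat.hom_ext (LinearMap.ext fun w => (he m w).symm)
  have h2 (g : Zn 3 ⟶ Zn 3) : G.map g ≫ e.toModuleIso.inv = e.toModuleIso.inv ≫ F.map g := by
    rw [Iso.comp_inv_eq, Category.assoc, h1, Iso.inv_hom_id_assoc]
  obtain ⟨α, hα⟩ := exists_natTrans hF hG _ h1
  obtain ⟨β, hβ⟩ := exists_natTrans hG hF _ h2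
  exact ⟨⟨α, β, natTrans_ext hF (by rw [NatTrans.comp_app, hα, hβ, Iso.hom_inv_id]; rfl),
    natTrans_ext hG (by rw [NatTrans.comp_app, hα, hβ, Iso.inv_hom_id]; rfl)⟩⟩

end Extend

end

/-! ### Equivariant maps from local data -/

section Lift

variable {R : Type*} [CommRing R]

lemma exists_smul_mem_of_fg {W : Type*} [AddCommGroup W] [Module R W] (S : Submonoid R)
    (N U : Submodule R W) (hN : N.FG) (h : ∀ x ∈ N, ∃ s ∈ S, s • x ∈ U) :
    ∃ s ∈ S, ∀ x ∈ N, s • x ∈ U := by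
  induction N, hN using Submodule.fg_induction with
  | singleton x =>
    obtain ⟨s, hs, hx⟩ := h x (Submodule.mem_span_singleton_self x)
    refine ⟨s, hs, fun y hy => ?_⟩
    obtain ⟨r, rfl⟩ := Submodule.mem_span_singleton.1 hy
    rw [smul_comm]
    exact U.smul_mem _ hx
  | sup N₁ N₂ h₁ h₂ ih₁ ih₂ =>
    obtain ⟨s, hs, h1⟩ := ih₁ fun x hx => h x (Submodule.mem_sup_left hx)
    obtain ⟨t, ht, h2⟩ := ih₂ fun x hx => h x (Submodule.mem_sup_right hx)
    refine ⟨s * t, S.mul_mem hs ht, fun x hx => ?_⟩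
    obtain ⟨y, hy, z, hz, rfl⟩ := Submodule.mem_sup.1 hx
    rw [smul_add]
    refine U.add_mem ?_ ?_
    · rw [mul_comm, mul_smul]
      exact U.smul_mem _ (h1 y hy)
    · rw [mul_smul]
      exact U.smul_mem _ (h2 z hz)

/-- Equivariant lifting of the identity of a common localization. -/
lemma exists_equivariant_lift [IsNoetherianRing R] {W W' V : Type*} [AddCommGroup W]
    [AddCommGroup W'] [AddCommGroup V] [Module R W] [Module R W'] [Module R V]
    [Module.Finite R W] [Module.Finite R W'] (S : Submonoid R) (a : W →ₗ[R] V) (b : W' →ₗ[R] V)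
    [IsLocalizedModule S a] [IsLocalizedModule S b] {ρ : Mat →* Module.End R W}
    {ρ' : Mat →* Module.End R W'} (σ : Mat → V → V) (ha : ∀ g x, a (ρ g x) = σ g (a x))
    (hb : ∀ g x, b (ρ' g x) = σ g (b x)) (hσ : ∀ g, ∀ s : R, ∀ x, σ g (s • x) = s • σ g x) :
    ∃ f : W →ₗ[R] W', (∀ g, ρ' g ∘ₗ f = f ∘ₗ ρ g) ∧ (∃ s ∈ S, ∀ x, b (f x) = s • a x) ∧
      ∃ s ∈ S, ∀ x, ∃ y, f y = s • x := by
  have := Module.finitePresentation_of_finite R W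
  obtain ⟨h, s, hs⟩ := Module.FinitePresentation.exists_lift_of_isLocalizedModule S b a
  replace hs (x : W) : b (h x) = (s : R) • a x := LinearMap.congr_fun hs x
  -- A lift `h` of `s • a` is equivariant only modulo `ker b`. That kernel is finitely generated and
  -- killed by some `t ∈ S`, so `t • h` is equivariant.
  obtain ⟨t, ht, htk⟩ := exists_smul_mem_of_fg S (LinearMap.ker b) ⊥
    (IsNoetherian.noetherian _) fun x hx => by
      obtain ⟨c, hc⟩ := IsLocalizedModule.exists_of_eq (S := S) (f := b) (x₁ := x) (x₂ := 0)
        (by rw [map_zero, LinearMap.mem_ker.1 hx])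
      exact ⟨c, c.2, by rw [smul_zero] at hc; exact hc⟩
  have hbf (x : W) : b ((t • h) x) = (t * s : R) • a x := by
    rw [LinearMap.smul_apply, map_smul, hs, mul_smul]
  refine ⟨t • h, fun g => LinearMap.ext fun x => ?_, ⟨t * s, S.mul_mem ht s.2, hbf⟩, ?_⟩
  · have := htk (ρ' g (h x) - h (ρ g x)) (by
      rw [LinearMap.mem_ker, map_sub, hb, hs, hs, ha, hσ, sub_self])
    rw [Submodule.mem_bot, smul_sub, sub_eq_zero] at this
    simpa using this
  · obtain ⟨r, hr, h⟩ := exists_smul_mem_of_fg S ⊤ (LinearMap.range (t • h))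
      (Module.Finite.fg_top) fun x _ => by
      obtain ⟨⟨y, c⟩, hy⟩ := IsLocalizedModule.surj S a (b x)
      replace hy : (c : R) • b x = a y := hy
      obtain ⟨d, hd⟩ := IsLocalizedModule.exists_of_eq (S := S) (f := b)
        (x₁ := (t • h) y) (x₂ := (t * s * c : R) • x)
        (by rw [hbf, map_smul, ← hy, mul_smul _ (c : R)])
      replace hd : (d : R) • (t • h) y = (d : R) • (t * s * c : R) • x := hd
      refine ⟨d * (t * s * c), S.mul_mem d.2 (S.mul_mem (S.mul_mem ht s.2) c.2), d • y, ?_⟩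
      rw [mul_smul, ← hd]
      exact map_smul (t • h) (d : R) y
    exact ⟨r, hr, fun x => h x trivial⟩

end Lift

/-- A prime dividing both `r` and a generator of `I` would divide all of `I`. -/
lemma exists_isCoprime_mem (I : Ideal ℤ) (r : ℤ)
    (h : ∀ p : ℕ, p.Prime → (p : ℤ) ∣ r → ∃ d ∈ I, ¬ (p : ℤ) ∣ d) : ∃ d ∈ I, IsCoprime d r := by
  obtain ⟨g, rfl⟩ := (IsPrincipalIdealRing.principal I).principal
  refine ⟨g, Submodule.mem_span_singleton_self g, ?_⟩
  rw [Int.isCoprime_iff_gcd_eq_one]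
  by_contra hg
  obtain ⟨p, hp, hpg⟩ := Nat.exists_prime_and_dvd hg
  have hpg' : (p : ℤ) ∣ (Int.gcd g r : ℤ) := Int.natCast_dvd_natCast.2 hpg
  obtain ⟨d, hd, hpd⟩ := h p hp (hpg'.trans (Int.gcd_dvd_right _ _))
  exact hpd ((hpg'.trans (Int.gcd_dvd_left _ _)).trans (Ideal.mem_span_singleton.1 hd))

/-- A version of the fact that a surjective endomorphism of a noetherian module is injective. Take
`n` where the kernels of powers stabilize. If `e x = 0` and `tⁿ x = eⁿ y`, then `y` lies in the
kernel of `eⁿ⁺¹`, hence of `eⁿ`. -/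
lemma exists_smul_eq_zero_of_surjective_up_to {W : Type*} [AddCommGroup W] [iW : Module ℤ W]
    [Module.Finite ℤ W] (e : W →ₗ[ℤ] W) (t : ℤ) (ht : ∀ x, ∃ y, e y = t • x) :
    ∃ n : ℕ, ∀ x, e x = 0 → t ^ n • x = 0 := by
  obtain rfl : iW = AddCommGroup.toIntModule W := Subsingleton.elim _ _
  obtain ⟨n, hn⟩ := monotone_stabilizes_iff_noetherian.2 (inferInstance : IsNoetherian ℤ W)
    ⟨fun n => LinearMap.ker (e ^ n), monotone_nat_of_le_succ fun n x hx => by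
      rw [LinearMap.mem_ker] at hx ⊢
      rw [pow_succ', Module.End.mul_apply, hx, map_zero]⟩
  have hpow (n : ℕ) : ∀ x, ∃ y, (e ^ n) y = t ^ n • x := by
    induction n with
    | zero => exact fun x => ⟨x, by simp⟩
    | succ n ih =>
      intro x
      obtain ⟨y, hy⟩ := ih x
      obtain ⟨z, hz⟩ := ht y
      exact ⟨z, by rw [pow_succ, Module.End.mul_apply, hz, map_smul, hy, smul_smul, pow_succ']⟩
  refine ⟨n, fun x hx => ?_⟩
  obtain ⟨y, hy⟩ := hpow n x
  have h1 : y ∈ LinearMap.ker (e ^ (n + 1)) := by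
    rw [LinearMap.mem_ker, pow_succ', Module.End.mul_apply, hy, map_smul, hx, smul_zero]
  have h2 : y ∈ LinearMap.ker (e ^ n) := by
    have := hn (n + 1) n.le_succ
    simp only [OrderHom.coe_mk] at this
    rwa [this]
  rw [← hy]
  exact h2

lemma exists_torsion_exponent (X : Type*) [AddCommGroup X] [iX : Module ℤ X] [Module.Finite ℤ X] :
    ∃ r : ℤ, r ≠ 0 ∧ ∀ x : X, ∀ d : ℤ, d ≠ 0 → d • x = 0 → r • x = 0 := by
  obtain rfl : iX = AddCommGroup.toIntModule X := Subsingleton.elim _ _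
  obtain ⟨r, hr, h⟩ := exists_smul_mem_of_fg (nonZeroDivisors ℤ) (Submodule.torsion ℤ X) ⊥
    (IsNoetherian.noetherian _) fun x ⟨s, hs⟩ => ⟨s, s.2, hs⟩
  exact ⟨r, nonZeroDivisors.ne_zero hr, fun x d hd hx =>
    h x ⟨⟨d, mem_nonZeroDivisors_of_ne_zero hd⟩, hx⟩⟩

/-- Representations of `Mat` on finitely generated abelian groups that are isomorphic up to an
integer prime to `p`, for each prime `p`, are isomorphic. -/
theorem exists_equiv_of_local {W W' : Type*} [AddCommGroup W] [AddCommGroup W'] [iW : Module ℤ W]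
    [iW' : Module ℤ W'] {ρ : Mat →* Module.End ℤ W} {ρ' : Mat →* Module.End ℤ W'}
    [Module.Finite ℤ W] [Module.Finite ℤ W'] (h' : IsCubicRep ρ')
    (H : ∀ p : ℕ, p.Prime → ∃ f : W →ₗ[ℤ] W', (∀ g, ρ' g ∘ₗ f = f ∘ₗ ρ g) ∧
      ∃ s : ℤ, ¬ (p : ℤ) ∣ s ∧ ∀ x, ∃ y, f y = s • x)
    (H' : ∀ p : ℕ, p.Prime → ∃ f : W' →ₗ[ℤ] W, ∃ s : ℤ, ¬ (p : ℤ) ∣ s ∧ ∀ x, ∃ y, f y = s • x) :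
    ∃ e : W ≃ₗ[ℤ] W', ∀ g w, ρ' g (e w) = e (ρ g w) := by
  obtain rfl : iW = AddCommGroup.toIntModule W := Subsingleton.elim _ _
  obtain rfl : iW' = AddCommGroup.toIntModule W' := Subsingleton.elim _ _
  obtain ⟨rW, hrW, hrW'⟩ := exists_torsion_exponent W
  obtain ⟨rN, hrN, hrN'⟩ := exists_torsion_exponent W'
  -- The primes that need control are 2, 3 and those occurring in the torsion of either module.
  obtain ⟨r, hrdef⟩ : ∃ r : ℤ, r = 6 * rW * rN := ⟨_, rfl⟩
  have hr : r ≠ 0 := by rw [hrdef]; positivity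
  let P := r.natAbs.primeFactors
  have hP {p : ℕ} (hp : p.Prime) (hpr : (p : ℤ) ∣ r) : p ∈ P :=
    Nat.mem_primeFactors.2 ⟨hp, Int.natCast_dvd.1 hpr, Int.natAbs_ne_zero.2 hr⟩
  have hPp {p : ℕ} (hp : p ∈ P) : p.Prime := (Nat.mem_primeFactors.1 hp).1
  -- Chinese remainder weights: modulo `p`, the sum `f` below is a unit multiple of the local map `F
  -- p`, and it stays equivariant.
  let c (p : ℕ) : ℤ := ∏ q ∈ P.erase p, (q : ℤ)
  choose! F hFρ s hs hFs using H
  choose! G t ht hGt using H'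
  let f : W →ₗ[ℤ] W' := ∑ p ∈ P, c p • F p
  have hf (g) : ρ' g ∘ₗ f = f ∘ₗ ρ g := by
    refine LinearMap.ext fun x => ?_
    simp only [f, LinearMap.comp_apply, LinearMap.sum_apply, map_sum, LinearMap.smul_apply,
      map_smul]
    refine Finset.sum_congr rfl fun p hp => ?_
    rw [← LinearMap.comp_apply, hFρ p (hPp hp), LinearMap.comp_apply]
  have hdvd {p q : ℕ} (hp : p ∈ P) (hpq : q ≠ p) : (p : ℤ) ∣ c q :=
    Finset.dvd_prod_of_mem _ (Finset.mem_erase.2 ⟨hpq.symm, hp⟩)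
  have hndvd {p : ℕ} (hp : p ∈ P) : ¬ (p : ℤ) ∣ c p := by
    rw [(Nat.prime_iff_prime_int.1 (hPp hp)).dvd_finsetProd_iff]
    rintro ⟨q, hq, hpq⟩
    rw [Finset.mem_erase] at hq
    exact hq.1 ((Nat.prime_dvd_prime_iff_eq (hPp hp) (hPp hq.2)).1
      (Int.natCast_dvd_natCast.1 hpq)).symm
  have hmod {p : ℕ} (hp : p ∈ P) (x : W) : ∃ z, f x = c p • F p x + (p : ℤ) • z := by
    have : ∀ q ∈ P.erase p, ∃ z, c q • F q x = (p : ℤ) • z := fun q hq => by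
      obtain ⟨k, hk⟩ := hdvd hp (Finset.ne_of_mem_erase hq)
      exact ⟨k • F q x, by rw [hk, mul_smul]⟩
    choose! z hz using this
    refine ⟨∑ q ∈ P.erase p, z q, ?_⟩
    simp only [f, LinearMap.sum_apply, LinearMap.smul_apply]
    rw [← Finset.add_sum_erase _ _ hp, Finset.smul_sum, Finset.sum_congr rfl hz]
  -- `f` is surjective up to an integer prime to `p`, by Nakayama
  have hsurj {p : ℕ} (hp : p ∈ P) : ∃ d : ℤ, ¬ (p : ℤ) ∣ d ∧ ∀ x, ∃ y, f y = d • x := by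
    have hpp := Nat.prime_iff_prime_int.1 (hPp hp)
    have hcop : IsCoprime (c p * s p) (p : ℤ) :=
      (hpp.coprime_iff_not_dvd.2 fun h => (hpp.dvd_or_dvd h).elim (hndvd hp) (hs p (hPp hp))).symm
    obtain ⟨d, hd, hdQ⟩ := Submodule.exists_sub_one_mem_and_smul_eq_zero_of_fg_of_le_smul
      (Ideal.span {(p : ℤ)}) (⊤ : Submodule ℤ (W' ⧸ LinearMap.range f)) Module.Finite.fg_top (by
        rintro x -
        obtain ⟨x, rfl⟩ := Submodule.Quotient.mk_surjective _ x
        obtain ⟨y, hy⟩ := hFs p (hPp hp) x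
        obtain ⟨z, hz⟩ := hmod hp y
        obtain ⟨u, v, huv⟩ := hcop
        have : x = f (u • y) + (p : ℤ) • (v • x - u • z) := by
          rw [map_smul, hz, hy]
          conv_lhs => rw [← one_smul ℤ x, ← huv]
          module
        rw [this, Submodule.Quotient.mk_add, Submodule.Quotient.mk_smul,
          (Submodule.Quotient.mk_eq_zero _).2 (LinearMap.mem_range_self f _), zero_add]
        exact Submodule.smul_mem_smul (Ideal.mem_span_singleton_self _) trivial)
    refine ⟨d, fun h => ?_, fun x => ?_⟩
    · have h1 := (Ideal.mem_span_singleton.1 hd)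
      have : (p : ℤ) ∣ 1 := by simpa using dvd_sub h h1
      exact hpp.not_isUnit (isUnit_of_dvd_one this)
    · have := hdQ (Submodule.Quotient.mk x) trivial
      rw [← Submodule.Quotient.mk_smul, Submodule.Quotient.mk_eq_zero] at this
      exact this
  have hker {p : ℕ} (hp : p ∈ P) : ∃ d : ℤ, ¬ (p : ℤ) ∣ d ∧ ∀ x, f x = 0 → d • x = 0 := by
    have hpp := Nat.prime_iff_prime_int.1 (hPp hp)
    obtain ⟨d, hd, hdf⟩ := hsurj hp
    -- A map back is used only to obtain an endomorphism that is surjective at `p`, so `G p` need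
    -- not be equivariant.
    obtain ⟨n, hn⟩ := exists_smul_eq_zero_of_surjective_up_to (G p ∘ₗ f) (d * t p) fun x => by
      obtain ⟨y, hy⟩ := hGt p (hPp hp) x
      obtain ⟨z, hz⟩ := hdf y
      exact ⟨z, by rw [LinearMap.comp_apply, hz, map_smul, hy, mul_smul]⟩
    refine ⟨(d * t p) ^ n, fun h => ?_, fun x hx => hn x (by rw [LinearMap.comp_apply, hx,
      map_zero])⟩
    exact (hpp.dvd_or_dvd (hpp.dvd_of_dvd_pow h)).elim hd (ht p (hPp hp))
  have hne {d : ℤ} (hd : IsCoprime d r) : d ≠ 0 := by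
    rintro rfl
    rw [isCoprime_zero_left, hrdef, mul_assoc] at hd
    have := isUnit_of_mul_isUnit_left hd
    rw [Int.isUnit_iff] at this
    omega
  obtain ⟨d, hd, hdr⟩ := exists_isCoprime_mem ((LinearMap.range f).colon Set.univ) r
    fun p hp hpr => by
      obtain ⟨d, h1, h2⟩ := hsurj (hP hp hpr)
      exact ⟨d, Submodule.mem_colon.2 fun x _ => h2 x, h1⟩
  obtain ⟨d', hd', hdr'⟩ := exists_isCoprime_mem (LinearMap.ker f).annihilator r
    fun p hp hpr => by
      obtain ⟨d, h1, h2⟩ := hker (hP hp hpr)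
      exact ⟨d, Submodule.mem_annihilator.2 fun x hx => h2 x hx, h1⟩
  refine exists_equiv_of_index h' d (hdr.of_isCoprime_of_dvd_right ⟨rW * rN, by rw [hrdef]; ring⟩)
    (fun x hx => ?_) f hf ?_ fun x => Submodule.mem_colon.1 hd x trivial
  · obtain ⟨u, v, huv⟩ := hdr
    have h2 : r • x = 0 := by
      rw [hrdef, mul_smul, hrN' x d (hne ⟨u, v, huv⟩) hx, smul_zero]
    rw [← one_smul ℤ x, ← huv, add_smul, mul_smul, mul_smul, hx, h2, smul_zero, smul_zero,
      add_zero]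
  -- The kernel is killed by `d' ≠ 0`, hence is torsion and killed by `r`. Since `d'` and `r` are
  -- coprime, it is zero.
  · rw [← LinearMap.ker_eq_bot, eq_bot_iff]
    intro x hx
    have h1 := Submodule.mem_annihilator.1 hd' x hx
    have h2 : r • x = 0 := by
      rw [hrdef, mul_right_comm, mul_smul, hrW' x d' (hne hdr') h1, smul_zero]
    obtain ⟨u, v, huv⟩ := hdr'
    rw [Submodule.mem_bot, ← one_smul ℤ x, ← huv, add_smul, mul_smul, mul_smul, h1, h2, smul_zero,
      smul_zero, add_zero]

/-! ### Localization maps of functors -/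

/-- The ring `S` is the localization of `ℤ` at the natural numbers in `T`. -/
structure IsLocRing (T : Submonoid ℕ) (S : Type) [CommRing S] : Prop where
  isUnit : ∀ t ∈ T, IsUnit (t : S)
  surj : ∀ s : S, ∃ t ∈ T, ∃ n : ℤ, (t : S) * s = n
  ker : ∀ n : ℤ, (n : S) = 0 → ∃ t ∈ T, (t : ℤ) * n = 0

namespace IsLocRing

variable {T : Submonoid ℕ} {S : Type} [CommRing S]

lemma eq_zero_of_nsmul (hS : IsLocRing T S) {W : Type*} [AddCommGroup W] [Module S W] {t : ℕ}
    (ht : t ∈ T) {x : W} (h : t • x = 0) : x = 0 := by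
  rw [← Nat.cast_smul_eq_nsmul S] at h
  exact (hS.isUnit t ht).smul_eq_zero.1 h

lemma exists_nsmul_eq (hS : IsLocRing T S) {W : Type*} [AddCommGroup W] [Module S W] {t : ℕ}
    (ht : t ∈ T) (x : W) : ∃ y, t • y = x := by
  obtain ⟨u, hu⟩ := hS.isUnit t ht
  refine ⟨(u⁻¹ : Sˣ) • x, ?_⟩
  rw [← Nat.cast_smul_eq_nsmul S, ← hu]
  exact smul_inv_smul u x

/-- Every scalar is an integer divided by an invertible natural number. This allows localization to
be handled throughout on underlying abelian groups, whatever the ring. -/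
lemma map_smul (hS : IsLocRing T S) {W W' : Type*} [AddCommGroup W] [Module S W]
    [AddCommGroup W'] [Module S W'] (f : W →+ W') (s : S) (x : W) : f (s • x) = s • f x := by
  obtain ⟨t, ht, n, hn⟩ := hS.surj s
  rw [← sub_eq_zero]
  refine hS.eq_zero_of_nsmul ht ?_
  rw [smul_sub, ← map_nsmul, ← Nat.cast_smul_eq_nsmul S, ← Nat.cast_smul_eq_nsmul S, smul_smul,
    smul_smul, hn, Int.cast_smul_eq_zsmul, Int.cast_smul_eq_zsmul, map_zsmul, sub_self]

/-- Additive maps between modules over a localization of `ℤ` are linear. -/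
def toLinearMap (hS : IsLocRing T S) {W W' : Type*} [AddCommGroup W] [Module S W]
    [AddCommGroup W'] [Module S W'] (f : W →+ W') : W →ₗ[S] W' where
  toFun := f
  map_add' := f.map_add
  map_smul' := hS.map_smul f

lemma isLocalization (hS : IsLocRing T S) [Algebra ℤ S] :
    IsLocalization (T.map (Nat.castRingHom ℤ)) S where
  map_units := by
    rintro ⟨_, t, ht, rfl⟩
    simpa using hS.isUnit t ht
  surj s := by
    obtain ⟨t, ht, n, hn⟩ := hS.surj s
    exact ⟨(n, ⟨t, t, ht, rfl⟩), by simpa [mul_comm] using hn⟩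
  exists_of_eq {x y} h := by
    obtain ⟨t, ht, htn⟩ := hS.ker (x - y) (by simpa [sub_eq_zero] using h)
    refine ⟨⟨t, t, ht, rfl⟩, ?_⟩
    rw [mul_sub, sub_eq_zero] at htn
    exact htn

lemma int : IsLocRing ⊥ ℤ where
  isUnit t ht := by
    rw [Submonoid.mem_bot.1 ht]
    simp
  surj s := ⟨1, Submonoid.one_mem _, s, by simp⟩
  ker n h := ⟨1, Submonoid.one_mem _, by simpa using h⟩

lemma exists_hom {X N : ModuleCat.{u} ℤ} (a : X →+ N) : ∃ g : X ⟶ N, ∀ x, g.hom x = a x :=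
  ⟨ModuleCat.ofHom (int.toLinearMap a), fun _ => rfl⟩

/-- The localization map `x ↦ 1 ⊗ x`. -/
noncomputable def unitMap (f : ℤ →+* S) (X : ModuleCat.{u} ℤ) :
    X →+ (ModuleCat.extendScalars f).obj X :=
  ((ModuleCat.extendRestrictScalarsAdj f).unit.app X).hom.toAddMonoidHom

lemma exists_unitMap_eq (hS : IsLocRing T S) (f : ℤ →+* S) (X : ModuleCat.{u} ℤ)
    (y : (ModuleCat.extendScalars f).obj X) : ∃ t ∈ T, ∃ x, unitMap f X x = t • y := by
  let U : Submodule S ((ModuleCat.extendScalars f).obj X) :=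
    Submodule.span S (Set.range (unitMap f X))
  -- A map out of the extension of scalars is determined on the elements `1 ⊗ x`, so these span it.
  have hU : ModuleCat.ofHom U.mkQ = 0 := by
    refine ModuleCat.ExtendScalars.hom_ext fun m => ?_
    exact (Submodule.Quotient.mk_eq_zero U).2 (Submodule.subset_span ⟨m, rfl⟩)
  have hy : y ∈ U :=
    (Submodule.Quotient.mk_eq_zero U).1 (congrArg (fun g => ModuleCat.Hom.hom g y) hU)
  induction hy using Submodule.span_induction with
  | mem y hy =>
    obtain ⟨x, rfl⟩ := hy
    exact ⟨1, T.one_mem, x, (one_smul _ _).symm⟩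
  | zero => exact ⟨1, T.one_mem, 0, by rw [map_zero, smul_zero]⟩
  | add y z _ _ hy hz =>
    obtain ⟨t, ht, x, hx⟩ := hy
    obtain ⟨t', ht', x', hx'⟩ := hz
    refine ⟨t * t', T.mul_mem ht ht', t' • x + t • x', ?_⟩
    rw [map_add, map_nsmul, map_nsmul, hx, hx', smul_add, mul_smul, smul_comm, mul_smul]
  | smul s y _ hy =>
    obtain ⟨t, ht, x, hx⟩ := hy
    obtain ⟨t', ht', n, hn⟩ := hS.surj s
    refine ⟨t' * t, T.mul_mem ht' ht, n • x, ?_⟩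
    rw [← Nat.cast_smul_eq_nsmul S, Nat.cast_mul, smul_smul, mul_right_comm, hn, mul_smul,
      Nat.cast_smul_eq_nsmul, Int.cast_smul_eq_zsmul, ← hx]
    exact map_zsmul (unitMap f X) n x

/-- The map `x ↦ 1 ⊗ x` into the plain tensor product factors through the unit of the adjunction, so
it kills `x` too. The kernel of that map is known because base change to a localization is
localization. -/
lemma exists_nsmul_eq_zero_of_unitMap (hS : IsLocRing T S) (f : ℤ →+* S) (X : ModuleCat.{u} ℤ)
    (x : X) (hx : unitMap f X x = 0) : ∃ t ∈ T, t • x = 0 := by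
  have := hS.isLocalization
  have h : IsLocalizedModule (T.map (Nat.castRingHom ℤ)) (TensorProduct.mk ℤ S X 1) :=
    (isLocalizedModule_iff_isBaseChange _ S _).2 (TensorProduct.isBaseChange _ _ _)
  obtain ⟨g, hg'⟩ := exists_hom
    (N := (ModuleCat.restrictScalars f).obj (ModuleCat.of S (TensorProduct ℤ S X)))
    (TensorProduct.mk ℤ S X 1).toAddMonoidHom
  have hg := (ModuleCat.extendRestrictScalarsAdj f).homEquiv_unit (f :=
    ((ModuleCat.extendRestrictScalarsAdj f).homEquiv X _).symm g)
  rw [Equiv.apply_symm_apply] at hg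
  have hgx : TensorProduct.mk ℤ S X 1 x = 0 := by
    refine (hg' x).symm.trans ((congrArg (fun k => ModuleCat.Hom.hom k x) hg).trans ?_)
    exact (congrArg (ModuleCat.Hom.hom (((ModuleCat.extendRestrictScalarsAdj f).homEquiv X
      (ModuleCat.of S (TensorProduct ℤ S X))).symm g)) hx).trans (map_zero _)
  obtain ⟨⟨_, t, ht, rfl⟩, htx⟩ := h.exists_of_eq (x₁ := x) (x₂ := 0)
    (by rw [map_zero]; exact hgx)
  refine ⟨t, ht, ?_⟩
  rw [smul_zero] at htx
  rw [← Nat.cast_smul_eq_nsmul ℤ]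
  exact htx

end IsLocRing

variable {R S S' : Type} [CommRing R] [CommRing S] [CommRing S']

/-- A natural transformation of underlying functors to abelian groups that is valuewise the
localization at the natural numbers in `T`. -/
structure LocMap (T : Submonoid ℕ) (F : Fab ⥤ ModuleCat.{u} R) (G : Fab ⥤ ModuleCat.{u} S) where
  app (A : Fab) : F.obj A →+ G.obj A
  naturality {A B : Fab} (φ : A ⟶ B) (x : F.obj A) : app B (F.map φ x) = G.map φ (app A x)
  eq_zero {t : ℕ} (ht : t ∈ T) {A : Fab} {y : G.obj A} (h : t • y = 0) : y = 0
  exists_nsmul_eq {t : ℕ} (ht : t ∈ T) {A : Fab} (y : G.obj A) : ∃ z, t • z = y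
  surj {A : Fab} (y : G.obj A) : ∃ t ∈ T, ∃ x, app A x = t • y
  ker {A : Fab} (x : F.obj A) (h : app A x = 0) : ∃ t ∈ T, t • x = 0

namespace LocMap

variable {T T' : Submonoid ℕ} {F : Fab ⥤ ModuleCat.{u} R} {G G' : Fab ⥤ ModuleCat.{u} S}

/-- Composition of localization maps. -/
def comp (η : LocMap T F G) {H : Fab ⥤ ModuleCat.{u} S'} (θ : LocMap T' G H) (hT : T ≤ T') :
    LocMap T' F H where
  app A := (θ.app A).comp (η.app A)
  naturality φ x := by
    simp only [AddMonoidHom.comp_apply, η.naturality, θ.naturality]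
  eq_zero := θ.eq_zero
  exists_nsmul_eq := θ.exists_nsmul_eq
  surj y := by
    obtain ⟨t, ht, z, hz⟩ := θ.surj y
    obtain ⟨s, hs, x, hx⟩ := η.surj z
    exact ⟨s * t, T'.mul_mem (hT hs) ht, x, by
      rw [AddMonoidHom.comp_apply, hx, map_nsmul, hz, mul_smul]⟩
  ker x h := by
    obtain ⟨t, ht, h1⟩ := θ.ker _ h
    obtain ⟨s, hs, h2⟩ := η.ker (t • x) (by rw [map_nsmul, h1])
    exact ⟨s * t, T'.mul_mem (hT hs) ht, by rw [mul_smul, h2]⟩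

/-- Composition of a localization map with an isomorphism. -/
def compIso (η : LocMap T F G) (e : G ≅ G') : LocMap T F G' where
  app A := (e.hom.app A).hom.toAddMonoidHom.comp (η.app A)
  naturality φ x := by
    change (e.hom.app _).hom (η.app _ _) = _
    rw [η.naturality]
    exact NatTrans.naturality_apply e.hom φ _
  eq_zero {t} ht A y h := by
    have : t • (e.inv.app A).hom y = 0 := by rw [← map_nsmul, h, map_zero]
    have := congrArg (e.hom.app A).hom (η.eq_zero ht this)
    rw [map_zero] at this
    rw [← this]
    exact (e.inv_hom_id_app_apply A y).symm
  exists_nsmul_eq {t} ht A y := by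
    obtain ⟨z, hz⟩ := η.exists_nsmul_eq ht ((e.inv.app A).hom y)
    refine ⟨(e.hom.app A).hom z, ?_⟩
    rw [← map_nsmul, hz]
    exact e.inv_hom_id_app_apply A y
  surj {A} y := by
    obtain ⟨t, ht, x, hx⟩ := η.surj ((e.inv.app A).hom y)
    refine ⟨t, ht, x, ?_⟩
    change (e.hom.app A).hom (η.app A x) = _
    rw [hx, map_nsmul]
    exact congrArg _ (e.inv_hom_id_app_apply A y)
  ker {A} x h := by
    refine η.ker x ?_
    have := congrArg (e.inv.app A).hom h
    rw [map_zero] at this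
    rw [← this]
    exact (e.hom_inv_id_app_apply A _).symm

lemma isLocalizedModule (η : LocMap T F G) (A : Fab) :
    IsLocalizedModule T (η.app A).toNatLinearMap where
  map_units t := by
    rw [Module.End.isUnit_iff]
    constructor
    · rw [injective_iff_map_eq_zero]
      exact fun y hy => η.eq_zero t.2 hy
    · exact fun y => η.exists_nsmul_eq t.2 y
  surj y := by
    obtain ⟨t, ht, x, hx⟩ := η.surj y
    exact ⟨(x, ⟨t, ht⟩), hx.symm⟩
  exists_of_eq {x y} h := by
    obtain ⟨t, ht, h⟩ := η.ker (x - y) (by rw [map_sub, sub_eq_zero]; exact h)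
    exact ⟨⟨t, ht⟩, by rw [smul_sub, sub_eq_zero] at h; exact h⟩

lemma hom_ext (η : LocMap T F G) (θ : LocMap T F G') {A B : Fab} {f g : G.obj A →+ G'.obj B}
    (h : ∀ x, f (η.app A x) = g (η.app A x)) : f = g := by
  ext y
  obtain ⟨t, ht, x, hx⟩ := η.surj y
  rw [← sub_eq_zero]
  refine θ.eq_zero ht ?_
  rw [smul_sub, ← map_nsmul, ← map_nsmul, ← hx, h, sub_self]

/-- Localizations are unique. -/
theorem nonempty_iso (hS : IsLocRing T S) (η : LocMap T F G) (θ : LocMap T F G') :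
    Nonempty (G ≅ G') := by
  have h1 := η.isLocalizedModule
  have h2 := θ.isLocalizedModule
  let e (A : Fab) : G.obj A ≃+ G'.obj A :=
    (IsLocalizedModule.linearEquiv T (η.app A).toNatLinearMap (θ.app A).toNatLinearMap).toAddEquiv
  have he (A : Fab) (x : F.obj A) : e A (η.app A x) = θ.app A x :=
    IsLocalizedModule.linearEquiv_apply T (η.app A).toNatLinearMap (θ.app A).toNatLinearMap x
  let e' (A : Fab) : G.obj A ≃ₗ[S] G'.obj A :=
    { e A with map_smul' := hS.map_smul (e A).toAddMonoidHom }
  refine ⟨NatIso.ofComponents (fun A => (e' A).toModuleIso) fun {A B} φ => ?_⟩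
  have := η.hom_ext θ (f := (e B).toAddMonoidHom.comp (G.map φ).hom.toAddMonoidHom)
    (g := (G'.map φ).hom.toAddMonoidHom.comp (e A).toAddMonoidHom) fun x => by
      change e B (G.map φ (η.app A x)) = G'.map φ (e A (η.app A x))
      rw [← η.naturality, he, he, θ.naturality]
  exact ModuleCat.hom_ext (LinearMap.ext fun y => DFunLike.congr_fun this y)

/-- The localization map `x ↦ 1 ⊗ x`. -/
noncomputable def ofBaseChange [Algebra ℤ S] (hS : IsLocRing T S) (F : Fab ⥤ ModuleCat.{u} ℤ) :
    LocMap T F (baseChange S F) where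
  app A := IsLocRing.unitMap (algebraMap ℤ S) (F.obj A)
  naturality _ _ := rfl
  eq_zero ht _ _ h := hS.eq_zero_of_nsmul ht h
  exists_nsmul_eq ht _ y := hS.exists_nsmul_eq ht y
  surj y := hS.exists_unitMap_eq _ _ y
  ker x h := hS.exists_nsmul_eq_zero_of_unitMap _ _ x h

/-- The rationalization map. -/
def ofToInt (η : LocMap T (toInt F) G) : LocMap T F G where
  app := η.app
  naturality := η.naturality
  eq_zero := η.eq_zero
  exists_nsmul_eq := η.exists_nsmul_eq
  surj := η.surj
  ker := η.ker

end LocMap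

/-! ### Cubic functors that are locally isomorphic -/

/-- The natural numbers prime to `p`. -/
def primeTo (p : Nat.Primes) : Submonoid ℕ where
  carrier := {t | ¬ (p : ℕ) ∣ t}
  mul_mem' ha hb h := (p.2.dvd_mul.1 h).elim ha hb
  one_mem' := p.2.not_dvd_one

lemma mem_primeTo {p : Nat.Primes} {t : ℕ} : t ∈ primeTo p ↔ ¬ (p : ℕ) ∣ t := Iff.rfl

/-- The nonzero natural numbers. -/
def nonzeroNat : Submonoid ℕ where
  carrier := {t | t ≠ 0}
  mul_mem' ha hb := mul_ne_zero ha hb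
  one_mem' := one_ne_zero

lemma mem_nonzeroNat {t : ℕ} : t ∈ nonzeroNat ↔ t ≠ 0 := Iff.rfl

lemma primeTo_le (p : Nat.Primes) : primeTo p ≤ nonzeroNat := by
  rintro t ht rfl
  exact ht (dvd_zero _)

lemma isLocRing_rat : IsLocRing nonzeroNat ℚ where
  isUnit t ht := by
    rw [isUnit_iff_ne_zero]
    exact_mod_cast ht
  surj s := ⟨s.den, s.den_ne_zero, s.num, by rw [mul_comm]; exact Rat.mul_den_eq_num s⟩
  ker n h := ⟨1, one_ne_zero, by simpa using h⟩

lemma isLocRing_zLoc (p : Nat.Primes) : IsLocRing (primeTo p) (ZLoc p) := by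
  have key (n : ℤ) : n ∈ (Ideal.span {((p : ℕ) : ℤ)}).primeCompl ↔ n.natAbs ∈ primeTo p := by
    rw [Ideal.mem_primeCompl_iff, Ideal.mem_span_singleton, mem_primeTo, Int.natCast_dvd]
  refine ⟨fun t ht => ?_, fun s => ?_, fun n hn => ?_⟩
  · have := IsLocalization.map_units (ZLoc p)
      (⟨(t : ℤ), (key t).2 (by simpa using ht)⟩ : (Ideal.span {((p : ℕ) : ℤ)}).primeCompl)
    simpa using this
  · obtain ⟨⟨n, t⟩, h⟩ := IsLocalization.surj (Ideal.span {((p : ℕ) : ℤ)}).primeCompl s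
    refine ⟨(t : ℤ).natAbs, (key t).1 t.2, (t : ℤ).sign * n, ?_⟩
    have h1 : (((t : ℤ).natAbs : ℕ) : ZLoc p) = (((t : ℤ).sign * t : ℤ) : ZLoc p) := by
      rw [Int.sign_mul_self, Int.cast_natCast]
    simp only [eq_intCast] at h
    rw [h1, Int.cast_mul, Int.cast_mul, ← h]
    ring
  · obtain ⟨t, ht⟩ := (IsLocalization.eq_iff_exists (Ideal.span {((p : ℕ) : ℤ)}).primeCompl
      (ZLoc p) (x := n) (y := 0)).1 (by simpa using hn)
    refine ⟨(t : ℤ).natAbs, (key t).1 t.2, ?_⟩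
    have h0 : (t : ℤ) * n = 0 := by simpa using ht
    rcases mul_eq_zero.1 h0 with h | h
    · rw [h]; simp
    · rw [h, mul_zero]

lemma IsLocRing.nonempty_ringHom {T T' : Submonoid ℕ} {R K : Type} [CommRing R] [CommRing K]
    (hR : IsLocRing T R) (hK : IsLocRing T' K) (hT : T ≤ T') : Nonempty (R →+* K) := by
  have := hR.isLocalization
  refine ⟨IsLocalization.lift (M := T.map (Nat.castRingHom ℤ)) (g := Int.castRingHom K) ?_⟩
  rintro ⟨_, t, ht, rfl⟩
  simpa using hK.isUnit t (hT ht)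

section Lift

variable {R K : Type} [CommRing R] [CommRing K] {T T' : Submonoid ℕ}
  {M N : Fab ⥤ ModuleCat.{u} R} {V : Fab ⥤ ModuleCat.{u} K}

/-- Functors with a common localization are related by equivariant maps. -/
theorem LocMap.exists_rep_hom [IsNoetherianRing R] (hR : IsLocRing T R) (hK : IsLocRing T' K)
    (hT : T ≤ T') (hM : Module.Finite R (M.obj (Zn 3))) (hN : Module.Finite R (N.obj (Zn 3)))
    (η : LocMap T' M V) (θ : LocMap T' N V) :
    ∃ f : M.obj (Zn 3) →ₗ[R] N.obj (Zn 3), (∀ g, rep N g ∘ₗ f = f ∘ₗ rep M g) ∧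
      (∃ s ∈ T', ∀ x, θ.app _ (f x) = s • η.app _ x) ∧ ∃ s ∈ T', ∀ x, ∃ y, f y = s • x := by
  obtain ⟨φ⟩ := hR.nonempty_ringHom hK hT
  let _ : Module R (V.obj (Zn 3)) := Module.compHom _ φ
  have hloc {X : Fab ⥤ ModuleCat.{u} R} (η : LocMap T' X V) : IsLocalizedModule
      (T'.map (Nat.castRingHom R)) (hR.toLinearMap (η.app (Zn 3))) := by
    refine ⟨?_, fun y => ?_, fun {x y} h => ?_⟩
    · rintro ⟨_, t, ht, rfl⟩
      rw [Module.End.isUnit_iff]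
      constructor
      · rw [injective_iff_map_eq_zero]
        refine fun y hy => η.eq_zero ht ?_
        rw [← Nat.cast_smul_eq_nsmul R]
        exact hy
      · intro y
        obtain ⟨z, hz⟩ := η.exists_nsmul_eq ht y
        exact ⟨z, by rw [← hz, ← Nat.cast_smul_eq_nsmul R]; rfl⟩
    · obtain ⟨t, ht, x, hx⟩ := η.surj y
      refine ⟨(x, ⟨t, t, ht, rfl⟩), ?_⟩
      change (t : R) • y = η.app _ x
      rw [hx, Nat.cast_smul_eq_nsmul]
    · obtain ⟨t, ht, h⟩ := η.ker (x - y) (by rw [map_sub, sub_eq_zero]; exact h)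
      refine ⟨⟨t, t, ht, rfl⟩, ?_⟩
      change (t : R) • x = (t : R) • y
      rw [Nat.cast_smul_eq_nsmul, Nat.cast_smul_eq_nsmul, ← sub_eq_zero, ← smul_sub, h]
  have h1 := hloc η
  have h2 := hloc θ
  obtain ⟨f, hf, ⟨_, ⟨s, hs, rfl⟩, hfs⟩, _, ⟨t, ht, rfl⟩, hft⟩ :=
    exists_equivariant_lift (T'.map (Nat.castRingHom R)) (hR.toLinearMap (η.app (Zn 3)))
      (hR.toLinearMap (θ.app (Zn 3))) (ρ := rep M) (ρ' := rep N)
      (fun g => V.map (matHom g)) (fun g x => η.naturality _ x) (fun g x => θ.naturality _ x)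
      (fun g s x => hR.map_smul (V.map (matHom g)).hom.toAddMonoidHom s x)
  refine ⟨f, hf, ⟨s, hs, fun x => ?_⟩, t, ht, fun x => ?_⟩
  · refine (hfs x).trans ?_
    exact Nat.cast_smul_eq_nsmul R s _
  · obtain ⟨y, hy⟩ := hft x
    exact ⟨y, hy.trans (Nat.cast_smul_eq_nsmul R t x)⟩

end Lift

/-- Weakly alternative cubic modules are isomorphic if all their localizations are. -/
theorem nonempty_iso_of_localization {M N : Fab ⥤ ModuleCat.{u} ℤ} (hM : IsWeaklyAlternative M)
    (hN : IsWeaklyAlternative N)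
    (h : ∀ p : Nat.Primes, Nonempty (localization p M ≅ localization p N)) : Nonempty (M ≅ N) := by
  have hWM := hM.finite (Zn 3)
  have hWN := hN.finite (Zn 3)
  have hcast {X : Type u} [AddCommGroup X] [Module ℤ X] {p : Nat.Primes} {t : ℕ}
      (ht : t ∈ primeTo p) {Y : Type u} (f : Y → X) (hf : ∀ x, ∃ y, f y = t • x) :
      ∃ s : ℤ, ¬ ((p : ℕ) : ℤ) ∣ s ∧ ∀ x, ∃ y, f y = s • x :=
    ⟨t, fun h => ht (Int.natCast_dvd_natCast.1 h), fun x => by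
      obtain ⟨y, hy⟩ := hf x
      exact ⟨y, by rw [hy, natCast_zsmul]⟩⟩
  obtain ⟨e, he⟩ := exists_equiv_of_local (ρ := rep M) (ρ' := rep N) hN.isAlternativeCubic.isCubicRep
    (fun p hp => by
      obtain ⟨e⟩ := h ⟨p, hp⟩
      obtain ⟨f, hf, -, t, ht, hft⟩ := LocMap.exists_rep_hom .int (isLocRing_zLoc ⟨p, hp⟩) bot_le
        hWM hWN ((LocMap.ofBaseChange (isLocRing_zLoc ⟨p, hp⟩) M).compIso e)
        (LocMap.ofBaseChange (isLocRing_zLoc ⟨p, hp⟩) N)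
      exact ⟨f, hf, hcast ht f hft⟩)
    (fun p hp => by
      obtain ⟨e⟩ := h ⟨p, hp⟩
      obtain ⟨f, -, -, t, ht, hft⟩ := LocMap.exists_rep_hom .int (isLocRing_zLoc ⟨p, hp⟩) bot_le
        hWN hWM (LocMap.ofBaseChange (isLocRing_zLoc ⟨p, hp⟩) N)
        ((LocMap.ofBaseChange (isLocRing_zLoc ⟨p, hp⟩) M).compIso e)
      exact ⟨f, hcast ht f hft⟩)
  exact nonempty_iso_of_rep hM.cubic hN.cubic e he

/-- Base change preserves isomorphisms. -/
lemma nonempty_iso_baseChange {R : Type} [CommRing R] (S : Type) [CommRing S] [Algebra R S]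
    {M N : Fab ⥤ ModuleCat.{u} R} (h : Nonempty (M ≅ N)) :
    Nonempty (baseChange S M ≅ baseChange S N) :=
  h.map fun e => Functor.isoWhiskerRight e _

/-! ### Torsion free modules away from `6` -/

section Blocks

variable {R : Type*} [CommRing R] {W W' : Type*} [AddCommGroup W] [Module R W] [AddCommGroup W']
  [Module R W'] {ρ : Mat →* Module.End R W} {ρ' : Mat →* Module.End R W'}

/-- If `6` is invertible, then representations with isomorphic blocks are isomorphic. -/
lemma exists_equiv_of_blocks (h : IsCubicRep ρ) (h' : IsCubicRep ρ') (h6 : IsUnit (6 : R))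
    (l : ∀ i, block ρ i ≃ₗ[R] block ρ' i) :
    ∃ e : W ≃ₗ[R] W', ∀ g w, ρ' g (e w) = e (ρ g w) := by
  -- These weights equalize the denominators 4, 6, 6 to 12, so both composites of `φ` and `ψ` are
  -- multiplication by 144 on every block, and on six times any vector.
  let c : Fin 3 → ℤ := ![3, 2, 2]
  have hc (i) : c i * blockDen i = 12 := by
    obtain rfl | rfl | rfl := fin_three_cases i <;> rfl
  let φ : W →ₗ[R] W' := ∑ i, c i • sharp ρ ρ' i (l i).toLinearMap
  let ψ : W' →ₗ[R] W := ∑ i, c i • sharp ρ' ρ i (l i).symm.toLinearMap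
  have hφ (g) (w) : ρ' g (φ w) = φ (ρ g w) := by
    simp only [φ, LinearMap.sum_apply, LinearMap.smul_apply, map_sum, map_zsmul]
    exact Finset.sum_congr rfl fun i _ => congrArg _ (LinearMap.congr_fun (sharp_comm h h' i _ g) w)
  have hψ (g) (w) : ρ g (ψ w) = ψ (ρ' g w) := by
    simp only [ψ, LinearMap.sum_apply, LinearMap.smul_apply, map_sum, map_zsmul]
    exact Finset.sum_congr rfl fun i _ => congrArg _ (LinearMap.congr_fun (sharp_comm h' h i _ g) w)
  have hφb (i) (x : block ρ i) : φ x = (12 : ℤ) • (l i x : W') := by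
    simp only [φ, LinearMap.sum_apply, LinearMap.smul_apply]
    rw [Finset.sum_eq_single i]
    · rw [h.sharp_apply_block h', smul_smul, hc]
      rfl
    · intro j _ hj
      rw [h.sharp_apply_block_of_ne j i hj, smul_zero]
    · simp
  have hψb (i) (x : block ρ' i) : ψ x = (12 : ℤ) • ((l i).symm x : W) := by
    simp only [ψ, LinearMap.sum_apply, LinearMap.smul_apply]
    rw [Finset.sum_eq_single i]
    · rw [h'.sharp_apply_block h, smul_smul, hc]
      rfl
    · intro j _ hj
      rw [h'.sharp_apply_block_of_ne j i hj, smul_zero]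
    · simp
  obtain ⟨d, hd⟩ : ∃ d : ℤ, 12 * 12 = d := ⟨_, rfl⟩
  have hunit : IsUnit ((6 * d : ℤ) : R) := by
    have : ((6 * d : ℤ) : R) = 6 ^ 3 * 4 := by rw [← hd]; norm_num
    have h2 : IsUnit (2 : R) := isUnit_of_dvd_unit ⟨3, by norm_num⟩ h6
    rw [this, show (4 : R) = 2 * 2 by norm_num]
    exact (h6.pow 3).mul (h2.mul h2)
  have h1 (w : W) : (6 : ℤ) • ψ (φ w) = (6 * d : ℤ) • w := by
    have := six_smul_mem (LinearMap.eqLocus (ψ ∘ₗ φ).toAddMonoidHom.toIntLinearMap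
      (d • LinearMap.id)) h (fun g u hu => ?_) w fun i g => ?_
    · have : ψ (φ ((6 : ℤ) • w)) = d • ((6 : ℤ) • w) :=
        LinearMap.mem_eqLocus.1 this
      rw [map_zsmul, map_zsmul, smul_smul] at this
      rw [this, mul_comm]
    · change ψ (φ (ρ g u)) = d • ρ g u
      have hu' : ψ (φ u) = d • u := LinearMap.mem_eqLocus.1 hu
      rw [← hφ, ← hψ, hu', map_zsmul]
    · change ψ (φ (blockOp ρ i (ρ g w))) = d • blockOp ρ i (ρ g w)
      have := hφb i ⟨blockOp ρ i (ρ g w), _, rfl⟩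
      rw [this, map_zsmul, hψb, LinearEquiv.symm_apply_apply, smul_smul, hd]
  have h2 (w : W') : (6 : ℤ) • φ (ψ w) = (6 * d : ℤ) • w := by
    have := six_smul_mem (LinearMap.eqLocus (φ ∘ₗ ψ).toAddMonoidHom.toIntLinearMap
      (d • LinearMap.id)) h' (fun g u hu => ?_) w fun i g => ?_
    · have : φ (ψ ((6 : ℤ) • w)) = d • ((6 : ℤ) • w) :=
        LinearMap.mem_eqLocus.1 this
      rw [map_zsmul, map_zsmul, smul_smul] at this
      rw [this, mul_comm]
    · change φ (ψ (ρ' g u)) = d • ρ' g u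
      have hu' : φ (ψ u) = d • u := LinearMap.mem_eqLocus.1 hu
      rw [← hψ, ← hφ, hu', map_zsmul]
    · change φ (ψ (blockOp ρ' i (ρ' g w))) = d • blockOp ρ' i (ρ' g w)
      have := hψb i ⟨blockOp ρ' i (ρ' g w), _, rfl⟩
      rw [this, map_zsmul, hφb, LinearEquiv.apply_symm_apply, smul_smul, hd]
  have hbij : Function.Bijective φ := by
    constructor
    · rw [injective_iff_map_eq_zero]
      intro w hw
      have := h1 w
      rw [hw, map_zero, smul_zero, ← Int.cast_smul_eq_zsmul R] at this
      exact hunit.smul_eq_zero.1 this.symm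
    · intro w
      obtain ⟨v, hv⟩ := hunit
      refine ⟨(v⁻¹ : Rˣ) • (6 : ℤ) • ψ w, ?_⟩
      have : φ ((v⁻¹ : Rˣ) • (6 : ℤ) • ψ w) = (v⁻¹ : Rˣ) • φ ((6 : ℤ) • ψ w) :=
        map_smul φ ((v⁻¹ : Rˣ) : R) _
      rw [this, map_zsmul, h2, ← Int.cast_smul_eq_zsmul R, ← hv]
      exact inv_smul_smul v w
  exact ⟨LinearEquiv.ofBijective φ hbij, hφ⟩

/-- Over a principal ideal domain in which `6` is invertible, torsion free representations that
embed into each other are isomorphic. -/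
lemma exists_equiv_of_injective [IsDomain R] [IsPrincipalIdealRing R] (h : IsCubicRep ρ)
    (h' : IsCubicRep ρ') (h6 : IsUnit (6 : R)) [Module.Finite R W] [Module.Finite R W']
    [Module.IsTorsionFree R W] [Module.IsTorsionFree R W'] (f : W →ₗ[R] W')
    (hf : ∀ g, ρ' g ∘ₗ f = f ∘ₗ ρ g) (hfi : Function.Injective f) (f' : W' →ₗ[R] W)
    (hf' : ∀ g, ρ g ∘ₗ f' = f' ∘ₗ ρ' g) (hfi' : Function.Injective f') :
    ∃ e : W ≃ₗ[R] W', ∀ g w, ρ' g (e w) = e (ρ g w) := by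
  refine exists_equiv_of_blocks h h' h6 fun i => ?_
  have := Module.free_iff_isTorsionFree (R := R) (M := block ρ i).2 inferInstance
  have := Module.free_iff_isTorsionFree (R := R) (M := block ρ' i).2 inferInstance
  -- The blocks are free over the principal ideal domain, and the equivariant injections restrict to
  -- injections of blocks in both directions.
  refine LinearEquiv.ofFinrankEq _ _ (le_antisymm ?_ ?_)
  · refine LinearMap.finrank_le_finrank_of_injective (f := f.restrict fun x hx => ?_) ?_
    · obtain ⟨y, rfl⟩ := hx
      rw [← comm_blockOp hf]
      exact ⟨_, rfl⟩
    · exact fun x y hxy => Subtype.ext (hfi (congrArg Subtype.val hxy))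
  · refine LinearMap.finrank_le_finrank_of_injective (f := f'.restrict fun x hx => ?_) ?_
    · obtain ⟨y, rfl⟩ := hx
      rw [← comm_blockOp hf']
      exact ⟨_, rfl⟩
    · exact fun x y hxy => Subtype.ext (hfi' (congrArg Subtype.val hxy))

end Blocks

lemma isUnit_six {p : Nat.Primes} (h2 : (p : ℕ) ≠ 2) (h3 : (p : ℕ) ≠ 3) :
    IsUnit (6 : ZLoc p) := by
  have : IsUnit ((6 : ℕ) : ZLoc p) := (isLocRing_zLoc p).isUnit 6 fun h => by
    rw [show 6 = 2 * 3 by norm_num, p.2.dvd_mul, Nat.prime_dvd_prime_iff_eq p.2 Nat.prime_two,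
      Nat.prime_dvd_prime_iff_eq p.2 Nat.prime_three] at h
    exact h.elim h2 h3
  exact_mod_cast this

lemma nsmul_eq_zero_of_isTorsionFree {R : Type*} [CommRing R] [IsDomain R] [CharZero R]
    {W : Type*} [AddCommGroup W] [Module R W] [Module.IsTorsionFree R W] {t : ℕ} (ht : t ≠ 0)
    {x : W} (h : t • x = 0) : x = 0 := by
  rw [← Nat.cast_smul_eq_nsmul R] at h
  exact (smul_eq_zero.1 h).resolve_left (Nat.cast_ne_zero.2 ht)

lemma charZero_zLoc (p : Nat.Primes) : CharZero (ZLoc p) := by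
  refine charZero_of_inj_zero fun n hn => ?_
  obtain ⟨t, ht, h⟩ := (isLocRing_zLoc p).ker n (by exact_mod_cast hn)
  have := (mul_eq_zero.1 h).resolve_left (by exact_mod_cast primeTo_le p ht)
  exact_mod_cast this

/-- For `p ≥ 5`, torsion free weakly alternative cubic modules over `ℤ_(p)` with the same
rationalization are isomorphic. -/
theorem nonempty_iso_of_isTorsionFree {p : Nat.Primes} (h2 : (p : ℕ) ≠ 2) (h3 : (p : ℕ) ≠ 3)
    {L L' : Fab ⥤ ModuleCat.{u} (ZLoc p)} (hL : IsWeaklyAlternative L)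
    (hL' : IsWeaklyAlternative L') (ht : IsTorsionFree L) (ht' : IsTorsionFree L')
    {V : Fab ⥤ ModuleCat.{u} ℚ} (η : LocMap nonzeroNat L V) (θ : LocMap nonzeroNat L' V) :
    Nonempty (L ≅ L') := by
  have := charZero_zLoc p
  have inj {X Y : Fab ⥤ ModuleCat.{u} (ZLoc p)} (hX : IsTorsionFree X) (η : LocMap nonzeroNat X V)
      (θ : LocMap nonzeroNat Y V) (f : X.obj (Zn 3) →ₗ[ZLoc p] Y.obj (Zn 3)) {s : ℕ}
      (hs : s ∈ nonzeroNat) (hf : ∀ x, θ.app _ (f x) = s • η.app _ x) : Function.Injective f := by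
    have := hX (Zn 3)
    rw [injective_iff_map_eq_zero]
    intro x hx
    have h := hf x
    rw [hx, map_zero] at h
    obtain ⟨t, ht, htx⟩ := η.ker x (η.eq_zero hs h.symm)
    exact nsmul_eq_zero_of_isTorsionFree (R := ZLoc p) ht htx
  obtain ⟨f, hf, ⟨s, hs, hfs⟩, -⟩ := LocMap.exists_rep_hom (isLocRing_zLoc p) isLocRing_rat
    (primeTo_le p) (hL.finite _) (hL'.finite _) η θ
  obtain ⟨f', hf', ⟨s', hs', hfs'⟩, -⟩ := LocMap.exists_rep_hom (isLocRing_zLoc p) isLocRing_rat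
    (primeTo_le p) (hL'.finite _) (hL.finite _) θ η
  have := hL.finite (Zn 3)
  have := hL'.finite (Zn 3)
  have := ht (Zn 3)
  have := ht' (Zn 3)
  obtain ⟨e, he⟩ := exists_equiv_of_injective hL.isAlternativeCubic.isCubicRep
    hL'.isAlternativeCubic.isCubicRep (isUnit_six h2 h3) f hf (inj ht η θ f hs hfs) f' hf'
    (inj ht' θ η f' hs' hfs')
  exact nonempty_iso_of_rep hL.cubic hL'.cubic e he

/-! ### Invariant lattices -/

section Lattice

variable {R : Type*} [CommRing R] {W : Type*} [AddCommGroup W] [Module R W]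
  {ρ : Mat →* Module.End R W}

/-- Matrices on either side of `op` are integral combinations of finitely many, so the finitely many
vectors `ρ(b J) op ρ(a I) x k` span an invariant subgroup. -/
lemma exists_fg_of_eq_sum (op : Module.End R W) {ι κ : Type*} [Fintype ι] [Finite κ]
    (a b : ι → Mat) (ha : ∀ m, ∃ c : ι → ℤ, op * ρ m = ∑ I, c I • (op * ρ (a I)))
    (hb : ∀ m, ∃ c : ι → ℤ, ρ m * op = ∑ I, c I • (ρ (b I) * op)) (x : κ → W) :
    ∃ U : Submodule ℤ W, U.FG ∧ (∀ g, ∀ u ∈ U, ρ g u ∈ U) ∧ ∀ g k, op (ρ g (x k)) ∈ U := by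
  let y (t : ι × ι × κ) : W := ρ (b t.1) (op (ρ (a t.2.1) (x t.2.2)))
  have key (m g : Mat) (k : κ) : ρ m (op (ρ g (x k))) ∈ Submodule.span ℤ (Set.range y) := by
    obtain ⟨c, hc⟩ := ha g
    obtain ⟨d, hd⟩ := hb m
    have h1 : op (ρ g (x k)) = ∑ I, c I • op (ρ (a I) (x k)) := by
      have := LinearMap.congr_fun hc (x k)
      simpa only [LinearMap.sum_apply, LinearMap.smul_apply, Module.End.mul_apply] using this
    rw [h1, map_sum]
    refine Submodule.sum_mem _ fun I _ => ?_
    rw [map_zsmul]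
    refine Submodule.smul_mem _ _ ?_
    have h2 := LinearMap.congr_fun hd (ρ (a I) (x k))
    simp only [LinearMap.sum_apply, LinearMap.smul_apply, Module.End.mul_apply] at h2
    rw [h2]
    exact Submodule.sum_mem _ fun J _ => Submodule.smul_mem _ _
      (Submodule.subset_span ⟨(J, I, k), rfl⟩)
  refine ⟨Submodule.span ℤ (Set.range y), Submodule.fg_span (Set.finite_range y),
    fun g u hu => ?_, fun g k => by simpa using key 1 g k⟩
  induction hu using Submodule.span_induction with
  | mem u hu =>
    obtain ⟨t, rfl⟩ := hu
    simp only [y]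
    rw [← Module.End.mul_apply, ← map_mul]
    exact key _ _ _
  | zero => rw [map_zero]; exact Submodule.zero_mem _
  | add u v _ _ hu hv => rw [map_add]; exact Submodule.add_mem _ hu hv
  | smul n u _ hu => rw [map_zsmul]; exact Submodule.smul_mem _ n hu

lemma IsCubicRep.exists_fg (h : IsCubicRep ρ) {κ : Type*} [Finite κ] (x : κ → W) :
    ∃ U : Submodule ℤ W, U.FG ∧ (∀ g, ∀ u ∈ U, ρ g u ∈ U) ∧ ∀ k, (6 : ℤ) • x k ∈ U := by
  obtain ⟨U, hU, hUs, hUx⟩ := exists_fg_of_eq_sum (omega ρ) sel (fun I => (sel I).transpose)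
    (fun m => ⟨_, h.omega_mul_eq_sum m⟩) (fun m => ⟨_, h.mul_omega_eq_sum m⟩) x
  obtain ⟨U', hU', hUs', hUx'⟩ := exists_fg_of_eq_sum (kap ρ) selPair
    (fun I => (selPair I).transpose)
    (fun m => ⟨_, h.kap_mul_eq_sum m⟩) (fun m => ⟨_, h.mul_kap_eq_sum m⟩) x
  have hs : ∀ g, ∀ u ∈ U ⊔ U', ρ g u ∈ U ⊔ U' := by
    intro g u hu
    obtain ⟨v, hv, w, hw, rfl⟩ := Submodule.mem_sup.1 hu
    rw [map_add]
    exact Submodule.add_mem_sup (hUs g v hv) (hUs' g w hw)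
  refine ⟨U ⊔ U', hU.sup hU', hs, fun k => six_smul_mem _ h hs _ fun i g => ?_⟩
  have ho : omega ρ (ρ g (x k)) ∈ U ⊔ U' := Submodule.mem_sup_left (hUx g k)
  obtain rfl | rfl | rfl := fin_three_cases i
  · exact Submodule.mem_sup_right (hUx' g k)
  · change qOp ρ _ ∈ U ⊔ U'
    simp only [qOp, Module.End.mul_apply, LinearMap.add_apply, Module.End.one_apply]
    exact Submodule.add_mem _ ho (hs _ _ ho)
  · change cOp ρ _ ∈ U ⊔ U'
    simp only [cOp, Module.End.mul_apply, LinearMap.add_apply, Module.End.one_apply]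
    exact Submodule.add_mem _ (Submodule.add_mem _ ho (hs _ _ ho)) (hs _ _ ho)

end Lattice

/-! ### Transfer along natural maps -/

section Transfer

variable {R S K : Type} [CommRing R] [CommRing S] [CommRing K]

lemma crossIdem_natural {F : Fab ⥤ ModuleCat.{u} R} {G : Fab ⥤ ModuleCat.{u} S}
    (η : ∀ A, F.obj A →+ G.obj A)
    (hη : ∀ {A B : Fab} (φ : A ⟶ B) (x : F.obj A), η B (F.map φ x) = G.map φ (η A x)) {m : ℕ}
    (A : Fin m → Fab) (T : Finset (Fin m)) (x : F.obj (Fab.sum A)) :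
    η _ ((crossIdem F A T).hom x) = (crossIdem G A T).hom (η _ x) := by
  simp only [crossIdem, ModuleCat.hom_sum, LinearMap.sum_apply, map_sum]
  refine Finset.sum_congr rfl fun U _ => ?_
  change η _ ((-1 : ℤ) ^ _ • F.map _ x) = (-1 : ℤ) ^ _ • G.map _ (η _ x)
  rw [map_zsmul, hη]

lemma crossEffect_eq_bot_iff {F : Fab ⥤ ModuleCat.{u} R} {m : ℕ} (A : Fin m → Fab) :
    crossEffect F A = ⊥ ↔ ∀ x, (crossIdem F A Finset.univ).hom x = 0 := by
  rw [crossEffect, LinearMap.range_eq_bot, LinearMap.ext_iff]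
  rfl

lemma IsAlternativeCubic.of_injective {F : Fab ⥤ ModuleCat.{u} R} {ι : Type} {K : ι → Type}
    [∀ i, CommRing (K i)] {G : ∀ i, Fab ⥤ ModuleCat.{u} (K i)} (hG : ∀ i, IsAlternativeCubic (G i))
    (η : ∀ i A, F.obj A →+ (G i).obj A)
    (hη : ∀ i, ∀ {A B : Fab} (φ : A ⟶ B) (x : F.obj A),
      η i B (F.map φ x) = (G i).map φ (η i A x))
    (hinj : ∀ A (x : F.obj A), (∀ i, η i A x = 0) → x = 0) : IsAlternativeCubic F where
  reduced A B := by
    refine ModuleCat.hom_ext (LinearMap.ext fun x => hinj B _ fun i => ?_)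
    refine (hη i 0 x).trans ?_
    rw [(hG i).reduced]
    rfl
  cubic m hm A := by
    rw [crossEffect_eq_bot_iff]
    intro x
    refine hinj _ _ fun i => ?_
    rw [crossIdem_natural (η i) (hη i)]
    exact (crossEffect_eq_bot_iff A).1 ((hG i).cubic m hm A) _
  vanish := by
    refine subsingleton_of_forall_eq 0 fun x => hinj _ _ fun i => ?_
    have := (hG i).vanish
    exact Subsingleton.elim _ _

variable {T T' : Submonoid ℕ} {F : Fab ⥤ ModuleCat.{u} R} {G : Fab ⥤ ModuleCat.{u} S}
  {V : Fab ⥤ ModuleCat.{u} K}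

lemma LocMap.isAlternativeCubic (η : LocMap T F G) (hF : IsAlternativeCubic F) :
    IsAlternativeCubic G where
  reduced A B := by
    refine ModuleCat.hom_ext (LinearMap.ext fun y => ?_)
    obtain ⟨t, ht, x, hx⟩ := η.surj y
    refine η.eq_zero ht ?_
    rw [← map_nsmul, ← hx]
    refine (η.naturality 0 x).symm.trans ?_
    rw [hF.reduced]
    exact map_zero (η.app B)
  cubic m hm A := by
    rw [crossEffect_eq_bot_iff]
    intro y
    obtain ⟨t, ht, x, hx⟩ := η.surj y
    refine η.eq_zero ht ?_
    rw [← map_nsmul, ← hx, ← crossIdem_natural η.app η.naturality,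
      (crossEffect_eq_bot_iff A).1 (hF.cubic m hm A), map_zero]
  vanish := by
    refine subsingleton_of_forall_eq 0 fun y => ?_
    obtain ⟨t, ht, x, hx⟩ := η.surj y
    have := hF.vanish
    refine η.eq_zero ht ?_
    rw [← hx, Subsingleton.elim x 0, map_zero]

lemma LocMap.finite {F : Fab ⥤ ModuleCat.{u} ℤ} (η : LocMap T F G) (hS : IsLocRing T S) (A : Fab)
    (hF : Module.Finite ℤ (F.obj A)) : Module.Finite S (G.obj A) := by
  obtain ⟨s, hs⟩ := hF.fg_top
  have h (x : F.obj A) : η.app A x ∈ Submodule.span S (η.app A '' s) := by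
    have hx : x ∈ Submodule.span ℤ (s : Set (F.obj A)) := hs ▸ trivial
    induction hx using Submodule.span_induction with
    | mem x hx => exact Submodule.subset_span ⟨x, hx, rfl⟩
    | zero => rw [map_zero]; exact Submodule.zero_mem _
    | add x y _ _ hx hy => rw [map_add]; exact Submodule.add_mem _ hx hy
    | smul n x _ hx =>
      rw [IsLocRing.int.map_smul (η.app A)]
      exact zsmul_mem hx n
  refine ⟨⟨(s.finite_toSet.image (η.app A)).toFinset, ?_⟩⟩
  rw [Set.Finite.coe_toFinset, eq_top_iff]
  rintro y -
  obtain ⟨t, ht, x, hx⟩ := η.surj y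
  obtain ⟨v, hv⟩ := hS.isUnit t ht
  have : y = (v⁻¹ : Sˣ) • η.app A x := by
    rw [hx, ← Nat.cast_smul_eq_nsmul S, ← hv]
    exact (inv_smul_smul v y).symm
  rw [this]
  exact Submodule.smul_mem _ _ (h x)

/-- A localization map factors through a coarser one. -/
lemma LocMap.exists_factor (η : LocMap T F G) (κ : LocMap T' F V) (hT : T ≤ T') :
    ∃ θ : LocMap T' G V, ∀ A x, θ.app A (η.app A x) = κ.app A x := by
  have h1 := η.isLocalizedModule
  have h2 (A : Fab) : ∀ t : T, IsUnit (algebraMap ℕ (Module.End ℕ (V.obj A)) t) := fun t =>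
    (κ.isLocalizedModule A).map_units ⟨t, hT t.2⟩
  let f (A : Fab) : G.obj A →+ V.obj A := (IsLocalizedModule.lift T (η.app A).toNatLinearMap
    (κ.app A).toNatLinearMap (h2 A)).toAddMonoidHom
  have hf (A : Fab) (x : F.obj A) : f A (η.app A x) = κ.app A x :=
    LinearMap.congr_fun (IsLocalizedModule.lift_comp T (η.app A).toNatLinearMap
      (κ.app A).toNatLinearMap (h2 A)) x
  refine ⟨⟨f, fun {A B} φ y => ?_, κ.eq_zero, κ.exists_nsmul_eq, fun y => ?_, fun y hy => ?_⟩, hf⟩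
  · obtain ⟨t, ht, x, hx⟩ := η.surj y
    rw [← sub_eq_zero]
    refine κ.eq_zero (hT ht) ?_
    rw [smul_sub, ← map_nsmul, ← map_nsmul, ← map_nsmul, ← map_nsmul, ← hx, ← η.naturality, hf, hf,
      κ.naturality, sub_self]
  · obtain ⟨t, ht, x, hx⟩ := κ.surj y
    exact ⟨t, ht, η.app _ x, by rw [hf, hx]⟩
  · obtain ⟨t, ht, x, hx⟩ := η.surj y
    obtain ⟨t', ht', h⟩ := κ.ker x (by rw [← hf, hx, map_nsmul, hy, smul_zero])
    refine ⟨t' * t, T'.mul_mem ht' (hT ht), ?_⟩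
    rw [mul_smul, ← hx, ← map_nsmul, h, map_zero]

end Transfer

/-! ### Lattices in rational functors -/

/-- The functor given by a natural family of subgroups. -/
def ofAddSubgroups {X : Fab → Type u} [∀ A, AddCommGroup (X A)]
    (f : ∀ {A B : Fab}, (A ⟶ B) → X A →+ X B) (hid : ∀ A x, f (𝟙 A) x = x)
    (hcomp : ∀ {A B C : Fab} (φ : A ⟶ B) (ψ : B ⟶ C) x, f (φ ≫ ψ) x = f ψ (f φ x))
    (S : ∀ A, AddSubgroup (X A)) (hS : ∀ {A B : Fab} (φ : A ⟶ B), ∀ x ∈ S A, f φ x ∈ S B) :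
    Fab ⥤ ModuleCat.{u} ℤ where
  obj A := ModuleCat.of ℤ (S A)
  map φ := ModuleCat.ofHom (AddMonoidHom.toIntLinearMap
    (((f φ).comp (S _).subtype).codRestrict (S _) fun x => hS φ x x.2))
  map_id A := ModuleCat.hom_ext (LinearMap.ext fun x => Subtype.ext (hid A x))
  map_comp φ ψ := ModuleCat.hom_ext (LinearMap.ext fun x => Subtype.ext (hcomp φ ψ x))

lemma finite_of_le_fg {X : Type*} [AddCommGroup X] (S : AddSubgroup X) (U : Submodule ℤ X)
    (hU : U.FG) (h : ∀ x ∈ S, x ∈ U) : Module.Finite ℤ S := by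
  have := Module.Finite.iff_fg.2 hU
  refine Module.Finite.of_injective
    ((S.subtype.codRestrict U fun x => h x x.2).toIntLinearMap : S →ₗ[ℤ] U) fun x y hxy => ?_
  exact Subtype.ext (congrArg (fun z : U => (z : X)) hxy)

/-- A finitely generated lattice in the rationalization of a cubic module. -/
theorem exists_lattice {T : Submonoid ℕ} {R : Type} [CommRing R] (hR : IsLocRing T R)
    (hT : T ≤ nonzeroNat) {N : Fab ⥤ ModuleCat.{u} R} (hN : IsWeaklyAlternative N)
    {V : Fab ⥤ ModuleCat.{u} ℚ} (θ : LocMap nonzeroNat N V) :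
    ∃ (L : Fab ⥤ ModuleCat.{u} ℤ) (κ : LocMap nonzeroNat L V), IsWeaklyAlternative L ∧
      ∀ A, Function.Injective (κ.app A) := by
  have hV := θ.isAlternativeCubic hN.isAlternativeCubic
  obtain ⟨s, hs⟩ := (hN.finite (Zn 3)).fg_top
  -- An invariant lattice in `V(ℤ³)` containing six times the image of each generator, hence
  -- spanning rationally.
  obtain ⟨U, hU, hUs, hUx⟩ := hV.isCubicRep.exists_fg fun x : s => θ.app (Zn 3) x
  have hspan (w : N.obj (Zn 3)) : ∃ d ∈ nonzeroNat, d • θ.app _ w ∈ U := by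
    have hw : w ∈ Submodule.span R (s : Set (N.obj (Zn 3))) := hs ▸ trivial
    induction hw using Submodule.span_induction with
    | mem x hx => exact ⟨6, by rw [mem_nonzeroNat]; norm_num, by rw [← natCast_zsmul]; exact hUx ⟨x, hx⟩⟩
    | zero => exact ⟨1, one_ne_zero, by simp⟩
    | add x y _ _ hx hy =>
      obtain ⟨d, hd, hdx⟩ := hx
      obtain ⟨e, he, hey⟩ := hy
      refine ⟨d * e, nonzeroNat.mul_mem hd he, ?_⟩
      rw [map_add, smul_add]
      refine U.add_mem ?_ ?_
      · rw [mul_comm, mul_smul]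
        exact nsmul_mem hdx e
      · rw [mul_smul]
        exact nsmul_mem hey d
    | smul r x _ hx =>
      obtain ⟨d, hd, hdx⟩ := hx
      obtain ⟨t, ht, n, hn⟩ := hR.surj r
      refine ⟨d * t, nonzeroNat.mul_mem hd (hT ht), ?_⟩
      have : t • r • x = n • x := by
        rw [← Nat.cast_smul_eq_nsmul R, smul_smul, hn, Int.cast_smul_eq_zsmul]
      rw [mul_smul, ← map_nsmul, this, map_zsmul, smul_comm]
      exact zsmul_mem hdx n
  have hall (v : V.obj (Zn 3)) : ∃ d ∈ nonzeroNat, d • v ∈ U := by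
    obtain ⟨t, ht, w, hw⟩ := θ.surj v
    obtain ⟨d, hd, hdw⟩ := hspan w
    exact ⟨d * t, nonzeroNat.mul_mem hd ht, by rwa [mul_smul, ← hw]⟩
  have hUm (g : Zn 3 ⟶ Zn 3) (u) (hu : u ∈ U) : (V.map g).hom u ∈ U := by
    obtain ⟨m, rfl⟩ := exists_matHom g
    exact hUs m u hu
  have hmap {A B C : Fab} (φ : A ⟶ B) (ψ : B ⟶ C) (x) :
      (V.map (φ ≫ ψ)).hom x = (V.map ψ).hom ((V.map φ).hom x) := by
    rw [V.map_comp]; rfl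
  -- The largest subfunctor of `V` whose value on `ℤ³` lies in `U`. Finite generation and fullness
  -- on every `A` follow from the resolution of the identity through `ℤ³`.
  let S (A : Fab) : AddSubgroup (V.obj A) :=
    { carrier := {x | ∀ φ : A ⟶ Zn 3, (V.map φ).hom x ∈ U}
      zero_mem' := fun φ => by rw [map_zero]; exact U.zero_mem
      add_mem' := fun hx hy φ => by rw [map_add]; exact U.add_mem (hx φ) (hy φ)
      neg_mem' := fun hx φ => by rw [map_neg]; exact U.neg_mem (hx φ) }
  let L := ofAddSubgroups (X := fun A => V.obj A) (fun φ => (V.map φ).hom.toAddMonoidHom)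
    (fun A x => by
      change (V.map (𝟙 A)).hom x = x
      rw [V.map_id]; rfl) hmap S (fun φ x hx ψ => by
      have := hx (φ ≫ ψ)
      rw [hmap] at this
      exact this)
  have hbig (A : Fab) (y : V.obj A) : ∃ d ∈ nonzeroNat, d • y ∈ S A := by
    obtain ⟨ι, _, c, p, i, hc⟩ := resolves.{u} (R := ℚ) A
    choose d hd hdU using fun t => hall ((V.map (p t)).hom y)
    refine ⟨∏ t, d t, prod_mem fun t _ => hd t, fun φ => ?_⟩
    have h1 := congrArg (fun f => (V.map φ).hom (f.hom y)) (hc V hV.cubic)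
    simp only [ModuleCat.hom_sum, LinearMap.sum_apply, map_sum] at h1
    have h2 : (V.map φ).hom y = ∑ t, c t • (V.map (i t ≫ φ)).hom ((V.map (p t)).hom y) := by
      refine h1.trans (Finset.sum_congr rfl fun t _ => ?_)
      rw [hmap]
      exact map_zsmul (V.map φ).hom.toAddMonoidHom (c t) _
    rw [map_nsmul, h2, Finset.smul_sum]
    refine U.sum_mem fun t _ => ?_
    rw [smul_comm]
    refine U.smul_mem _ ?_
    obtain ⟨k, hk⟩ := Finset.dvd_prod_of_mem d (Finset.mem_univ t)
    rw [hk, mul_comm, mul_smul, ← map_nsmul]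
    exact nsmul_mem (hUm _ _ (hdU t)) k
  have hfin (A : Fab) : Module.Finite ℤ (S A) := by
    obtain ⟨ι, _, c, p, i, hc⟩ := resolves.{u} (R := ℚ) A
    refine finite_of_le_fg (S A) (⨆ t, U.map (V.map (i t)).hom.toAddMonoidHom.toIntLinearMap)
      (Submodule.fg_iSup _ fun t => hU.map _) fun x hx => ?_
    have h1 := congrArg (fun f => f.hom x) (hc V hV.cubic)
    simp only [ModuleCat.hom_sum, LinearMap.sum_apply] at h1
    have h2 : x = ∑ t, c t • (V.map (i t)).hom ((V.map (p t)).hom x) := h1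
    rw [h2]
    refine Submodule.sum_mem _ fun t _ => Submodule.smul_mem _ _ ?_
    exact Submodule.mem_iSup_of_mem t ⟨_, hx (p t), rfl⟩
  have hLalt : IsAlternativeCubic L := .of_injective (ι := Unit) (G := fun _ => V) (fun _ => hV)
    (fun _ A => (S A).subtype) (fun _ _ _ _ _ => rfl) (fun A x hx => Subtype.ext (hx ()))
  refine ⟨L, ⟨fun A => (S A).subtype, fun _ _ => rfl, θ.eq_zero, θ.exists_nsmul_eq, fun {A} y => ?_,
    fun x hx => ⟨1, one_ne_zero, ?_⟩⟩, ⟨hfin, hLalt.reduced, hLalt.cubic, hLalt.vanish⟩,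
    fun A => Subtype.val_injective⟩
  · obtain ⟨d, hd, hy⟩ := hbig A y
    exact ⟨d, hd, ⟨d • y, hy⟩, rfl⟩
  · rw [one_smul]
    exact Subtype.ext hx

lemma isTorsionFree_of_nsmul {p : Nat.Primes} {F : Fab ⥤ ModuleCat.{u} (ZLoc p)}
    (h : ∀ A, ∀ x : F.obj A, ∀ t ∈ nonzeroNat, t • x = 0 → x = 0) : IsTorsionFree F := by
  refine fun A => ⟨fun r hr x y hxy => ?_⟩
  obtain ⟨t, ht, n, hn⟩ := (isLocRing_zLoc p).surj r
  have hr0 : r ≠ 0 := hr.ne_zero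
  have ht0 : (t : ZLoc p) ≠ 0 := ((isLocRing_zLoc p).isUnit t ht).ne_zero
  have hn0 : n ≠ 0 := by
    rintro rfl
    rw [Int.cast_zero] at hn
    exact (mul_ne_zero ht0 hr0) hn
  have h1 : r • (x - y) = 0 := by rw [smul_sub, sub_eq_zero]; exact hxy
  have h2 : n • (x - y) = 0 := by
    rw [← Int.cast_smul_eq_zsmul (ZLoc p), ← hn, mul_smul, h1, smul_zero]
  rw [← sub_eq_zero]
  exact h A _ n.natAbs (Int.natAbs_ne_zero.2 hn0) ((natAbs_nsmul_eq_zero).2 h2)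

/-- A lattice localizes to every torsion free module at `p ≥ 5` with the same rationalization. -/
theorem exists_locMap_of_isTorsionFree {p : Nat.Primes} (h2 : (p : ℕ) ≠ 2) (h3 : (p : ℕ) ≠ 3)
    {L : Fab ⥤ ModuleCat.{u} ℤ} {V : Fab ⥤ ModuleCat.{u} ℚ} (hL : IsWeaklyAlternative L)
    (κ : LocMap nonzeroNat L V) (hκ : ∀ A, Function.Injective (κ.app A))
    {N : Fab ⥤ ModuleCat.{u} (ZLoc p)} (hN : IsWeaklyAlternative N) (ht : IsTorsionFree N)
    (θ : LocMap nonzeroNat N V) :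
    ∃ (ι : LocMap (primeTo p) L N) (j : LocMap nonzeroNat N V),
      ∀ A x, j.app A (ι.app A x) = κ.app A x := by
  let η := LocMap.ofBaseChange (isLocRing_zLoc p) L
  obtain ⟨j, hj⟩ := η.exists_factor κ (primeTo_le p)
  have hjinj (A : Fab) (y) (hy : j.app A y = 0) : y = 0 := by
    obtain ⟨t, ht, x, hx⟩ := η.surj y
    have : x = 0 := hκ A (by rw [← hj, hx, map_nsmul, hy, smul_zero, map_zero])
    exact η.eq_zero ht (by rw [← hx, this, map_zero])
  have hA := η.isAlternativeCubic hL.isAlternativeCubic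
  obtain ⟨e⟩ := nonempty_iso_of_isTorsionFree h2 h3
    ⟨fun A => η.finite (isLocRing_zLoc p) A (hL.finite A), hA.reduced, hA.cubic, hA.vanish⟩ hN
    (isTorsionFree_of_nsmul fun A x t ht hx => hjinj A x (j.eq_zero ht (by
      rw [← map_nsmul, hx, map_zero]))) ht j θ
  -- The isomorphism `e` need not respect `θ`, so the map from `N` to its rationalization is chosen
  -- anew to be compatible with the lattice.
  obtain ⟨j', hj'⟩ := (η.compIso e).exists_factor κ (primeTo_le p)
  exact ⟨_, j', hj'⟩

/-! ### Gluing -/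

lemma exists_eq_pow_mul (p : Nat.Primes) {n : ℕ} (hn : n ≠ 0) :
    ∃ b s : ℕ, s ∈ primeTo p ∧ n = (p : ℕ) ^ b * s := by
  obtain ⟨b, s, hs, h⟩ := Nat.exists_eq_pow_mul_and_not_dvd hn p p.2.ne_one
  exact ⟨b, s, hs, h⟩

lemma isCoprime_pow_of_mem {p : Nat.Primes} {t : ℕ} (ht : t ∈ primeTo p) (c : ℕ) :
    IsCoprime (t : ℤ) ((p : ℕ) ^ c : ℕ) :=
  Nat.isCoprime_iff_coprime.2 (Nat.Coprime.pow_right c ((p.2.coprime_iff_not_dvd.2 ht).symm))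

lemma pow_mem_primeTo {p q : Nat.Primes} (h : p ≠ q) (c : ℕ) : (p : ℕ) ^ c ∈ primeTo q :=
  fun hd => h (Subtype.ext ((Nat.prime_dvd_prime_iff_eq q.2 p.2).1 (q.2.dvd_of_dvd_pow hd)).symm)

/-- The integers carrying `x` into `U` form an ideal contained in no maximal ideal. Coprimality to 0
below means being a unit. -/
lemma mem_of_primeTo {X : Type*} [AddCommGroup X] (U : AddSubgroup X) (x : X)
    (h : ∀ p : Nat.Primes, ∃ t ∈ primeTo p, t • x ∈ U) : x ∈ U := by
  obtain ⟨d, hd, hd1⟩ := exists_isCoprime_mem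
    ((AddSubgroup.toIntSubmodule U).comap (LinearMap.toSpanSingleton ℤ X x)) 0 fun p hp _ => by
    obtain ⟨t, ht, hx⟩ := h ⟨p, hp⟩
    refine ⟨t, ?_, fun h => ht (Int.natCast_dvd_natCast.1 h)⟩
    change (t : ℤ) • x ∈ U
    rwa [natCast_zsmul]
  have hdx : d • x ∈ U := hd
  rw [isCoprime_zero_right, Int.isUnit_iff] at hd1
  obtain rfl | rfl := hd1
  · simpa using hdx
  · simpa using hdx

lemma fg_range {X Y : Type*} [AddCommGroup X] [AddCommGroup Y] [iX : Module ℤ X]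
    [Module.Finite ℤ X] (f : X →+ Y) : (AddSubgroup.toIntSubmodule f.range).FG := by
  obtain rfl : iX = AddCommGroup.toIntModule X := Subsingleton.elim _ _
  have h : AddSubgroup.toIntSubmodule f.range = LinearMap.range f.toIntLinearMap := rfl
  rw [h, ← Submodule.map_top]
  exact Module.Finite.fg_top.map _

/-- On a module killed by a power of `p`, denominators prime to `p` act as integers. -/
lemma finite_int_of_pow {p : Nat.Primes} {W : Type*} [AddCommGroup W] [Module (ZLoc p) W]
    [hW : Module.Finite (ZLoc p) W] (c : ℕ) (h : ∀ x : W, (p : ℕ) ^ c • x = 0) :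
    Module.Finite ℤ W := by
  obtain ⟨s, hs⟩ := hW.fg_top
  refine ⟨⟨s, ?_⟩⟩
  rw [eq_top_iff]
  rintro x -
  have hx : x ∈ Submodule.span (ZLoc p) (s : Set W) := hs ▸ trivial
  induction hx using Submodule.span_induction with
  | mem x hx => exact Submodule.subset_span hx
  | zero => exact Submodule.zero_mem _
  | add x y _ _ hx hy => exact Submodule.add_mem _ hx hy
  | smul r x _ hx =>
    obtain ⟨t, ht, n, hn⟩ := (isLocRing_zLoc p).surj r
    obtain ⟨u, v, huv⟩ := isCoprime_pow_of_mem ht c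
    have h1 : (t : ℤ) • r • x = n • x := by
      rw [natCast_zsmul, ← Nat.cast_smul_eq_nsmul (ZLoc p), smul_smul, hn, Int.cast_smul_eq_zsmul]
    have h2 : r • x = (u * n) • x := by
      rw [← one_zsmul (r • x), ← huv, add_zsmul, mul_zsmul, mul_zsmul, h1, natCast_zsmul, h,
        zsmul_zero, add_zero, mul_zsmul]
    rw [h2]
    exact Submodule.smul_mem _ _ hx

section Values

variable {p : Nat.Primes} {N : Fab ⥤ ModuleCat.{u} (ZLoc p)} {V : Fab ⥤ ModuleCat.{u} ℚ}
  {L : Fab ⥤ ModuleCat.{u} ℤ}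

lemma LocMap.exists_pow_smul_mem (j : LocMap nonzeroNat N V) {A : Fab} (v : V.obj A) :
    ∃ b : ℕ, ∃ y, j.app A y = (p : ℕ) ^ b • v := by
  obtain ⟨n, hn, y, hy⟩ := j.surj v
  obtain ⟨b, s, hs, rfl⟩ := exists_eq_pow_mul p hn
  obtain ⟨z, rfl⟩ := (isLocRing_zLoc p).exists_nsmul_eq hs y
  refine ⟨b, z, ?_⟩
  rw [← sub_eq_zero]
  refine j.eq_zero (primeTo_le p hs) ?_
  rw [smul_sub, ← map_nsmul, hy, smul_smul, mul_comm, sub_self]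

lemma LocMap.exists_pow_smul_eq_zero (j : LocMap nonzeroNat N V) {A : Fab}
    (hN : Module.Finite (ZLoc p) (N.obj A)) :
    ∃ c : ℕ, ∀ y, j.app A y = 0 → (p : ℕ) ^ c • y = 0 := by
  obtain ⟨_, ⟨n, hn, rfl⟩, h⟩ := exists_smul_mem_of_fg (nonzeroNat.map (Nat.castRingHom (ZLoc p)))
    (Submodule.torsion' (ZLoc p) (N.obj A) (nonzeroNat.map (Nat.castRingHom (ZLoc p)))) ⊥
    (IsNoetherian.noetherian _) fun x ⟨s, hs⟩ => ⟨s, s.2, hs⟩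
  obtain ⟨c, s, hs, rfl⟩ := exists_eq_pow_mul p hn
  refine ⟨c, fun y hy => (isLocRing_zLoc p).eq_zero_of_nsmul hs ?_⟩
  obtain ⟨t, ht, hty⟩ := j.ker y hy
  have := h y ⟨⟨_, t, ht, rfl⟩, (Nat.cast_smul_eq_nsmul (ZLoc p) t y).trans hty⟩
  rw [smul_smul, mul_comm, ← Nat.cast_smul_eq_nsmul (ZLoc p)]
  exact this

lemma LocMap.exists_pow_smul_mem_range (j : LocMap nonzeroNat N V) (κ : LocMap nonzeroNat L V)
    {A : Fab} (hN : Module.Finite (ZLoc p) (N.obj A)) :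
    ∃ b : ℕ, ∀ y, ∃ t ∈ primeTo p, ∃ x, κ.app A x = t • (p : ℕ) ^ b • j.app A y := by
  obtain ⟨s, hs⟩ := hN.fg_top
  choose n hn x hx using fun y : s => κ.surj (j.app A y)
  obtain ⟨b, r, hr, hb⟩ := exists_eq_pow_mul p
    (prod_mem (S := nonzeroNat) (t := Finset.univ) fun y _ => hn y)
  refine ⟨b, fun y => ?_⟩
  have hy : y ∈ Submodule.span (ZLoc p) (s : Set (N.obj A)) := hs ▸ trivial
  induction hy using Submodule.span_induction with
  | mem y hy =>
    obtain ⟨k, hk⟩ := Finset.dvd_prod_of_mem n (Finset.mem_univ ⟨y, hy⟩)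
    refine ⟨r, hr, k • x ⟨y, hy⟩, ?_⟩
    rw [map_nsmul, hx, smul_smul, smul_smul, mul_comm k, ← hk, hb, mul_comm r]
  | zero => exact ⟨1, one_mem _, 0, by simp⟩
  | add y z _ _ hy hz =>
    obtain ⟨t, ht, x, hx⟩ := hy
    obtain ⟨t', ht', x', hx'⟩ := hz
    refine ⟨t * t', mul_mem ht ht', t' • x + t • x', ?_⟩
    rw [map_add, map_nsmul, map_nsmul, hx, hx', map_add, smul_add, smul_add, mul_smul,
      mul_smul, smul_comm t' t]
  | smul a y _ hy =>
    obtain ⟨t, ht, x, hx⟩ := hy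
    obtain ⟨t', ht', m, hm⟩ := (isLocRing_zLoc p).surj a
    refine ⟨t * t', mul_mem ht ht', m • x, ?_⟩
    have h1 : t' • a • y = m • y := by
      rw [← Nat.cast_smul_eq_nsmul (ZLoc p), smul_smul, hm, Int.cast_smul_eq_zsmul]
    rw [map_zsmul, hx, mul_smul, smul_comm t', ← map_nsmul _ t', h1, map_zsmul, smul_comm m t,
      smul_comm m ((p : ℕ) ^ b)]

end Values

/-- A family of local modules with a common rationalization, almost all of which are localizations
of the same lattice, is the family of localizations of a cubic module. -/
theorem exists_glue {N : (p : Nat.Primes) → (Fab ⥤ ModuleCat.{u} (ZLoc p))}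
    (hN : ∀ p, IsWeaklyAlternative (N p)) {V : Fab ⥤ ModuleCat.{u} ℚ}
    {L : Fab ⥤ ModuleCat.{u} ℤ} (hL : IsWeaklyAlternative L) (κ : LocMap nonzeroNat L V)
    (j : ∀ p, LocMap nonzeroNat (N p) V) (P : Finset Nat.Primes)
    (hP : ∀ p ∉ P, IsTorsionFree (N p) ∧ ∃ ι : LocMap (primeTo p) L (N p),
      ∀ A x, (j p).app A (ι.app A x) = κ.app A x) :
    ∃ M : Fab ⥤ ModuleCat.{u} ℤ, IsWeaklyAlternative M ∧
      ∀ p, Nonempty (LocMap (primeTo p) M (N p)) := by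
  have hinj (p) (hp : p ∉ P) {A} (y) (hy : (j p).app A y = 0) : y = 0 := by
    have := charZero_zLoc p
    have := (hP p hp).1 A
    obtain ⟨t, ht, hty⟩ := (j p).ker y hy
    exact nsmul_eq_zero_of_isTorsionFree (R := ZLoc p) ht hty
  have hrange (p) (hp : p ∉ P) {A} (y) : ∃ t ∈ primeTo p, ∃ x, κ.app A x = t • (j p).app A y := by
    obtain ⟨ι, hι⟩ := (hP p hp).2
    obtain ⟨t, ht, x, hx⟩ := ι.surj y
    exact ⟨t, ht, x, by rw [← hι, hx, map_nsmul]⟩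
  have hmem (p) (hp : p ∉ P) {A} (v : V.obj A) (t) (ht : t ∈ primeTo p) (x)
      (hx : κ.app A x = t • v) : ∃ y, (j p).app A y = v := by
    obtain ⟨ι, hι⟩ := (hP p hp).2
    obtain ⟨z, hz⟩ := ι.exists_nsmul_eq ht (ι.app A x)
    refine ⟨z, ?_⟩
    rw [← sub_eq_zero]
    refine (j p).eq_zero (primeTo_le p ht) ?_
    rw [smul_sub, ← map_nsmul, hz, hι, hx, sub_self]
  -- The fibre product of all the local modules over their common rationalization.
  let S (A : Fab) : AddSubgroup (V.obj A × ∀ p, (N p).obj A) :=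
    { carrier := {x | ∀ p, (j p).app A (x.2 p) = x.1}
      zero_mem' := fun p => map_zero _
      add_mem' := fun hx hy p => (map_add _ _ _).trans (congrArg₂ _ (hx p) (hy p))
      neg_mem' := fun hx p => (map_neg _ _).trans (congrArg _ (hx p)) }
  let f {A B : Fab} (φ : A ⟶ B) :
      (V.obj A × ∀ p, (N p).obj A) →+ (V.obj B × ∀ p, (N p).obj B) :=
    (V.map φ).hom.toAddMonoidHom.prodMap
      (AddMonoidHom.piMap fun p => ((N p).map φ).hom.toAddMonoidHom)
  let M := ofAddSubgroups (X := fun A => V.obj A × ∀ p, (N p).obj A) f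
    (fun A x => by
      refine Prod.ext ?_ (funext fun p => ?_)
      · exact congrArg (fun g => ModuleCat.Hom.hom g x.1) (V.map_id A)
      · exact congrArg (fun g => ModuleCat.Hom.hom g (x.2 p)) ((N p).map_id A))
    (fun φ ψ x => by
      refine Prod.ext ?_ (funext fun p => ?_)
      · exact congrArg (fun g => ModuleCat.Hom.hom g x.1) (V.map_comp φ ψ)
      · exact congrArg (fun g => ModuleCat.Hom.hom g (x.2 p)) ((N p).map_comp φ ψ)) S
    (fun φ x hx p => by
      refine ((j p).naturality φ (x.2 p)).trans ?_
      rw [hx p]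
      rfl)
  let η (p : Nat.Primes) (A : Fab) : S A →+ (N p).obj A :=
    (Pi.evalAddMonoidHom _ p).comp ((AddMonoidHom.snd _ _).comp (S A).subtype)
  have hηj (p) (A) (x : S A) : (j p).app A (η p A x) = x.1.1 := x.2 p
  have hMalt : IsAlternativeCubic M := .of_injective (fun p => (hN p).isAlternativeCubic) η
    (fun _ _ _ _ _ => rfl) (fun A x hx => by
      refine Subtype.ext (Prod.ext ?_ (funext hx))
      exact (hηj ⟨2, Nat.prime_two⟩ A x).symm.trans ((congrArg _ (hx _)).trans (map_zero _)))
  have hfin (A : Fab) : Module.Finite ℤ (S A) := by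
    choose c hc using fun p => (j p).exists_pow_smul_eq_zero ((hN p).finite A)
    choose b hb using fun p => (j p).exists_pow_smul_mem_range κ ((hN p).finite A)
    -- Outside `P` the rational component of a compatible family already lies in the localized
    -- lattice. Hence `D`, which clears denominators at the finitely many primes of `P`, carries it
    -- into the image of `L(A)`.
    let D : ℕ := ∏ p ∈ P, (p : ℕ) ^ b p
    have hD : D ∈ nonzeroNat := prod_mem fun p _ => pow_ne_zero _ p.2.ne_zero
    let π : S A →ₗ[ℤ] V.obj A :=
      (D • (AddMonoidHom.fst _ _).comp (S A).subtype).toIntLinearMap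
    have hπ (x : S A) : π x = D • x.1.1 := rfl
    have hrangeπ : LinearMap.range π ≤ AddSubgroup.toIntSubmodule (κ.app A).range := by
      rintro _ ⟨x, rfl⟩
      rw [hπ]
      refine mem_of_primeTo (κ.app A).range _ fun p => ?_
      by_cases hp : p ∈ P
      · obtain ⟨t, ht, y, hy⟩ := hb p (η p A x)
        obtain ⟨k, hk⟩ := Finset.dvd_prod_of_mem (fun p : Nat.Primes => (p : ℕ) ^ b p) hp
        refine ⟨t, ht, k • y, ?_⟩
        rw [map_nsmul, hy, hηj, smul_comm, smul_smul k, mul_comm, ← hk]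
      · obtain ⟨t, ht, y, hy⟩ := hrange p hp (η p A x)
        refine ⟨t, ht, D • y, ?_⟩
        rw [map_nsmul, hy, hηj, smul_comm]
    have hLA := hL.finite A
    have hNA := fun p => (hN p).finite A
    -- A family with rational component zero has torsion entries. They vanish outside `P` and are
    -- killed by `p ^ c p` for `p ∈ P`, so the kernel of `π` embeds in a finite product of finitely
    -- generated groups.
    let K (p : P) : Submodule (ZLoc p) ((N p).obj A) :=
      LinearMap.ker (((p : ℕ) ^ c p) • (LinearMap.id : (N p).obj A →ₗ[ZLoc p] (N p).obj A))
    have hK (p : P) : Module.Finite ℤ (K p) :=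
      finite_int_of_pow (c p) fun x => Subtype.ext x.2
    have hker (x : S A) (hx : π x = 0) (p) : (j p).app A (η p A x) = 0 := by
      rw [hηj]
      exact κ.eq_zero hD hx
    let g : LinearMap.ker π →+ ∀ p : P, K p :=
      { toFun := fun x p => ⟨η p A x, hc p _ (hker x x.2 p)⟩
        map_zero' := rfl
        map_add' := fun _ _ => rfl }
    have hg : Function.Injective g.toIntLinearMap := by
      rw [injective_iff_map_eq_zero]
      intro x hx
      refine Subtype.ext (Subtype.ext (Prod.ext ?_ (funext fun p => ?_)))
      · exact (hηj ⟨2, Nat.prime_two⟩ A x).symm.trans (hker x x.2 _)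
      · by_cases hp : p ∈ P
        · exact congrArg (fun y : ∀ p : P, K p => (y ⟨p, hp⟩ : (N p).obj A)) hx
        · exact hinj p hp _ (hker x x.2 p)
    have hkerfin : Module.Finite ℤ (LinearMap.ker π) := Module.Finite.of_injective _ hg
    refine ⟨Submodule.fg_of_fg_map_of_fg_inf_ker π ?_ ?_⟩
    · rw [Submodule.map_top]
      exact (fg_range (κ.app A)).of_le hrangeπ
    · rw [top_inf_eq]
      exact Module.Finite.iff_fg.1 hkerfin
  refine ⟨M, ⟨hfin, hMalt.reduced, hMalt.cubic, hMalt.vanish⟩, fun q => ⟨⟨η q, fun _ _ => rfl,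
    fun ht _ _ h => (isLocRing_zLoc q).eq_zero_of_nsmul ht h,
    fun ht _ y => (isLocRing_zLoc q).exists_nsmul_eq ht y, fun {A} y => ?_, fun {A} x hx => ?_⟩⟩⟩
  -- A multiple of `y` by an integer prime to `q` must be completed to a compatible family. Write `d
  -- = qᵃ t`. The factor `t` suffices at primes outside `P`, where `qᵃ` is invertible, and `D`
  -- removes the remaining denominators at primes of `P` other than `q`.
  · obtain ⟨d, hd, x₀, hx₀⟩ := κ.surj ((j q).app A y)
    obtain ⟨a, t, ht, rfl⟩ := exists_eq_pow_mul q hd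
    choose b z hz using fun p => (j p).exists_pow_smul_mem (t • (j q).app A y)
    let D : ℕ := ∏ p ∈ P.erase q, (p : ℕ) ^ b p
    have hD : D ∈ primeTo q :=
      prod_mem fun p hp => pow_mem_primeTo (Finset.ne_of_mem_erase hp) _
    have hx (p) (hpq : p ≠ q) : ∃ x, (j p).app A x = (D * t) • (j q).app A y := by
      by_cases hp : p ∈ P
      · obtain ⟨k, hk⟩ := Finset.dvd_prod_of_mem (fun p : Nat.Primes => (p : ℕ) ^ b p)
          (Finset.mem_erase.2 ⟨hpq, hp⟩)
        refine ⟨k • z p, ?_⟩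
        rw [map_nsmul, hz, smul_smul, mul_comm k, ← hk, mul_smul]
      · refine hmem p hp _ ((q : ℕ) ^ a) (pow_mem_primeTo hpq.symm a) (D • x₀) ?_
        rw [map_nsmul, hx₀, smul_smul, smul_smul, mul_left_comm]
    choose! x hx using hx
    refine ⟨D * t, mul_mem hD ht, ⟨((D * t) • (j q).app A y,
      Function.update x q ((D * t) • y)), fun p => ?_⟩, ?_⟩
    · by_cases hp : p = q
      · subst hp
        simp only [Function.update_self, map_nsmul]
      · simp only [Function.update_of_ne hp, hx p hp]
    · exact Function.update_self q _ x
  · choose c hc using fun p => (j p).exists_pow_smul_eq_zero ((hN p).finite A)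
    have hv : x.1.1 = 0 := 
      (hηj q A x).symm.trans ((congrArg _ hx).trans (map_zero _))
    refine ⟨∏ p ∈ P.erase q, (p : ℕ) ^ c p,
      prod_mem fun p hp => pow_mem_primeTo (Finset.ne_of_mem_erase hp) _,
      Subtype.ext (Prod.ext ?_ (funext fun p => ?_))⟩
    · change (_ : ℕ) • x.1.1 = 0
      rw [hv, smul_zero]
    · change (_ : ℕ) • x.1.2 p = 0
      have hjp : (j p).app A (x.1.2 p) = 0 := (x.2 p).trans hv
      by_cases hpq : p = q
      · subst hpq
        exact (congrArg _ hx).trans (smul_zero _)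
      · by_cases hp : p ∈ P
        · obtain ⟨k, hk⟩ := Finset.dvd_prod_of_mem (fun p : Nat.Primes => (p : ℕ) ^ c p)
            (Finset.mem_erase.2 ⟨hpq, hp⟩)
          rw [hk, mul_comm, mul_smul, hc p _ hjp, smul_zero]
        · rw [hinj p hp _ hjp, smul_zero]

/-! ### Torsion -/

lemma IsLocRing.mem_torsion_iff {T : Submonoid ℕ} {R : Type} [CommRing R] [IsDomain R] [CharZero R]
    (hR : IsLocRing T R) (hT : T ≤ nonzeroNat) {W : Type*} [AddCommGroup W] [Module R W] (x : W) :
    x ∈ Submodule.torsion R W ↔ ∃ n ∈ nonzeroNat, n • x = 0 := by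
  constructor
  · rintro ⟨a, ha⟩
    obtain ⟨t, ht, n, hn⟩ := hR.surj a
    have hn0 : n ≠ 0 := by
      rintro rfl
      rw [Int.cast_zero, mul_eq_zero] at hn
      exact hn.elim (by exact_mod_cast hT ht) (nonZeroDivisors.ne_zero a.2)
    refine ⟨n.natAbs, Int.natAbs_ne_zero.2 hn0, natAbs_nsmul_eq_zero.2 ?_⟩
    have ha' : (a : R) • x = 0 := ha
    rw [← Int.cast_smul_eq_zsmul R, ← hn, mul_smul, ha', smul_zero]
  · rintro ⟨n, hn, h⟩
    refine ⟨⟨n, mem_nonZeroDivisors_of_ne_zero (Nat.cast_ne_zero.2 hn)⟩, ?_⟩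
    exact (Nat.cast_smul_eq_nsmul R n x).trans h

/-- The primes dividing a natural number. -/
def primesDividing (n : ℕ) : Finset Nat.Primes := n.primeFactors.subtype Nat.Prime

lemma mem_primesDividing {n : ℕ} (hn : n ≠ 0) (p : Nat.Primes) :
    p ∈ primesDividing n ↔ n ∉ primeTo p := by
  refine Finset.mem_subtype.trans ?_
  rw [mem_primeTo, not_not]
  exact ⟨fun h => (Nat.mem_primeFactors.1 h).2.1, fun h => Nat.mem_primeFactors.2 ⟨p.2, h, hn⟩⟩

section Torsion

variable {M : Fab ⥤ ModuleCat.{u} ℤ} {N : (p : Nat.Primes) → (Fab ⥤ ModuleCat.{u} (ZLoc p))}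

lemma mem_torsion_zLoc_iff {p : Nat.Primes} {W : Type*} [AddCommGroup W] [Module (ZLoc p) W]
    (x : W) : x ∈ Submodule.torsion (ZLoc p) W ↔ ∃ n ∈ nonzeroNat, n • x = 0 :=
  have := charZero_zLoc p
  (isLocRing_zLoc p).mem_torsion_iff (primeTo_le p) x

lemma mem_torsion_int_iff {W : Type*} [AddCommGroup W] [Module ℤ W]
    (x : W) : x ∈ Submodule.torsion ℤ W ↔ ∃ n ∈ nonzeroNat, n • x = 0 :=
  IsLocRing.int.mem_torsion_iff bot_le x

/-- The restriction of a localization map to torsion. -/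
def torsionApp (η : ∀ p, LocMap (primeTo p) M (N p)) (p : Nat.Primes) (A : Fab) :
    Submodule.torsion ℤ (M.obj A) →+ Submodule.torsion (ZLoc p) ((N p).obj A) where
  toFun x := ⟨(η p).app A x, by
    obtain ⟨n, hn, h⟩ := (mem_torsion_int_iff (x : M.obj A)).1 x.2
    exact (mem_torsion_zLoc_iff _).2 ⟨n, hn, by rw [← map_nsmul, h, map_zero]⟩⟩
  map_zero' := Subtype.ext (map_zero _)
  map_add' x y := Subtype.ext (map_add _ _ _)

lemma exists_nsmul_torsion (A : Fab) (hM : Module.Finite ℤ (M.obj A)) :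
    ∃ n ∈ nonzeroNat, ∀ x : M.obj A, ∀ d ∈ nonzeroNat, d • x = 0 → n • x = 0 := by
  obtain ⟨r, hr, h⟩ := exists_torsion_exponent (M.obj A)
  refine ⟨r.natAbs, Int.natAbs_ne_zero.2 hr, fun x d hd hx => natAbs_nsmul_eq_zero.2 ?_⟩
  exact h x d (by exact_mod_cast hd) (by rw [natCast_zsmul, hx])

lemma exists_torsion_hom (η : ∀ p, LocMap (primeTo p) M (N p)) (A : Fab)
    (hM : Module.Finite ℤ (M.obj A)) :
    ∃ Φ : Submodule.torsion ℤ (M.obj A) →+ ⨁ p, Submodule.torsion (ZLoc p) ((N p).obj A),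
      ∀ x p, Φ x p = torsionApp η p A x := by
  classical
  obtain ⟨n, hn, hnx⟩ := exists_nsmul_torsion A hM
  -- At primes not dividing the torsion exponent `n` the torsion of `M(A)` maps to zero, so the
  -- family has finite support.
  refine ⟨∑ p ∈ primesDividing n, (DirectSum.of (fun p => Submodule.torsion (ZLoc p)
    ((N p).obj A)) p).comp (torsionApp η p A), fun x q => ?_⟩
  rw [AddMonoidHom.finsetSum_apply, DirectSum.sum_apply]
  simp only [AddMonoidHom.comp_apply]
  by_cases hq : q ∈ primesDividing n
  · rw [Finset.sum_eq_single q]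
    · rw [DirectSum.of_eq_same]
    · intro p _ hp
      exact DirectSum.of_eq_of_ne _ _ _ hp.symm
    · exact fun h => absurd hq h
  · rw [Finset.sum_eq_zero]
    · rw [mem_primesDividing hn, not_not] at hq
      obtain ⟨d, hd, hx⟩ := (mem_torsion_int_iff (x : M.obj A)).1 x.2
      refine (Subtype.ext ((η q).eq_zero hq ?_)).symm
      change n • (η q).app A x = 0
      rw [← map_nsmul, hnx x d hd hx, map_zero]
    · intro p hp
      exact DirectSum.of_eq_of_ne _ _ _ fun h => hq (h ▸ hp)

lemma exists_torsion_preimage (η : ∀ p, LocMap (primeTo p) M (N p)) (A : Fab) (p : Nat.Primes)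
    (y : Submodule.torsion (ZLoc p) ((N p).obj A)) :
    ∃ x, torsionApp η p A x = y ∧ ∀ q ≠ p, torsionApp η q A x = 0 := by
  obtain ⟨n, hn, hy⟩ := (mem_torsion_zLoc_iff (y : (N p).obj A)).1 y.2
  obtain ⟨k, s, hs, rfl⟩ := exists_eq_pow_mul p hn
  have hpy : (p : ℕ) ^ k • (y : (N p).obj A) = 0 :=
    (η p).eq_zero hs (by rw [smul_smul, mul_comm]; exact hy)
  obtain ⟨t, ht, x, hx⟩ := (η p).surj (y : (N p).obj A)
  obtain ⟨t', ht', hx'⟩ := (η p).ker ((p : ℕ) ^ k • x) (by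
    rw [map_nsmul, hx, smul_comm, hpy, smul_zero])
  -- The preimage is `u t' x` where `u t t' + v pᵏ = 1`. At `p` it maps to `u t t' y = y`; being
  -- killed by `pᵏ`, it vanishes at every other prime.
  obtain ⟨u, v, huv⟩ := isCoprime_pow_of_mem (mul_mem ht ht') k
  have hz : (p : ℕ) ^ k • u • t' • x = 0 := by
    rw [smul_comm, smul_comm _ t', hx', zsmul_zero]
  refine ⟨⟨u • t' • x, (mem_torsion_int_iff _).2 ⟨_, pow_ne_zero k p.2.ne_zero, hz⟩⟩,
    Subtype.ext ?_, fun q hq => Subtype.ext ((η q).eq_zero (pow_mem_primeTo hq.symm k) ?_)⟩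
  · change (η p).app A (u • t' • x) = y
    rw [map_zsmul, map_nsmul, hx]
    conv_rhs => rw [← one_zsmul (y : (N p).obj A), ← huv, add_zsmul, mul_zsmul, mul_zsmul,
      natCast_zsmul, natCast_zsmul, hpy, zsmul_zero, add_zero, mul_comm, mul_smul]
  · change (p : ℕ) ^ k • (η q).app A (u • t' • x) = 0
    rw [← map_nsmul, hz, map_zero]

/-- The torsion of a cubic module is the direct sum of the torsion of its localizations. -/
theorem nonempty_torsion_iso (hM : ∀ A, Module.Finite ℤ (M.obj A))
    (η : ∀ p, LocMap (primeTo p) M (N p)) :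
    Nonempty (torsion M ≅ directSum fun p : Nat.Primes => toInt (torsion (N p))) := by
  choose Φ hΦ using fun A => exists_torsion_hom η A (hM A)
  have hbij (A : Fab) : Function.Bijective (Φ A) := by
    constructor
    · rw [injective_iff_map_eq_zero]
      intro x hx
      refine Subtype.ext ((AddSubgroup.mem_bot).1 (mem_of_primeTo ⊥ (x : M.obj A) fun p => ?_))
      have h : torsionApp η p A x = 0 := by
        rw [← hΦ, hx]
        rfl
      obtain ⟨t, ht, h⟩ := (η p).ker (x : M.obj A) (congrArg Subtype.val h)
      exact ⟨t, ht, AddSubgroup.mem_bot.2 h⟩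
    · intro y
      induction y using DirectSum.induction_on with
      | zero => exact ⟨0, map_zero _⟩
      | of p y =>
        obtain ⟨x, hx, hx'⟩ := exists_torsion_preimage η A p y
        refine ⟨x, DFinsupp.ext fun q => ?_⟩
        refine (hΦ A x q).trans ?_
        by_cases hq : q = p
        · subst hq
          rw [hx]
          exact (DirectSum.of_eq_same (β := fun p => Submodule.torsion (ZLoc p) ((N p).obj A))
            q y).symm
        · rw [hx' q hq]
          exact (DirectSum.of_eq_of_ne (β := fun p => Submodule.torsion (ZLoc p) ((N p).obj A))
            p q y hq).symm
      | add y z hy hz =>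
        obtain ⟨x, rfl⟩ := hy
        obtain ⟨x', rfl⟩ := hz
        exact ⟨x + x', map_add _ _ _⟩
  choose g hg using fun A => IsLocRing.exists_hom (X := (torsion M).obj A)
    (N := (directSum fun p : Nat.Primes => toInt (torsion (N p))).obj A) (Φ A)
  have hgbij (A : Fab) : Function.Bijective (g A).hom := by
    rw [show ⇑(g A).hom = Φ A from funext (hg A)]
    exact hbij A
  refine ⟨NatIso.ofComponents (fun A => (LinearEquiv.ofBijective _ (hgbij A)).toModuleIso)
    fun {A B} φ => ?_⟩
  refine ModuleCat.hom_ext (LinearMap.ext fun x => ?_)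
  change (g B).hom ((torsion M).map φ x) = DirectSum.lmap (fun p : Nat.Primes =>
    ((toInt (torsion (N p))).map φ).hom) ((g A).hom x)
  rw [hg, hg]
  refine DFinsupp.ext fun p => ?_
  refine (hΦ B _ p).trans ?_
  change torsionApp η p B _ = ((toInt (torsion (N p))).map φ).hom (Φ A x p)
  refine Eq.trans ?_ (congrArg ((toInt (torsion (N p))).map φ).hom (hΦ A x p).symm)
  exact Subtype.ext ((η p).naturality φ _)

end Torsion

/-! ### The main theorem -/

/-- The localization map to the rationalization. -/
noncomputable def LocMap.ofRationalization {R : Type} [CommRing R] (F : Fab ⥤ ModuleCat.{u} R) :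
    LocMap nonzeroNat F (rationalization F) :=
  (LocMap.ofBaseChange isLocRing_rat (toInt F)).ofToInt

section Local

variable {M : Fab ⥤ ModuleCat.{u} ℤ} {N : (p : Nat.Primes) → (Fab ⥤ ModuleCat.{u} (ZLoc p))}

lemma nonempty_rationalization_iso (η : ∀ p, LocMap (primeTo p) M (N p)) (p : Nat.Primes) :
    Nonempty (rationalization M ≅ rationalization (N p)) :=
  (LocMap.ofRationalization M).nonempty_iso isLocRing_rat
    ((η p).comp (LocMap.ofRationalization (N p)) (primeTo_le p))

/-- Torsion of `N p` on any `A` is detected on `ℤ³`, and there it comes from the torsion of `M(ℤ³)`.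
One exponent `n` therefore bounds the bad primes uniformly in `A`. -/
lemma finite_not_isTorsionFree (hM : IsWeaklyAlternative M) (hN : ∀ p, IsWeaklyAlternative (N p))
    (η : ∀ p, LocMap (primeTo p) M (N p)) : {p : Nat.Primes | ¬ IsTorsionFree (N p)}.Finite := by
  obtain ⟨n, hn, hnx⟩ := exists_nsmul_torsion (Zn 3) (hM.finite (Zn 3))
  refine (primesDividing n).finite_toSet.subset fun p hp => ?_
  rw [Finset.mem_coe, mem_primesDividing hn]
  refine fun hnp => hp (isTorsionFree_of_nsmul fun A x t ht hx => ?_)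
  refine eq_zero_of_map (hN p).cubic x fun q => ?_
  obtain ⟨s, hs, m, hm⟩ := (η p).surj ((N p).map q x)
  have h1 : t • (N p).map q x = 0 := by
    have h := congrArg ((N p).map q).hom hx
    rw [map_nsmul, map_zero] at h
    exact h
  obtain ⟨v, hv, hvm⟩ := (η p).ker (t • m) (by rw [map_nsmul, hm, smul_comm, h1, smul_zero])
  rw [smul_smul] at hvm
  have h2 := hnx m _ (nonzeroNat.mul_mem (primeTo_le p hv) ht) hvm
  refine (η p).eq_zero hs ?_
  rw [← hm]
  refine (η p).eq_zero hnp ?_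
  rw [← map_nsmul, h2, map_zero]

lemma exists_of_rationalization (hN : ∀ p, IsWeaklyAlternative (N p))
    (hfin : {p : Nat.Primes | ¬ IsTorsionFree (N p)}.Finite)
    (hrat : ∀ p q : Nat.Primes, Nonempty (rationalization (N p) ≅ rationalization (N q))) :
    ∃ M : Fab ⥤ ModuleCat.{u} ℤ, IsWeaklyAlternative M ∧
      ∀ p, Nonempty (LocMap (primeTo p) M (N p)) := by
  classical
  let p₂ : Nat.Primes := ⟨2, Nat.prime_two⟩
  let p₃ : Nat.Primes := ⟨3, Nat.prime_three⟩
  let V := rationalization (N p₂)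
  let θ (p : Nat.Primes) : LocMap nonzeroNat (N p) V :=
    (LocMap.ofRationalization (N p)).compIso (hrat p p₂).some
  -- The exceptional primes are 2 and 3, where 6 is not invertible, and those at which torsion
  -- occurs.
  let P : Finset Nat.Primes := insert p₂ (insert p₃ hfin.toFinset)
  obtain ⟨L, κ, hL, hκ⟩ := exists_lattice (isLocRing_zLoc p₂) (primeTo_le p₂) (hN p₂) (θ p₂)
  have hj (p : Nat.Primes) : ∃ j : LocMap nonzeroNat (N p) V, p ∉ P → IsTorsionFree (N p) ∧
      ∃ ι : LocMap (primeTo p) L (N p), ∀ A x, j.app A (ι.app A x) = κ.app A x := by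
    by_cases hp : p ∈ P
    · exact ⟨θ p, fun h => absurd hp h⟩
    · simp only [P, Finset.mem_insert, Set.Finite.mem_toFinset, Set.mem_ofPred_eq, not_or,
        not_not] at hp
      obtain ⟨ι, j, h⟩ := exists_locMap_of_isTorsionFree (fun h => hp.1 (Subtype.ext h))
        (fun h => hp.2.1 (Subtype.ext h)) hL κ hκ (hN p) hp.2.2 (θ p)
      exact ⟨j, fun _ => ⟨hp.2.2, ι, h⟩⟩
  choose j hj using hj
  exact exists_glue hN hL κ j P hj

end Local

end CubicFunctor

theorem mainTheorem10 :
    (∀ M N : Fab ⥤ ModuleCat.{u} ℤ, IsWeaklyAlternative M → IsWeaklyAlternative N →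
      (Nonempty (M ≅ N) ↔
        ∀ p : Nat.Primes, Nonempty (localization p M ≅ localization p N))) ∧
    (∀ N : (p : Nat.Primes) → (Fab ⥤ ModuleCat.{u} (ZLoc p)),
      (∀ p, IsWeaklyAlternative (N p)) →
      ((∃ M : Fab ⥤ ModuleCat.{u} ℤ, IsWeaklyAlternative M ∧
          ∀ p, Nonempty (localization p M ≅ N p)) ↔
        ({p : Nat.Primes | ¬ IsTorsionFree (N p)}.Finite ∧
          ∀ p q : Nat.Primes, Nonempty (rationalization (N p) ≅ rationalization (N q)))) ∧
      (∀ M : Fab ⥤ ModuleCat.{u} ℤ, IsWeaklyAlternative M →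
        (∀ p, Nonempty (localization p M ≅ N p)) →
        (∀ p, Nonempty (rationalization M ≅ rationalization (N p))) ∧
          Nonempty (torsion M ≅ directSum fun p : Nat.Primes => toInt (torsion (N p))))) := by
  have hη {M : Fab ⥤ ModuleCat.{u} ℤ} {N : (p : Nat.Primes) → (Fab ⥤ ModuleCat.{u} (ZLoc p))}
      (e : ∀ p, Nonempty (localization p M ≅ N p)) (p : Nat.Primes) : LocMap (primeTo p) M (N p) :=
    (LocMap.ofBaseChange (isLocRing_zLoc p) M).compIso (e p).some
  refine ⟨fun M N hM hN => ⟨fun h p => nonempty_iso_baseChange (ZLoc p) h,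
    nonempty_iso_of_localization hM hN⟩, fun N hN => ⟨⟨?_, ?_⟩, fun M hM e =>
      ⟨nonempty_rationalization_iso (hη e), nonempty_torsion_iso hM.finite (hη e)⟩⟩⟩
  · rintro ⟨M, hM, e⟩
    refine ⟨finite_not_isTorsionFree hM hN (hη e), fun p q => ?_⟩
    obtain ⟨a⟩ := nonempty_rationalization_iso (hη e) p
    obtain ⟨b⟩ := nonempty_rationalization_iso (hη e) q
    exact ⟨a.symm ≪≫ b⟩
  · rintro ⟨hfin, hrat⟩
    obtain ⟨M, hM, h⟩ := exists_of_rationalization hN hfin hrat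
    exact ⟨M, hM, fun p =>
      (LocMap.ofBaseChange (isLocRing_zLoc p) M).nonempty_iso (isLocRing_zLoc p) (h p).some⟩
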